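/- **Setting.** Let $(X,\mathfrak F,\mu)$ be a $\sigma$-finite atomless measure space. Call $\Delta\in\mathfrak F$ *integrable* if $\mu_\Delta=\mu(\Delta)<\infty$. Let $\mathfrak b$ be a monoid with unit $u$ and an involution $\star$, $(a\cdot c)^\star=c^\star\cdot a^\star$; write $a\star c=a\cdot c^\star$. Let $\mathfrak m$ be the $\star$-monoid (pointwise operations, unit $e\equiv u$) of integrable step maps: maps $g:X\to\mathfrak b$ with countable image, measurable level sets, and support $\{g\ne u\}$ of finite measure. For integrable $\Delta$ let $b_\Delta\in\mathfrak m$ be equal to $b$ on $\Delta$ and to $u$ elsewhere. If $g_1,g_2,\dots\in\mathfrak m$ have mutually disjoint supports, $\bigsqcup g_n$ is the map equal to $g_n$ on the support of $g_n$ and to $u$ elsewhere (considered when it lies in $\mathfrak m$). Let $S$ be a semigroup acting on $X$ by injections $x\mapsto sx$ which are measurable, map measurable sets to measurable sets, and preserve $\mu$ ($\mu(s^{-1}\Delta)=\mu(\Delta)$ for measurable $\Delta\subseteq sX$), and acting on $\mathfrak b$ by unital injective $\star$-endomorphisms $b\mapsto b_s$. For $g\in\mathfrak m$ put $g_s(sx)=g(x)_s$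 and $g_s=u$ off $sX$. A functional $\varphi$ on $\mathfrak m$ is *$S$-homogeneous* if $\varphi(g_s)=\varphi(g)$ for all $s,g$. Fix a *Vitali system*: for each $x$ a filter, written $\Delta\downarrow\{x\}$, on the integrable sets such that (a) for almost every $x$ it is proper, eventually $x\in\Delta$ and $\mu_\Delta>0$, and $\mu_\Delta\to0$; (b) (Vitali covering property) if $A\subseteq X$ has finite outer measure and for each $x\in A$ a family $F_x$ of integrable sets is met frequently as $\Delta\downarrow\{x\}$, then for every $\varepsilon>0$ there are countably many mutually disjoint sets, each taken from some $F_x$, $x\in A$, that cover almost all of $A$ and whose union has measure at most $\mu(A)+\varepsilon$. It is assumed to respect $S$: for each $s$ and almost every $x$, if $\Delta\downarrow\{x\}$ then $s\Delta\downarrow\{sx\}$. We say that *$l_x(b)$ is the Vitali derivative of $\nu_\Delta(b)$* if for almost every $x$ one has $\nu_\Delta(b)/\mu_\Delta\to l_x(b)$ as $\Delta\downarrow\{x\}$ for all $b\in\mathfrak b$ (one null set for all $b$). *Covariance* identities at points $x$, $sx$ below are required for each $s$, for almost every $x$ and all $b$. A *state* over a $\star$-monoid is a functional $\varphi$ with value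 $1$ at the unit and $\sum_{f,h}\kappa_f\varphi(f\star h)\kappa_h^*\ge0$ for all finitely supported $\kappa$. A state over $\mathfrak m$ is *chaotic* if $\varphi(\bigsqcup g_n)=\lim_N\prod_{n\le N}\varphi(g_n)$. A *cumulant functional* over $\mathfrak b$ is a functional $\lambda$ with $\lambda(u)=0$, $\lambda(b^\star)=\lambda(b)^*$ and $\sum_{a,c}\kappa_a\lambda(a\star c)\kappa_c^*\ge0$ for all finitely supported $\kappa$ with $\sum_b\kappa_b=0$. For a field $(K_x)_{x\in X}$ of complex pre-Hilbert spaces, a *pre-Hilbert subspace* of $\int^\oplus K_x\,dx$ is a linear space $K$ of sections, modulo equality almost everywhere, with $x\mapsto\langle\xi(x)|\eta(x)\rangle$ integrable for all $\xi,\eta\in K$; its scalar product is $\int\langle\xi(x)|\eta(x)\rangle dx$. An *isometric representation by fibre maps* consists of linear maps $V_s:K_x\to K_{sx}$, isometric for almost every $x$, such that the induced maps on sections, $(V_s\xi)(sx)=V_s\xi(x)$ and $V_s\xi=0$ off $sX$, satisfy $V_{st}=V_sV_t$ modulo null sets. **Theorem.** Let $\varphi:\mathfrak m\to\mathbb C$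 be an $S$-homogeneous functional, and $\varphi_\Delta(b)=\varphi(b_\Delta)$ for integrable $\Delta$. The following are equivalent. (i) The $\varphi_\Delta$ are infinitely divisible states over $\mathfrak b$, that is, each $\varphi_\Delta$ is a state and $\varphi$ is a chaotic state over $\mathfrak m$ without zeros; $\varphi_\Delta(b)=1$ for all $b$ whenever $\mu_\Delta=0$; and $\varphi_\Delta(b)-1$ has a Vitali derivative $l_x(b)$. (ii) $\lambda=\ln\varphi$ is defined: there is $\lambda:\mathfrak m\to\mathbb C$ with $e^{\lambda(g)}=\varphi(g)$ which is $\sigma$-additive ($\lambda(\bigsqcup g_n)=\sum\lambda(g_n)$, unconditionally), absolutely continuous ($\mu_\Delta=0\Rightarrow\lambda_\Delta(b):=\lambda(b_\Delta)=0$) and $S$-homogeneous, every $\lambda_\Delta$ is a cumulant functional over $\mathfrak b$, and there is an $S$-covariant Radon–Nikodym derivative $l_x(b)=l_{sx}(b_s)$: for all integrable $\Delta$ and all $b$, $x\mapsto l_x(b)$ is integrable on $\Delta$ with $\lambda_\Delta(b)=\int_\Delta l_x(b)\,dx$, and $l_x(b)$ is the Vitali derivative of $\lambda_\Delta(b)$.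 (iii) There are a field $(K_x)$ of pre-Hilbert spaces, a pre-Hilbert subspace $K\subseteq\int^\oplus K_x\,dx$, an isometric representation $V_s$ of $S$ by fibre maps, which maps $K$ isometrically into $K$, and (1) a density $l_x(b)\in\mathbb C$ such that $l_x(g(x))$ is integrable for all $g\in\mathfrak m$, $\lambda(g)=\int l_x(g(x))\,dx$ is $S$-homogeneous with $e^{\lambda(g)}=\varphi(g)$, $l_x(b)$ is the Vitali derivative of $\int_\Delta l_x(b)\,dx$, $l_{sx}(b_s)=l_x(b)$, $l_x(b^\star)=l_x(b)^*$ and $l_x(u)=0$; (2) vectors $k_x(b)\in K_x$ with $k_x(u)=0$, $k_{sx}(b_s)=V_sk_x(b)$, such that $k(g)=\int^\oplus k_x(g(x))\,dx\in K$ for all $g\in\mathfrak m$ and, with $k^\star(g)=\langle k(g^\star)|\,\cdot\,\rangle$, $k^\star(f)k(h)=\lambda(f\cdot h)-\lambda(f)-\lambda(h)$ for all $f,h\in\mathfrak m$; (3) linear operators $j_x(b)$ on $K_x$ with $j_x(u)=I_x$ such that the decomposable operators $j(g)=\int^\oplus j_x(g(x))\,dx$ map $K$ into $K$ and satisfy on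 $K$: $j(g\cdot h)=j(g)j(h)$, $j(g^\star)=j(g)^*$, $j(e)=I$, $V_sj(g)=j(g_s)V_s$, the cocycle identities $j(g)k(h)=k(g\cdot h)-k(g)$ and $k^\star(f)j(g)=k^\star(f\cdot g)-k^\star(g)$, and each $j(g)$ is continuous with respect to the family of seminorms $\|\xi\|^h=\left(\int\|j_x(h(x))\xi(x)\|^2dx\right)^{1/2}$, $h\in\mathfrak m$. (iv) There are a field $(K_x)$ of pre-Hilbert spaces, $l_x(b)\in\mathbb C$, $k_x(b)\in K_x$, linear operators $j_x(b)$ on $K_x$, and an isometric representation $V_s$ of $S$ by fibre maps, where $l_x(g(x))$ is integrable with $\exp\int l_x(g(x))\,dx=\varphi(g)$ for all $g\in\mathfrak m$ and $l_x(b)$ is the Vitali derivative of $\lambda_\Delta(b)=\int_\Delta l_x(b)\,dx$, and for each integrable $\Delta$ a pre-Hilbert subspace $K_\Delta\subseteq\int^\oplus_\Delta K_x\,dx$ such that, with $k_\Delta(b)=\int_\Delta^\oplus k_x(b)\,dx$, $k^\star_\Delta(b)=\langle k_\Delta(b^\star)|\,\cdot\,\rangle$ and $j_\Delta(b)=\int^\oplus_\Delta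 j_x(b)\,dx$, the triangular matrices $$\mathbf j_\Delta(b)=\begin{bmatrix}1&k^\star_\Delta(b)&\lambda_\Delta(b)\\0&j_\Delta(b)&k_\Delta(b)\\0&0&1\end{bmatrix}$$ act on $\mathbb K_\Delta=\mathbb C\oplus K_\Delta\oplus\mathbb C$ and form a unital $\dagger$-representation of $\mathfrak b$: $\mathbf j_\Delta(a\cdot b)=\mathbf j_\Delta(a)\mathbf j_\Delta(b)$, $\mathbf j_\Delta(u)=\mathbf I$, $\mathbf j_\Delta(b^\star)=\mathbf j_\Delta(b)^\dagger$, where $\dagger$ is the adjoint for the Minkowski scalar product $(\mathbf k|\mathbf k')=k_-^*k'_++\langle k_\circ|k'_\circ\rangle+k_+^*k'_-$ of columns $\mathbf k=(k_-,k_\circ,k_+)$; moreover $\lambda_\Delta(b)=(\mathbf e|\mathbf j_\Delta(b)\mathbf e)$ and $e^{\lambda_\Delta(b)}=\varphi_\Delta(b)$, where $\mathbf e=(0,0,1)$, $(\mathbf e|\mathbf e)=0$. Furthermore, for all $s$ and integrable $\Delta$, the block-diagonal operator $\mathbf V_s=\mathrm{diag}(1,V_s,1)$ maps $\mathbb K_\Delta$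 into $\mathbb K_{s\Delta}$, preserves the Minkowski scalar products, and satisfies $\mathbf V_s\mathbf j_\Delta(b)=\mathbf j_{s\Delta}(b_s)\mathbf V_s$ for all $b\in\mathfrak b$. -/

import Mathlib

open MeasureTheory Filter Topology
open scoped ComplexOrder ComplexConjugate ENNReal InnerProductSpace

noncomputable section

namespace LevyField

universe u v w

/-! ### Measurable sets of finite measure, atomless measures, Vitali systems -/

section Base

variable {X : Type v} [MeasurableSpace X]

/-- The integrable sets: measurable sets of finite measure. -/
def IntegrableSet (μ : Measure X) : Type v :=
  {D : Set X // MeasurableSet D ∧ μ D < ∞}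

/-- Every measurable set of positive measure has a measurable subset of strictly smaller
positive measure. (Mathlib's `NoAtoms` only says that points are null sets.) -/
def IsAtomless (μ : Measure X) : Prop :=
  ∀ A, MeasurableSet A → μ A ≠ 0 → ∃ B ⊆ A, MeasurableSet B ∧ 0 < μ B ∧ μ B < μ A

/-- A Vitali system on a measure space: for each point `x` a notion of convergence
`D ↓ {x}` of integrable sets, such that for almost every `x` the sets contain `x` and have
positive measure tending to zero, and such that the (strong) Vitali covering property holds: if
`s` is covered finely by a family of sets, countably many disjoint sets of the family cover
almost all of `s` with arbitrarily small overflow. -/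
structure VitaliSystem (μ : Measure X) where
  filterAt : X → Filter (IntegrableSet μ)
  neBot : ∀ᵐ x ∂μ, (filterAt x).NeBot
  mem_pos : ∀ᵐ x ∂μ, ∀ᶠ D in filterAt x, x ∈ D.1 ∧ 0 < μ D.1
  tendsto_zero : ∀ᵐ x ∂μ, Tendsto (fun D : IntegrableSet μ => μ D.1) (filterAt x) (𝓝 0)
  covering : ∀ (s : Set X) (F : X → Set (IntegrableSet μ)), μ s < ∞ →
    (∀ x ∈ s, ∃ᶠ D in filterAt x, D ∈ F x) → ∀ ε : ℝ≥0∞, 0 < ε →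
    ∃ T : Set (IntegrableSet μ), T.Countable ∧
      (∀ D ∈ T, ∃ x ∈ s, D ∈ F x) ∧
      T.PairwiseDisjoint (fun D => D.1) ∧
      μ (s \ ⋃ D ∈ T, D.1) = 0 ∧
      μ (⋃ D ∈ T, D.1) ≤ μ s + ε

end Base

/-! ### The monoid of integrable step maps -/

/-- Integrable step maps: maps `X → 𝔟` with countable image, measurable level sets, and a support
`{x | g x ≠ 1}` of finite measure. -/
structure StepMap {X : Type v} [MeasurableSpace X] (μ : Measure X) (𝔟 : Type u) [One 𝔟] where
  toFun : X → 𝔟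
  countable_range : (Set.range toFun).Countable
  measurableSet_fiber : ∀ b, MeasurableSet (toFun ⁻¹' {b})
  support_lt_top : μ {x | toFun x ≠ 1} < ∞

namespace StepMap

variable {X : Type v} [MeasurableSpace X] {μ : Measure X} {𝔟 : Type u}

instance [One 𝔟] : CoeFun (StepMap μ 𝔟) (fun _ => X → 𝔟) := ⟨StepMap.toFun⟩

@[ext] theorem ext [One 𝔟] {g h : StepMap μ 𝔟} (H : ∀ x, g x = h x) : g = h := by
  cases g; cases h
  congr
  exact funext H

/-- The support of a step map. -/
def supp [One 𝔟] (g : StepMap μ 𝔟) : Set X := {x | g x ≠ 1}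

theorem measurableSet_preimage [One 𝔟] (g : StepMap μ 𝔟) (A : Set 𝔟) :
    MeasurableSet (g ⁻¹' A) := by
  have h : g ⁻¹' A = ⋃ b ∈ A ∩ Set.range g, g ⁻¹' {b} := by
    ext x; simp
  rw [h]
  exact MeasurableSet.biUnion (g.countable_range.mono Set.inter_subset_right)
    fun b _ => g.measurableSet_fiber b

variable [Monoid 𝔟]

instance : One (StepMap μ 𝔟) where
  one :=
    { toFun := fun _ => 1
      countable_range := (Set.countable_singleton (1 : 𝔟)).mono (by rintro _ ⟨x, rfl⟩; rfl)
      measurableSet_fiber := fun b => MeasurableSet.const ((1 : 𝔟) = b)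
      support_lt_top := by simp }

instance : Mul (StepMap μ 𝔟) where
  mul f h :=
    { toFun := fun x => f x * h x
      countable_range := (f.countable_range.image2 h.countable_range (· * ·)).mono (by
        rintro _ ⟨x, rfl⟩
        exact ⟨f x, ⟨x, rfl⟩, h x, ⟨x, rfl⟩, rfl⟩)
      measurableSet_fiber := fun b => by
        have H : (fun x => f x * h x) ⁻¹' {b} =
            ⋃ a ∈ Set.range f, f ⁻¹' {a} ∩ h ⁻¹' {c | a * c = b} := by
          ext x
          simp only [Set.mem_preimage, Set.mem_singleton_iff, Set.mem_iUnion, Set.mem_inter_iff,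
            Set.mem_ofPred_eq, exists_prop]
          exact ⟨fun H => ⟨f x, ⟨x, rfl⟩, rfl, H⟩, fun ⟨a, _, h1, h2⟩ => by rw [h1, h2]⟩
        rw [H]
        exact MeasurableSet.biUnion f.countable_range fun a _ =>
          (f.measurableSet_fiber a).inter (h.measurableSet_preimage _)
      support_lt_top := by
        refine lt_of_le_of_lt (measure_mono (t := {x | f x ≠ 1} ∪ {x | h x ≠ 1}) ?_)
          (measure_union_lt_top f.support_lt_top h.support_lt_top)
        intro x hx
        by_contra hn
        simp only [Set.mem_union, Set.mem_ofPred_eq, not_or, not_not] at hn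
        exact hx (by simp [hn.1, hn.2]) }

@[simp] theorem one_apply (x : X) : (1 : StepMap μ 𝔟) x = 1 := rfl

@[simp] theorem mul_apply (f h : StepMap μ 𝔟) (x : X) : (f * h) x = f x * h x := rfl

instance : Monoid (StepMap μ 𝔟) where
  mul_assoc f g h := ext fun x => mul_assoc _ _ _
  one_mul f := ext fun x => one_mul _
  mul_one f := ext fun x => mul_one _

/-- The `b`-valued indicator `b_D` of an integrable set `D`: equal to `b` on `D` and to the unit
elsewhere. -/
def ind (b : 𝔟) (D : IntegrableSet μ) : StepMap μ 𝔟 := by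
  classical
  exact
    { toFun := fun x => if x ∈ D.1 then b else 1
      countable_range := ((Set.countable_singleton (1 : 𝔟)).insert b).mono (by
        rintro _ ⟨x, rfl⟩
        by_cases h : x ∈ D.1 <;> simp [h])
      measurableSet_fiber := fun c => by
        have H : (fun x => if x ∈ D.1 then b else 1) ⁻¹' {c} =
            (D.1 ∩ {_x | b = c}) ∪ (D.1ᶜ ∩ {_x | (1 : 𝔟) = c}) := by
          ext x
          by_cases h : x ∈ D.1 <;> simp [h]
        rw [H]
        exact (D.2.1.inter (MeasurableSet.const _)).union
          (D.2.1.compl.inter (MeasurableSet.const _))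
      support_lt_top := by
        refine lt_of_le_of_lt (measure_mono ?_) D.2.2
        intro x hx
        by_contra h
        exact hx (by simp [h]) }

theorem ind_of_mem (b : 𝔟) (D : IntegrableSet μ) {x : X} (h : x ∈ D.1) : ind b D x = b := by
  simp [ind, h]

theorem ind_of_notMem (b : 𝔟) (D : IntegrableSet μ) {x : X} (h : x ∉ D.1) : ind b D x = 1 := by
  simp [ind, h]

/-- `h = ⊔ g n`: the supports of the `g n` are mutually disjoint, `h` agrees with `g n` on the
support of `g n`, and `h` is the unit off the union of the supports. -/
def IsJoin (g : ℕ → StepMap μ 𝔟) (h : StepMap μ 𝔟) : Prop :=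
  Pairwise (fun m n => Disjoint (supp (g m)) (supp (g n))) ∧
  (∀ n, ∀ x ∈ supp (g n), h x = g n x) ∧
  (∀ x, (∀ n, x ∉ supp (g n)) → h x = 1)

variable [StarMul 𝔟]

instance : Star (StepMap μ 𝔟) where
  star g :=
    { toFun := fun x => star (g x)
      countable_range := (g.countable_range.image star).mono (by
        rintro _ ⟨x, rfl⟩
        exact ⟨g x, ⟨x, rfl⟩, rfl⟩)
      measurableSet_fiber := fun b => g.measurableSet_preimage (star ⁻¹' {b})
      support_lt_top := by
        refine lt_of_le_of_lt (measure_mono ?_) g.support_lt_top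
        intro x hx h
        exact hx (by simp [h]) }

@[simp] theorem star_apply (g : StepMap μ 𝔟) (x : X) : (star g) x = star (g x) := rfl

instance : StarMul (StepMap μ 𝔟) where
  star_involutive _ := ext fun _ => star_star _
  star_mul _ _ := ext fun _ => star_mul _ _

end StepMap

/-! ### States and cumulant functionals -/

section States

variable {M : Type w} [Monoid M] [StarMul M]

/-- A (generating) state over a `⋆`-monoid: normalised and positive definite. -/
def IsState (φ : M → ℂ) : Prop :=
  φ 1 = 1 ∧
  ∀ κ : M →₀ ℂ,
    0 ≤ ∑ f ∈ κ.support, ∑ h ∈ κ.support, κ f * φ (f * star h) * conj (κ h)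

/-- A cumulant generating functional over a `⋆`-monoid: conditionally positive definite, zero at the
unit, and Hermitian. -/
def IsCumulant (lam : M → ℂ) : Prop :=
  (∀ κ : M →₀ ℂ, ∑ b ∈ κ.support, κ b = 0 →
    0 ≤ ∑ a ∈ κ.support, ∑ c ∈ κ.support, κ a * lam (a * star c) * conj (κ c)) ∧
  lam 1 = 0 ∧
  ∀ b, lam (star b) = conj (lam b)

end States

/-! ### The symmetry semigroup -/

/-- An action of the symmetry semigroup `S` on the measure space `X` by measure-preserving
measurable injections `x ↦ s x` (which map measurable sets to measurable sets) together with a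
representation of `S` by unital injective `⋆`-endomorphisms `θ s` of the `⋆`-monoid `𝔟`. -/
structure Symmetry (S : Type w) [Semigroup S] {X : Type v} [MeasurableSpace X] (μ : Measure X)
    (𝔟 : Type u) [Monoid 𝔟] [StarMul 𝔟] where
  act : S → X → X
  act_mul : ∀ s t x, act (s * t) x = act s (act t x)
  measurableEmbedding : ∀ s, MeasurableEmbedding (act s)
  measure_preimage : ∀ s (D : Set X), MeasurableSet D → D ⊆ Set.range (act s) →
    μ (act s ⁻¹' D) = μ D
  θ : S → 𝔟 →* 𝔟
  θ_mul : ∀ s t b, θ (s * t) b = θ s (θ t b)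
  θ_star : ∀ s b, θ s (star b) = star (θ s b)
  θ_injective : ∀ s, Function.Injective (θ s)

namespace Symmetry

variable {S : Type w} [Semigroup S] {X : Type v} [MeasurableSpace X] {μ : Measure X}
  {𝔟 : Type u} [Monoid 𝔟] [StarMul 𝔟]

theorem measure_image (σ : Symmetry S μ 𝔟) (s : S) {D : Set X} (hD : MeasurableSet D) :
    μ (σ.act s '' D) = μ D := by
  have h := σ.measure_preimage s (σ.act s '' D)
    ((σ.measurableEmbedding s).measurableSet_image.2 hD) (Set.image_subset_range _ _)
  rw [Set.preimage_image_eq _ (σ.measurableEmbedding s).injective] at h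
  exact h.symm

/-- The image `sD` of an integrable set. -/
def image (σ : Symmetry S μ 𝔟) (s : S) (D : IntegrableSet μ) : IntegrableSet μ :=
  ⟨σ.act s '' D.1, (σ.measurableEmbedding s).measurableSet_image.2 D.2.1,
    (σ.measure_image s D.2.1).trans_lt D.2.2⟩

/-- The underlying map of `g_s`: `g_s (s x) = θ s (g x)`, and `g_s = 1` off `sX`. -/
def shiftFun (σ : Symmetry S μ 𝔟) (s : S) (g : X → 𝔟) : X → 𝔟 :=
  Function.extend (σ.act s) (fun x => σ.θ s (g x)) (fun _ => 1)

theorem shiftFun_act (σ : Symmetry S μ 𝔟) (s : S) (g : X → 𝔟) (x : X) :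
    σ.shiftFun s g (σ.act s x) = σ.θ s (g x) :=
  (σ.measurableEmbedding s).injective.extend_apply _ _ _

theorem shiftFun_of_notMem (σ : Symmetry S μ 𝔟) (s : S) (g : X → 𝔟) {y : X}
    (hy : y ∉ Set.range (σ.act s)) : σ.shiftFun s g y = 1 :=
  Function.extend_apply' _ _ _ hy

/-- The induced action `g ↦ g_s` on step maps. -/
def shift (σ : Symmetry S μ 𝔟) (s : S) (g : StepMap μ 𝔟) : StepMap μ 𝔟 where
  toFun := σ.shiftFun s g
  countable_range := ((g.countable_range.image (σ.θ s)).insert 1).mono (by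
    rintro _ ⟨y, rfl⟩
    by_cases hy : y ∈ Set.range (σ.act s)
    · obtain ⟨x, rfl⟩ := hy
      rw [σ.shiftFun_act]
      exact Or.inr ⟨g x, ⟨x, rfl⟩, rfl⟩
    · rw [σ.shiftFun_of_notMem s g hy]
      exact Or.inl rfl)
  measurableSet_fiber := fun b => by
    have H : σ.shiftFun s g ⁻¹' {b} =
        σ.act s '' (g ⁻¹' (σ.θ s ⁻¹' {b})) ∪ ((Set.range (σ.act s))ᶜ ∩ {_y | (1 : 𝔟) = b}) := by
      ext y
      by_cases hy : y ∈ Set.range (σ.act s)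
      · obtain ⟨x, rfl⟩ := hy
        simp [σ.shiftFun_act, (σ.measurableEmbedding s).injective.eq_iff]
      · have hy' : ∀ x, σ.act s x ≠ y := fun x hx => hy ⟨x, hx⟩
        simp [σ.shiftFun_of_notMem s g hy, hy']
    rw [H]
    exact ((σ.measurableEmbedding s).measurableSet_image.2 (g.measurableSet_preimage _)).union
      ((σ.measurableEmbedding s).measurableSet_range.compl.inter (MeasurableSet.const _))
  support_lt_top := by
    have hm : MeasurableSet {x | g x ≠ 1} := g.measurableSet_preimage {b | b ≠ 1}
    refine lt_of_le_of_lt (measure_mono (t := σ.act s '' {x | g x ≠ 1}) ?_)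
      ((σ.measure_image s hm).trans_lt g.support_lt_top)
    intro y hy
    by_cases hr : y ∈ Set.range (σ.act s)
    · obtain ⟨x, rfl⟩ := hr
      refine ⟨x, fun h => hy ?_, rfl⟩
      rw [σ.shiftFun_act, h, map_one]
    · exact absurd (σ.shiftFun_of_notMem s g hr) hy

/-- A functional on the step maps is `S`-homogeneous. -/
def IsHomogeneous (σ : Symmetry S μ 𝔟) (φ : StepMap μ 𝔟 → ℂ) : Prop :=
  ∀ s g, φ (σ.shift s g) = φ g

/-- The symmetry semigroup respects the Vitali system: for almost every `x`, if `D ↓ {x}` then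
`sD ↓ {sx}`. -/
def Respects (σ : Symmetry S μ 𝔟) (V : VitaliSystem μ) : Prop :=
  ∀ s, ∀ᵐ x ∂μ, Tendsto (σ.image s) (V.filterAt x) (V.filterAt (σ.act s x))

/-- A density `l x b` is `S`-covariant: `l (s x) (b_s) = l x b`. -/
def IsCovariantDensity (σ : Symmetry S μ 𝔟) (l : X → 𝔟 → ℂ) : Prop :=
  ∀ s, ∀ᵐ x ∂μ, ∀ b, l (σ.act s x) (σ.θ s b) = l x b

end Symmetry

/-! ### Direct integrals of pre-Hilbert spaces

`E : X → Type*` is a field of pre-Hilbert spaces. Elements of a direct integral are classes of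
sections modulo equality almost everywhere. -/

section DirectIntegral

variable {X : Type v} [MeasurableSpace X] (μ : Measure X)
  (E : X → Type u) [∀ x, NormedAddCommGroup (E x)] [∀ x, InnerProductSpace ℂ (E x)]

/-- The sections vanishing almost everywhere. -/
def nullSections : Submodule ℂ (∀ x, E x) where
  carrier := {ξ | ∀ᵐ x ∂μ, ξ x = 0}
  add_mem' := by
    intro ξ η hξ hη
    change ∀ᵐ x ∂μ, ξ x + η x = 0
    filter_upwards [hξ, hη] with x h1 h2
    simp [h1, h2]
  zero_mem' := by simp
  smul_mem' := by
    intro c ξ hξ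
    change ∀ᵐ x ∂μ, c • ξ x = 0
    filter_upwards [hξ] with x h1
    simp [h1]

/-- Sections modulo equality almost everywhere. -/
abbrev SectionClass : Type (max v u) := (∀ x, E x) ⧸ nullSections μ E

variable {E}

/-- The class of a section, written `∫^⊕ ξ(x) dx`. -/
def cls (ξ : ∀ x, E x) : SectionClass μ E := Submodule.Quotient.mk ξ

variable {μ}

/-- The scalar product `∫ ⟨ξ(x) | η(x)⟩ dx` (conjugate-linear in the first argument). -/
def sprod (ξ η : SectionClass μ E) : ℂ :=
  Quotient.liftOn₂' ξ η (fun ξ η => ∫ x, ⟪ξ x, η x⟫_ℂ ∂μ) (by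
    intro ξ η ξ' η' h h'
    rw [Submodule.quotientRel_def] at h h'
    refine integral_congr_ae ?_
    filter_upwards [h, h'] with x h1 h2
    rw [Pi.sub_apply, sub_eq_zero] at h1 h2
    simp [h1, h2])

theorem sprod_cls (ξ η : ∀ x, E x) :
    sprod (cls μ ξ) (cls μ η) = ∫ x, ⟪ξ x, η x⟫_ℂ ∂μ := rfl

/-- The decomposable operator `∫^⊕ T(x) dx`. -/
def decomposable (T : ∀ x, E x →ₗ[ℂ] E x) : SectionClass μ E →ₗ[ℂ] SectionClass μ E :=
  Submodule.mapQ _ _ (LinearMap.pi fun x => T x ∘ₗ LinearMap.proj x) (by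
    intro ξ hξ
    change ∀ᵐ x ∂μ, T x (ξ x) = 0
    filter_upwards [show ∀ᵐ x ∂μ, ξ x = 0 from hξ] with x h
    rw [h, map_zero])

theorem decomposable_cls (T : ∀ x, E x →ₗ[ℂ] E x) (ξ : ∀ x, E x) :
    decomposable T (cls μ ξ) = cls μ (fun x => T x (ξ x)) := rfl

/-- A space of classes of sections is a pre-Hilbert subspace of the direct integral
`∫^⊕ E_x dx`: the pointwise scalar products of its elements are (measurable and) integrable. In
particular its elements are square integrable. -/
def IsPreHilbert (K : Submodule ℂ (SectionClass μ E)) : Prop :=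
  ∀ ξ η : ∀ x, E x, cls μ ξ ∈ K → cls μ η ∈ K → Integrable (fun x => ⟪ξ x, η x⟫_ℂ) μ

/-- The Minkowski scalar product on `ℂ ⊕ K ⊕ ℂ`; the components of `(α, ξ, β)` are
`k_- = α`, `k_∘ = ξ`, `k_+ = β`. -/
def minkowski {K : Submodule ℂ (SectionClass μ E)} (p q : ℂ × K × ℂ) : ℂ :=
  conj p.1 * q.2.2 + sprod (p.2.1 : SectionClass μ E) (q.2.1 : SectionClass μ E)
    + conj p.2.2 * q.1

end DirectIntegral

/-! ### Transport of sections along the symmetry semigroup -/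

section Push

variable {S : Type w} [Semigroup S] {X : Type v} [MeasurableSpace X] {μ : Measure X}
  {𝔟 : Type u} [Monoid 𝔟] [StarMul 𝔟] (σ : Symmetry S μ 𝔟)
  {E : X → Type u} [∀ x, NormedAddCommGroup (E x)] [∀ x, InnerProductSpace ℂ (E x)]

open Classical in
/-- The section `V_s ξ` determined by fibre maps `V_s(x) : E_x → E_{sx}`: it is
`V_s(x) ξ(x)` at `s x`, and zero off `sX`. -/
def push (V : ∀ s x, E x →ₗ[ℂ] E (σ.act s x)) (s : S) (ξ : ∀ x, E x) : ∀ x, E x :=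
  fun y => if h : ∃ x, σ.act s x = y then h.choose_spec ▸ V s h.choose (ξ h.choose) else 0

theorem push_act (V : ∀ s x, E x →ₗ[ℂ] E (σ.act s x)) (s : S) (ξ : ∀ x, E x) (x : X) :
    push σ V s ξ (σ.act s x) = V s x (ξ x) := by
  have h : ∃ z, σ.act s z = σ.act s x := ⟨x, rfl⟩
  have key : ∀ z (hz : σ.act s z = σ.act s x), hz ▸ V s z (ξ z) = V s x (ξ x) := by
    intro z hz
    obtain rfl := (σ.measurableEmbedding s).injective hz
    rfl
  unfold push
  rw [dif_pos h]
  exact key _ h.choose_spec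

theorem push_of_notMem (V : ∀ s x, E x →ₗ[ℂ] E (σ.act s x)) (s : S) (ξ : ∀ x, E x) {y : X}
    (hy : ¬ ∃ x, σ.act s x = y) : push σ V s ξ y = 0 := by
  unfold push
  rw [dif_neg hy]

/-- The fibre maps `V_s(x) : E_x → E_{sx}` form an isometric representation of `S`: they are
isometric for almost every `x`, and `V_{st} = V_s V_t` on sections modulo null sets. -/
def IsIsometricRep (V : ∀ s x, E x →ₗ[ℂ] E (σ.act s x)) : Prop :=
  (∀ s, ∀ᵐ x ∂μ, ∀ e, ‖V s x e‖ = ‖e‖) ∧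
  ∀ s t (ξ : ∀ x, E x), cls μ (push σ V (s * t) ξ) = cls μ (push σ V s (push σ V t ξ))

end Push

/-! ### The four conditions -/

section Conditions

variable {S : Type w} [Semigroup S] {X : Type v} [MeasurableSpace X] {μ : Measure X}
  {𝔟 : Type u} [Monoid 𝔟] [StarMul 𝔟]

/-- A chaotic state over the step maps: a state with `φ (⊔ g n) = ∏ φ (g n)`. -/
def IsChaoticState (φ : StepMap μ 𝔟 → ℂ) : Prop :=
  IsState φ ∧
  ∀ (g : ℕ → StepMap μ 𝔟) (h : StepMap μ 𝔟), StepMap.IsJoin g h →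
    Tendsto (fun N => ∏ n ∈ Finset.range N, φ (g n)) atTop (𝓝 (φ h))

/-- `l` is the derivative of the set function `lam` in the sense of the Vitali system: for
almost every `x` and all `b`, `lam D b / μ D → l x b` as `D ↓ {x}`. -/
def IsVitaliDerivative (V : VitaliSystem μ) (lam : IntegrableSet μ → 𝔟 → ℂ)
    (l : X → 𝔟 → ℂ) : Prop :=
  ∀ᵐ x ∂μ, ∀ b,
    Tendsto (fun D : IntegrableSet μ => lam D b / (μ.real D.1 : ℂ)) (V.filterAt x) (𝓝 (l x b))

/-- The functionals `φ_D(b) = φ(b_D)` are infinitely divisible states (they come from a nowhere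
vanishing chaotic state), form an absolutely continuous multiplicative measure, and the limit of
`(φ_D(b) - 1) / μ_D` as `D ↓ {x}` exists. -/
structure InfinitelyDivisibleState (V : VitaliSystem μ) (φ : StepMap μ 𝔟 → ℂ) : Prop where
  isState : ∀ D, IsState (fun b : 𝔟 => φ (StepMap.ind b D))
  chaotic : IsChaoticState φ
  ne_zero : ∀ g, φ g ≠ 0
  absolutelyContinuous : ∀ (D : IntegrableSet μ) (b : 𝔟), μ D.1 = 0 → φ (StepMap.ind b D) = 1
  exists_derivative : ∃ l : X → 𝔟 → ℂ,
    IsVitaliDerivative V (fun D b => φ (StepMap.ind b D) - 1) l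

/-- `lam = ln φ` is an absolutely continuous (`σ`-additive) `S`-homogeneous cumulant generating
functional, with `S`-covariant Radon-Nikodym derivative `l`. -/
structure CumulantFunctional (σ : Symmetry S μ 𝔟) (V : VitaliSystem μ) (φ : StepMap μ 𝔟 → ℂ)
    (lam : StepMap μ 𝔟 → ℂ) (l : X → 𝔟 → ℂ) : Prop where
  exp_eq : ∀ g, Complex.exp (lam g) = φ g
  sigmaAdditive : ∀ (g : ℕ → StepMap μ 𝔟) (h : StepMap μ 𝔟), StepMap.IsJoin g h →
    HasSum (fun n => lam (g n)) (lam h)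
  absolutelyContinuous : ∀ (D : IntegrableSet μ) (b : 𝔟), μ D.1 = 0 → lam (StepMap.ind b D) = 0
  homogeneous : σ.IsHomogeneous lam
  cumulant : ∀ D, IsCumulant (fun b : 𝔟 => lam (StepMap.ind b D))
  integrableOn : ∀ (D : IntegrableSet μ) (b : 𝔟), IntegrableOn (fun x => l x b) D.1 μ
  eq_integral : ∀ (D : IntegrableSet μ) (b : 𝔟), lam (StepMap.ind b D) = ∫ x in D.1, l x b ∂μ
  derivative : IsVitaliDerivative V (fun D b => lam (StepMap.ind b D)) l
  covariant : σ.IsCovariantDensity l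

/-- `λ(g) = ∫ l(x, g) dx` with `l(x, g) = l_x(g(x))`. -/
def integralFunctional (μ : Measure X) (l : X → 𝔟 → ℂ) (g : StepMap μ 𝔟) : ℂ := ∫ x, l x (g x) ∂μ

/-- `φ = exp λ` for the integral functional `λ(g) = ∫ l_x(g(x)) dx` with density `l`, the density
being the Vitali derivative of `λ_D(b) = ∫_D l_x(b) dx`. -/
structure IsLogDensity (V : VitaliSystem μ) (φ : StepMap μ 𝔟 → ℂ) (l : X → 𝔟 → ℂ) : Prop where
  integrable : ∀ g : StepMap μ 𝔟, Integrable (fun x => l x (g x)) μ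
  exp_eq : ∀ g, Complex.exp (integralFunctional μ l g) = φ g
  derivative : IsVitaliDerivative V (fun D b => ∫ x in D.1, l x b ∂μ) l

variable {E : X → Type u} [∀ x, NormedAddCommGroup (E x)] [∀ x, InnerProductSpace ℂ (E x)]

/-- The vector `k(g) = ∫^⊕ k_x(g(x)) dx`. -/
def vec (k : ∀ x, 𝔟 → E x) (g : StepMap μ 𝔟) : SectionClass μ E := cls μ fun x => k x (g x)

/-- The linear functional `k^⋆(g) = k(g^⋆)^*`. -/
def covec (k : ∀ x, 𝔟 → E x) (g : StepMap μ 𝔟) (ξ : SectionClass μ E) : ℂ :=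
  sprod (vec k (star g)) ξ

/-- The decomposable operator `j(g) = ∫^⊕ j_x(g(x)) dx`. -/
def oper (j : ∀ x, 𝔟 → E x →ₗ[ℂ] E x) (g : StepMap μ 𝔟) :
    SectionClass μ E →ₗ[ℂ] SectionClass μ E :=
  decomposable fun x => j x (g x)

/-- The polynorm `‖ξ‖^h = (∫ ‖j(x, h) ξ(x)‖² dx)^{1/2}`. -/
def polynorm (j : ∀ x, 𝔟 → E x →ₗ[ℂ] E x) (h : StepMap μ 𝔟) (ξ : SectionClass μ E) : ℝ :=
  Real.sqrt (sprod (oper j h ξ) (oper j h ξ)).re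

/-- The covariant canonical triple: density `l`, cocycle `k` and representation `j`, intertwined by
the isometric representation `W` of `S`. -/
structure CanonicalTriple (σ : Symmetry S μ 𝔟) (V : VitaliSystem μ) (φ : StepMap μ 𝔟 → ℂ)
    (l : X → 𝔟 → ℂ) (k : ∀ x, 𝔟 → E x) (j : ∀ x, 𝔟 → E x →ₗ[ℂ] E x)
    (W : ∀ s x, E x →ₗ[ℂ] E (σ.act s x)) (K : Submodule ℂ (SectionClass μ E)) : Prop where
  -- the integral functional and its density
  logDensity : IsLogDensity V φ l
  homogeneous : σ.IsHomogeneous (integralFunctional μ l)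
  covariant : σ.IsCovariantDensity l
  l_star : ∀ x b, l x (star b) = conj (l x b)
  l_one : ∀ x, l x 1 = 0
  -- the vector map and the isometric representation
  preHilbert : IsPreHilbert K
  vec_mem : ∀ g : StepMap μ 𝔟, vec k g ∈ K
  k_one : ∀ x, k x 1 = 0
  isometricRep : IsIsometricRep σ W
  push_mem : ∀ s (ξ : ∀ x, E x), cls μ ξ ∈ K → cls μ (push σ W s ξ) ∈ K
  push_isometric : ∀ s (ξ : ∀ x, E x), cls μ ξ ∈ K →
    sprod (cls μ (push σ W s ξ)) (cls μ (push σ W s ξ)) = sprod (cls μ ξ) (cls μ ξ)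
  k_covariant : ∀ s, ∀ᵐ x ∂μ, ∀ b, k (σ.act s x) (σ.θ s b) = W s x (k x b)
  covec_vec : ∀ f h : StepMap μ 𝔟, covec k f (vec k h) =
    integralFunctional μ l (f * h) - integralFunctional μ l f - integralFunctional μ l h
  -- the representation
  j_one : ∀ x, j x 1 = LinearMap.id
  oper_mem : ∀ g, ∀ ξ ∈ K, oper j g ξ ∈ K
  oper_mul : ∀ g h, ∀ ξ ∈ K, oper j (g * h) ξ = oper j g (oper j h ξ)
  oper_star : ∀ g, ∀ ξ ∈ K, ∀ η ∈ K, sprod (oper j (star g) ξ) η = sprod ξ (oper j g η)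
  oper_one : ∀ ξ ∈ K, oper j 1 ξ = ξ
  oper_covariant : ∀ s g (ξ : ∀ x, E x), cls μ ξ ∈ K →
    cls μ (push σ W s fun x => j x (g x) (ξ x)) = oper j (σ.shift s g) (cls μ (push σ W s ξ))
  oper_vec : ∀ g h : StepMap μ 𝔟, oper j g (vec k h) = vec k (g * h) - vec k g
  covec_oper : ∀ f g : StepMap μ 𝔟, ∀ ξ ∈ K, covec k f (oper j g ξ) = covec k (f * g) ξ - covec k g ξ
  oper_continuous : ∀ g h, ∃ (F : Finset (StepMap μ 𝔟)) (C : ℝ), ∀ ξ ∈ K,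
    polynorm j h (oper j g ξ) ≤ C * ∑ f ∈ F, polynorm j f ξ

/-- The covariant family of `†`-representations `J D` of `𝔟` by triangular operators on the
pseudo-Hilbert spaces `ℂ ⊕ K D ⊕ ℂ`, intertwined by the block-diagonal pseudo-isometries `U s D`. -/
structure MinkowskiRep (σ : Symmetry S μ 𝔟) (V : VitaliSystem μ) (φ : StepMap μ 𝔟 → ℂ)
    (l : X → 𝔟 → ℂ) (k : ∀ x, 𝔟 → E x) (j : ∀ x, 𝔟 → E x →ₗ[ℂ] E x)
    (W : ∀ s x, E x →ₗ[ℂ] E (σ.act s x))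
    (K : ∀ D : IntegrableSet μ, Submodule ℂ (SectionClass (μ.restrict D.1) E))
    (J : ∀ D, 𝔟 → Module.End ℂ (ℂ × K D × ℂ))
    (U : ∀ s D, (ℂ × K D × ℂ) →ₗ[ℂ] (ℂ × K (σ.image s D) × ℂ)) : Prop where
  logDensity : IsLogDensity V φ l
  preHilbert : ∀ D, IsPreHilbert (K D)
  -- unital `†`-representation
  map_mul : ∀ D a b, J D (a * b) = J D a * J D b
  map_star : ∀ D b p q, minkowski (J D (star b) p) q = minkowski p (J D b q)
  map_one : ∀ D, J D 1 = 1
  -- triangular form, with rows `(1, k^⋆_D(b), λ_D(b))`, `(0, j_D(b), k_D(b))`, `(0, 0, 1)`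
  row_minus : ∀ D b (p : ℂ × K D × ℂ), (J D b p).1 =
    p.1 + sprod (cls (μ.restrict D.1) fun x => k x (star b)) (p.2.1 : SectionClass _ E)
      + (∫ x in D.1, l x b ∂μ) * p.2.2
  row_circ : ∀ D b (p : ℂ × K D × ℂ), ((J D b p).2.1 : SectionClass (μ.restrict D.1) E) =
    decomposable (fun x => j x b) (p.2.1 : SectionClass (μ.restrict D.1) E)
      + p.2.2 • cls (μ.restrict D.1) fun x => k x b
  row_plus : ∀ D b (p : ℂ × K D × ℂ), (J D b p).2.2 = p.2.2
  -- `λ_D(b)` is the vector form of the null vector `e`, and it is a logarithm of `φ_D(b)`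
  corner : ∀ D b, minkowski ((0, 0, 1) : ℂ × K D × ℂ) (J D b (0, 0, 1)) = ∫ x in D.1, l x b ∂μ
  null_vector : ∀ D, minkowski ((0, 0, 1) : ℂ × K D × ℂ) (0, 0, 1) = 0
  exp_corner : ∀ D b, Complex.exp (∫ x in D.1, l x b ∂μ) = φ (StepMap.ind b D)
  -- covariance
  isometricRep : IsIsometricRep σ W
  block_minus : ∀ s D (p : ℂ × K D × ℂ), (U s D p).1 = p.1
  block_circ : ∀ s D (p : ℂ × K D × ℂ) (ξ : ∀ x, E x),
    (p.2.1 : SectionClass (μ.restrict D.1) E) = cls (μ.restrict D.1) ξ →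
    ((U s D p).2.1 : SectionClass (μ.restrict (σ.image s D).1) E) =
      cls (μ.restrict (σ.image s D).1) (push σ W s ξ)
  block_plus : ∀ s D (p : ℂ × K D × ℂ), (U s D p).2.2 = p.2.2
  pseudoIsometric : ∀ s D p q, minkowski (U s D p) (U s D q) = minkowski p q
  intertwines : ∀ s D b p, U s D (J D b p) = J (σ.image s D) (σ.θ s b) (U s D p)

end Conditions

end LevyField

end

/-!
All four conditions say that `φ(g) = exp ∫ l_x(g(x)) dx` for a density `l` of which every `l_x` is a
cumulant functional on `𝔟`.

If `φ` is chaotic without zeros, `A ↦ φ(b_{Δ ∩ A})` is a multiplicative measure. It is close to `1`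
on small sets, where its principal logarithm is a complex measure and has a Radon–Nikodym density;
since `Δ` can be cut into finitely many small pieces, `φ(b_Δ) = exp ∫_Δ l_x(b) dx`. The
Vitali covering property identifies the density with the Vitali derivative of `φ_Δ(b) - 1`. The
inequalities that make `φ_Δ - 1` or `λ_Δ` conditionally positive are closed and homogeneous, so they
pass to the derivative `l_x`.

Conversely, for a cumulant functional `l_x` the kernel `l_x(a⋆c) - l_x(a) - l_x(c⋆)` is positive
semidefinite; its Kolmogorov space carries the vectors `k_x(b)` and the operators `j_x(b)`.
Integrating these fibres gives the canonical triple, and the triangular operators over each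
integrable set. The uniqueness of Vitali derivatives makes `l` covariant, so the Gram matrices of
the vectors `k_x(b)` and `k_{sx}(b_s)` agree; this produces the isometries `V_s`.
-/

noncomputable section

namespace LevyField

open scoped Function

universe u v w

/-! ### Multiplicative measures -/

section Multiplicative

variable {X : Type v} [MeasurableSpace X] {ν : Measure X} {Φ : Set X → ℂ}

/-- A multiplicative measure: a nowhere vanishing complex set function which turns countable
disjoint unions into products and is absolutely continuous with respect to `ν`. -/
structure IsMultiplicativeMeasure (ν : Measure X) (Φ : Set X → ℂ) : Prop where
  tendsto_prod : ∀ A : ℕ → Set X, (∀ n, MeasurableSet (A n)) → Pairwise (Disjoint on A) →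
    Tendsto (fun N => ∏ n ∈ Finset.range N, Φ (A n)) atTop (𝓝 (Φ (⋃ n, A n)))
  ne_zero : ∀ A, MeasurableSet A → Φ A ≠ 0
  null : ∀ A, MeasurableSet A → ν A = 0 → Φ A = 1

namespace IsMultiplicativeMeasure

theorem empty (h : IsMultiplicativeMeasure ν Φ) : Φ ∅ = 1 :=
  h.null ∅ MeasurableSet.empty measure_empty

theorem inter (h : IsMultiplicativeMeasure ν Φ) {P : Set X} (hP : MeasurableSet P) :
    IsMultiplicativeMeasure ν fun A => Φ (A ∩ P) where
  tendsto_prod A hA hd := by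
    rw [Set.iUnion_inter]
    exact h.tendsto_prod _ (fun n => (hA n).inter hP) fun i j hij =>
      (hd hij).mono Set.inter_subset_left Set.inter_subset_left
  ne_zero A hA := h.ne_zero _ (hA.inter hP)
  null A hA h0 := h.null _ (hA.inter hP) (measure_mono_null Set.inter_subset_left h0)

theorem union (h : IsMultiplicativeMeasure ν Φ) {A B : Set X} (hA : MeasurableSet A)
    (hB : MeasurableSet B) (hAB : Disjoint A B) : Φ (A ∪ B) = Φ A * Φ B := by
  let C : ℕ → Set X
    | 0 => A
    | 1 => B
    | _ + 2 => ∅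
  have hC : ∀ n, MeasurableSet (C n)
    | 0 => hA
    | 1 => hB
    | _ + 2 => MeasurableSet.empty
  have hd : Pairwise (Disjoint on C)
    | 0, 1, _ => hAB
    | 1, 0, _ => hAB.symm
    | 0, 0, h => absurd rfl h
    | 1, 1, h => absurd rfl h
    | _ + 2, _, _ => Set.empty_disjoint _
    | _, _ + 2, _ => Set.disjoint_empty _
  have hU : ⋃ n, C n = A ∪ B := by
    rw [← Set.union_iUnion_nat_succ, ← Set.union_iUnion_nat_succ]
    simp [C]
  have ht := h.tendsto_prod C hC hd
  rw [hU] at ht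
  refine tendsto_nhds_unique ht ((tendsto_add_atTop_iff_nat 2).1 ?_)
  simp [Finset.prod_range_succ', C, h.empty, mul_comm]

theorem biUnion_finset (h : IsMultiplicativeMeasure ν Φ) {ι : Type*} (F : Finset ι)
    {A : ι → Set X} (hA : ∀ i ∈ F, MeasurableSet (A i))
    (hd : (F : Set ι).PairwiseDisjoint A) : Φ (⋃ i ∈ F, A i) = ∏ i ∈ F, Φ (A i) := by
  classical
  induction F using Finset.induction_on with
  | empty => simp [h.empty]
  | insert a F ha ih =>
    rw [Finset.coe_insert, Set.pairwiseDisjoint_insert_of_notMem (mod_cast ha)] at hd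
    have hF := fun i hi => hA i (Finset.mem_insert_of_mem hi)
    rw [Finset.set_biUnion_insert, Finset.prod_insert ha, h.union (hA a (F.mem_insert_self a))
      (F.measurableSet_biUnion hF) (Set.disjoint_iUnion₂_right.2 hd.2), ih hF hd.1]

theorem tendsto_monotone (h : IsMultiplicativeMeasure ν Φ) {B : ℕ → Set X}
    (hB : ∀ n, MeasurableSet (B n)) (hm : Monotone B) :
    Tendsto (fun n => Φ (B n)) atTop (𝓝 (Φ (⋃ n, B n))) := by
  have hm' := fun n => MeasurableSet.disjointed hB n
  have ht := h.tendsto_prod (disjointed B) hm' (disjoint_disjointed B)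
  rw [iUnion_disjointed] at ht
  refine (ht.comp (tendsto_add_atTop_nat 1)).congr fun n => ?_
  rw [Function.comp_apply, ← h.biUnion_finset _ (fun n _ => hm' n)
    ((disjoint_disjointed B).set_pairwise _)]
  exact congrArg Φ ((biUnion_range_succ_disjointed B n).trans (congrFun hm.partialSups_eq n))

theorem tendsto_sdiff (h : IsMultiplicativeMeasure ν Φ) {A : Set X} {E : ℕ → Set X}
    (hA : MeasurableSet A) (hE : ∀ n, MeasurableSet (E n)) (hanti : Antitone E)
    (hnull : ν (⋂ n, E n) = 0) : Tendsto (fun n => Φ (A \ E n)) atTop (𝓝 (Φ A)) := by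
  have ht := h.tendsto_monotone (fun n => hA.diff (hE n))
    fun m n hmn => Set.sdiff_subset_sdiff_right (hanti hmn)
  have hE' : MeasurableSet (⋂ n, E n) := MeasurableSet.iInter hE
  have hΦA : Φ A = Φ (A \ ⋂ n, E n) := by
    nth_rw 1 [← Set.sdiff_union_inter A (⋂ n, E n)]
    rw [h.union (hA.diff hE') (hA.inter hE') (Set.disjoint_sdiff_inter),
      h.null _ (hA.inter hE') (measure_mono_null Set.inter_subset_right hnull), mul_one]
  rwa [← Set.sdiff_iInter, ← hΦA] at ht

theorem tendsto_one (h : IsMultiplicativeMeasure ν Φ) {A : ℕ → Set X}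
    (hA : ∀ n, MeasurableSet (A n)) (hd : Pairwise (Disjoint on A)) :
    Tendsto (fun n => Φ (A n)) atTop (𝓝 1) := by
  have ht := h.tendsto_prod A hA hd
  have hne := h.ne_zero _ (MeasurableSet.iUnion hA)
  rw [← div_self hne]
  refine ((ht.comp (tendsto_add_atTop_nat 1)).div ht hne).congr fun n => ?_
  rw [Pi.div_apply, Function.comp_apply, Finset.prod_range_succ,
    mul_div_cancel_left₀ _ (Finset.prod_ne_zero_iff.2 fun k _ => h.ne_zero _ (hA k))]

/- Gliding hump: if `‖Φ (A n) - 1‖ ≥ ε` along a sequence with summable measures, removing from each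
`A n` a late tail of the sequence leaves a disjoint subsequence on which `Φ` stays away from `1`. -/
theorem exists_pos_forall_lt (h : IsMultiplicativeMeasure ν Φ) {ε : ℝ} (hε : 0 < ε) :
    ∃ δ : ℝ≥0∞, 0 < δ ∧ ∀ A, MeasurableSet A → ν A < δ → ‖Φ A - 1‖ < ε := by
  by_contra! hcon
  obtain ⟨δ, hδ, hδsum⟩ := ENNReal.exists_pos_sum_of_countable' one_ne_zero ℕ
  choose A hA hνA hΦA using fun n => hcon (δ n) (hδ n)
  let E : ℕ → Set X := fun n => ⋃ i, A (i + n)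
  have hE : ∀ n, MeasurableSet (E n) := fun n => MeasurableSet.iUnion fun i => hA _
  have hanti : Antitone E := fun m n hmn => Set.iUnion_subset fun i => by
    rw [← Nat.sub_add_cancel hmn, ← add_assoc]
    exact Set.subset_iUnion (fun i => A (i + m)) _
  have hAE : ∀ {m n}, m ≤ n → A n ⊆ E m := fun {m n} hmn => by
    rw [← Nat.sub_add_cancel hmn]
    exact Set.subset_iUnion (fun i => A (i + m)) _
  have hnull : ν (⋂ n, E n) = 0 := by
    have hlim := measure_limsup_atTop_eq_zero (μ := ν) (s := A)
      ((ENNReal.tsum_le_tsum fun n => (hνA n).le).trans_lt (hδsum.trans ENNReal.one_lt_top)).ne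
    rwa [limsup_eq_iInf_iSup_of_nat'] at hlim
  have hnext : ∀ n, ∃ M, n < M ∧ ε / 2 < ‖Φ (A n \ E M) - 1‖ := fun n =>
    have ht := ((h.tendsto_sdiff (hA n) hE hanti hnull).sub_const 1).norm
    ((eventually_gt_atTop n).and
      (ht.eventually_const_lt ((half_lt_self hε).trans_le (hΦA n)))).exists
  choose next hlt hfar using hnext
  let s : ℕ → ℕ := fun k => next^[k] 0
  have hs : ∀ k, s (k + 1) = next (s k) := fun k => Function.iterate_succ_apply' next k 0
  have hmono : StrictMono s := strictMono_nat_of_lt_succ fun k => (hlt (s k)).trans_eq (hs k).symm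
  have hd : Pairwise (Disjoint on fun k => A (s k) \ E (s (k + 1))) :=
    (pairwise_disjoint_on _).2 fun j k hjk => Set.disjoint_left.2 fun _ hj hk =>
      hj.2 (hAE (hmono.monotone hjk) hk.1)
  have ht := ((h.tendsto_one (fun k => (hA _).diff (hE _)) hd).sub_const 1).norm
  rw [sub_self, norm_zero] at ht
  obtain ⟨k, hk⟩ := (ht.eventually_lt_const (half_pos hε)).exists
  rw [hs] at hk
  exact hk.not_gt (hfar (s k))

theorem tendsto_biUnion_finset [IsFiniteMeasure ν] (h : IsMultiplicativeMeasure ν Φ)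
    {A : ℕ → Set X} (hA : ∀ i, MeasurableSet (A i)) (hd : Pairwise (Disjoint on A)) :
    Tendsto (fun F : Finset ℕ => Φ (⋃ i ∈ F, A i)) atTop (𝓝 (Φ (⋃ i, A i))) := by
  let R : Finset ℕ → Set X := fun F => ⋃ i : {i // i ∉ F}, A i
  have hR : ∀ F, MeasurableSet (R F) := fun F => MeasurableSet.iUnion fun i => hA i
  have hΦR : Tendsto (fun F => Φ (R F)) atTop (𝓝 1) := by
    rw [Metric.tendsto_nhds]
    intro ε hε
    obtain ⟨δ, hδ, hδΦ⟩ := h.exists_pos_forall_lt hε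
    have hsum : ∑' i, ν (A i) ≠ ∞ := by
      rw [← measure_iUnion hd hA]
      exact measure_ne_top _ _
    filter_upwards [(ENNReal.tendsto_tsum_compl_atTop_zero hsum).eventually_lt_const hδ] with F hF
    rw [dist_eq_norm]
    exact hδΦ _ (hR F) ((measure_iUnion_le _).trans_lt hF)
  have hsplit : ∀ F : Finset ℕ, Φ (⋃ i, A i) / Φ (R F) = Φ (⋃ i ∈ F, A i) := by
    intro F
    rw [div_eq_iff (h.ne_zero _ (hR F)),
      ← h.union (F.measurableSet_biUnion fun i _ => hA i) (hR F)]
    · congr 1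
      rw [← Set.biUnion_univ, ← Set.union_compl_self (F : Set ℕ), Set.biUnion_union]
      simp only [R, Finset.mem_coe, Set.mem_compl_iff, Set.iUnion_subtype]
    · exact Set.disjoint_iUnion₂_left.2 fun i hi => Set.disjoint_iUnion_right.2 fun j =>
        hd (ne_of_mem_of_not_mem hi j.2)
  have ht := (tendsto_const_nhds (x := Φ (⋃ i, A i))).div hΦR one_ne_zero
  rw [div_one] at ht
  exact ht.congr hsplit

theorem log_union (h : IsMultiplicativeMeasure ν Φ) {A B : Set X} (hA : MeasurableSet A)
    (hB : MeasurableSet B) (hAB : Disjoint A B) (hA' : 0 < (Φ A).re) (hB' : 0 < (Φ B).re) :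
    Complex.log (Φ (A ∪ B)) = Complex.log (Φ A) + Complex.log (Φ B) := by
  have hargA := abs_lt.1 (Complex.abs_arg_lt_pi_div_two_iff.2 (Or.inl hA'))
  have hargB := abs_lt.1 (Complex.abs_arg_lt_pi_div_two_iff.2 (Or.inl hB'))
  rw [h.union hA hB hAB, Complex.log_mul (h.ne_zero _ hA) (h.ne_zero _ hB)]
  constructor <;> linarith

theorem log_biUnion_finset (h : IsMultiplicativeMeasure ν Φ)
    (hpos : ∀ A, MeasurableSet A → 0 < (Φ A).re) (F : Finset ℕ) {A : ℕ → Set X}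
    (hA : ∀ i, MeasurableSet (A i)) (hd : Pairwise (Disjoint on A)) :
    Complex.log (Φ (⋃ i ∈ F, A i)) = ∑ i ∈ F, Complex.log (Φ (A i)) := by
  induction F using Finset.induction_on with
  | empty => simp [h.empty]
  | insert a F ha ih =>
    have hF : MeasurableSet (⋃ i ∈ F, A i) := F.measurableSet_biUnion fun i _ => hA i
    rw [Finset.set_biUnion_insert, Finset.sum_insert ha, h.log_union (hA a) hF
      (Set.disjoint_iUnion₂_right.2 fun i hi => hd (ne_of_mem_of_not_mem hi ha).symm)
      (hpos _ (hA a)) (hpos _ hF), ih]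

open Classical in
/-- The logarithm of a multiplicative measure with values in the right half plane, a complex
measure. -/
def logMeasure [IsFiniteMeasure ν] (h : IsMultiplicativeMeasure ν Φ)
    (hpos : ∀ A, MeasurableSet A → 0 < (Φ A).re) : ComplexMeasure X where
  measureOf' A := if MeasurableSet A then Complex.log (Φ A) else 0
  empty' := by simp [h.empty]
  not_measurable' A hA := if_neg hA
  m_iUnion' A hA hd := by
    simp only [hA, if_true, MeasurableSet.iUnion hA]
    exact ((h.tendsto_biUnion_finset hA hd).clog (Or.inl (hpos _ (MeasurableSet.iUnion hA)))).congr
      fun F => h.log_biUnion_finset hpos F hA hd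

theorem logMeasure_apply [IsFiniteMeasure ν] (h : IsMultiplicativeMeasure ν Φ)
    (hpos : ∀ A, MeasurableSet A → 0 < (Φ A).re) {A : Set X} (hA : MeasurableSet A) :
    h.logMeasure hpos A = Complex.log (Φ A) :=
  if_pos hA

end IsMultiplicativeMeasure

theorem exists_density_of_null [SigmaFinite ν] (c : ComplexMeasure X)
    (hc : ∀ A, MeasurableSet A → ν A = 0 → c A = 0) :
    ∃ ρ : X → ℂ, Integrable ρ ν ∧ ∀ A, MeasurableSet A → c A = ∫ x in A, ρ x ∂ν := by
  have hdensity : ∀ s : SignedMeasure X, (∀ A, MeasurableSet A → ν A = 0 → s A = 0) →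
      ∀ A, MeasurableSet A → s A = ∫ x in A, s.rnDeriv ν x ∂ν := by
    intro s hs A hA
    have hac : s ≪ᵥ ν.toENNRealVectorMeasure :=
      VectorMeasure.AbsolutelyContinuous.mk fun A hA h0 =>
        hs A hA (by rwa [Measure.toENNRealVectorMeasure_apply_measurable hA] at h0)
    rw [← withDensityᵥ_apply (SignedMeasure.integrable_rnDeriv _ _) hA,
      SignedMeasure.withDensityᵥ_rnDeriv_eq s ν hac]
  have hint := c.integrable_rnDeriv ν
  refine ⟨c.rnDeriv ν, hint, fun A hA => Complex.ext ?_ ?_⟩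
  · exact (hdensity (ComplexMeasure.re c) (fun A hA h0 => congrArg Complex.re (hc A hA h0)) A
      hA).trans (integral_re hint.integrableOn)
  · exact (hdensity (ComplexMeasure.im c) (fun A hA h0 => congrArg Complex.im (hc A hA h0)) A
      hA).trans (integral_im hint.integrableOn)

namespace IsMultiplicativeMeasure

theorem exists_density_of_re_pos [IsFiniteMeasure ν] (h : IsMultiplicativeMeasure ν Φ)
    (hpos : ∀ A, MeasurableSet A → 0 < (Φ A).re) :
    ∃ ρ : X → ℂ, Integrable ρ ν ∧
      ∀ A, MeasurableSet A → Φ A = Complex.exp (∫ x in A, ρ x ∂ν) := by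
  obtain ⟨ρ, hρ, hlog⟩ := exists_density_of_null (ν := ν) (h.logMeasure hpos) fun A hA h0 => by
    rw [h.logMeasure_apply hpos hA, h.null A hA h0, Complex.log_one]
  refine ⟨ρ, hρ, fun A hA => ?_⟩
  rw [← hlog A hA, h.logMeasure_apply hpos hA, Complex.exp_log (h.ne_zero A hA)]

theorem exists_density [IsFiniteMeasure ν] (h : IsMultiplicativeMeasure ν Φ)
    (hsplit : ∀ δ : ℝ≥0∞, 0 < δ → ∃ F : Finset (Set X),
      (∀ P ∈ F, MeasurableSet P ∧ ν P < δ) ∧ (F : Set (Set X)).PairwiseDisjoint id ∧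
      ⋃ P ∈ F, P = Set.univ) :
    ∃ ρ : X → ℂ, Integrable ρ ν ∧
      ∀ A, MeasurableSet A → Φ A = Complex.exp (∫ x in A, ρ x ∂ν) := by
  obtain ⟨δ, hδ, hδΦ⟩ := h.exists_pos_forall_lt one_pos
  obtain ⟨F, hF, hd, hU⟩ := hsplit δ hδ
  have hpos : ∀ P : F, ∀ A, MeasurableSet A → 0 < (Φ (A ∩ P)).re := by
    intro P A hA
    have hlt : ‖Φ (A ∩ P) - 1‖ < 1 := hδΦ _ (hA.inter (hF P P.2).1)
      ((measure_mono Set.inter_subset_right).trans_lt (hF P P.2).2)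
    have hre := (abs_lt.1 ((Complex.abs_re_le_norm _).trans_lt hlt)).1
    rw [Complex.sub_re, Complex.one_re] at hre
    linarith
  choose ρ hρ hexp using fun P : F => (h.inter (hF P P.2).1).exists_density_of_re_pos (hpos P)
  refine ⟨fun x => ∑ P, ρ P x, integrable_finsetSum _ fun P _ => hρ P, fun A hA => ?_⟩
  rw [integral_finsetSum _ fun P _ => (hρ P).integrableOn, Complex.exp_sum,
    ← Finset.prod_congr rfl fun P _ => hexp P A hA,
    Finset.prod_coe_sort F fun P => Φ (A ∩ P),
    ← h.biUnion_finset F (A := fun P => A ∩ P) (fun P hP => hA.inter (hF P hP).1)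
      (hd.mono_on fun P _ => Set.inter_subset_right), ← Set.inter_iUnion₂, hU, Set.inter_univ]

end IsMultiplicativeMeasure

end Multiplicative

/-! ### Differentiation in a Vitali system -/

section Vitali

variable {X : Type v} [MeasurableSpace X] {μ : Measure X}

theorem exists_pos_norm_setIntegral_lt {F : Type*} [NormedAddCommGroup F] [NormedSpace ℝ F]
    {f : X → F} (hf : ∀ D : IntegrableSet μ, IntegrableOn f D.1 μ) {ε : ℝ} (hε : 0 < ε) :
    ∃ δ : ℝ≥0∞, 0 < δ ∧ ∀ A, MeasurableSet A → μ A < δ → ‖∫ x in A, f x ∂μ‖ < ε := by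
  by_contra! hcon
  obtain ⟨δ, hδ, hδsum⟩ := ENNReal.exists_pos_sum_of_countable' one_ne_zero ℕ
  choose A hA hμA hfA using fun n => hcon (δ n) (hδ n)
  have hsum : ∑' n, μ (A n) < ∞ :=
    (ENNReal.tsum_le_tsum fun n => (hμA n).le).trans_lt (hδsum.trans ENNReal.one_lt_top)
  let D : IntegrableSet μ :=
    ⟨⋃ n, A n, MeasurableSet.iUnion hA, (measure_iUnion_le _).trans_lt hsum⟩
  have hμD : Tendsto (μ.restrict D.1 ∘ A) atTop (𝓝 0) :=
    tendsto_of_tendsto_of_tendsto_of_le_of_le tendsto_const_nhds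
      (ENNReal.tendsto_atTop_zero_of_tsum_ne_top hsum.ne) (fun _ => zero_le)
      fun n => Measure.restrict_apply_le _ _
  have ht := (Integrable.tendsto_setIntegral_nhds_zero (hf D) hμD).norm
  rw [norm_zero] at ht
  obtain ⟨n, hn⟩ := (ht.eventually_lt_const hε).exists
  rw [Measure.restrict_restrict (hA n), Set.inter_eq_left.2 (Set.subset_iUnion A n)] at hn
  exact hn.not_ge (hfA n)

theorem aestronglyMeasurable_of_forall_integrableOn [SigmaFinite μ] {F : Type*}
    [NormedAddCommGroup F] {f : X → F} (hf : ∀ D : IntegrableSet μ, IntegrableOn f D.1 μ) :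
    AEStronglyMeasurable f μ := by
  rw [← Measure.restrict_univ (μ := μ), ← iUnion_spanningSets μ, aestronglyMeasurable_iUnion_iff]
  exact fun n => (hf ⟨spanningSets μ n, measurableSet_spanningSets μ n,
    measure_spanningSets_lt_top μ n⟩).1

namespace VitaliSystem

theorem tendsto_setIntegral_zero (V : VitaliSystem μ) {f : X → ℂ}
    (hf : ∀ D : IntegrableSet μ, IntegrableOn f D.1 μ) {x : X}
    (hx : Tendsto (fun D : IntegrableSet μ => μ D.1) (V.filterAt x) (𝓝 0)) :
    Tendsto (fun D : IntegrableSet μ => ∫ y in D.1, f y ∂μ) (V.filterAt x) (𝓝 0) := by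
  rw [Metric.tendsto_nhds]
  intro ε hε
  obtain ⟨δ, hδ, hsmall⟩ := exists_pos_norm_setIntegral_lt hf hε
  filter_upwards [hx.eventually_lt_const hδ] with D hD
  rw [dist_zero_right]
  exact hsmall D.1 D.2.1 hD

theorem exists_finset_restrict_compl_lt (V : VitaliSystem μ) {A : Set X} (hA : μ A < ∞) {δ : ℝ≥0∞}
    (hδ : 0 < δ) :
    ∃ F : Finset (IntegrableSet μ), (∀ D ∈ F, μ D.1 < δ) ∧
      (F : Set (IntegrableSet μ)).PairwiseDisjoint (fun D => D.1) ∧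
      μ.restrict A (⋃ D ∈ F, D.1)ᶜ < δ := by
  classical
  let G : Set X := {x | ∃ᶠ D in V.filterAt x, μ D.1 < δ}
  have hG : μ Gᶜ = 0 := by
    change ∀ᵐ x ∂μ, ∃ᶠ D in V.filterAt x, μ D.1 < δ
    filter_upwards [V.neBot, V.tendsto_zero] with x _ ht
    exact (ht.eventually_lt_const hδ).frequently
  have hAG : μ (A ∩ G) < ∞ := (measure_mono Set.inter_subset_left).trans_lt hA
  obtain ⟨T, hTc, hTδ, hTd, hT0, hTε⟩ := V.covering (A ∩ G) (fun _ => {D | μ D.1 < δ}) hAG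
    (fun x hx => hx.2) 1 one_pos
  have := hTc.to_subtype
  rw [Set.biUnion_eq_iUnion] at hT0 hTε
  rw [measure_iUnion hTd.subtype fun D => D.1.2.1] at hTε
  obtain ⟨F, hF⟩ := ((ENNReal.tendsto_tsum_compl_atTop_zero
    (hTε.trans_lt (ENNReal.add_lt_top.2 ⟨hAG, ENNReal.one_lt_top⟩)).ne).eventually_lt_const
      hδ).exists
  refine ⟨F.map (.subtype _), ?_, ?_, ?_⟩
  · simp only [Finset.forall_mem_map]
    intro D _
    obtain ⟨x, -, hx⟩ := hTδ D.1 D.2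
    exact hx
  · refine hTd.subset fun D hD => ?_
    obtain ⟨D, -, rfl⟩ := Finset.mem_map.1 hD
    exact D.2
  let R : Set X := (⋃ D ∈ F.map (.subtype _), D.1)ᶜ
  have hsub : R ∩ A ⊆ (⋃ D : {D // D ∉ F}, D.1.1.1) ∪ ((A ∩ G) \ (⋃ D : T, D.1.1) ∪ Gᶜ) := by
    rintro x ⟨hxR, hxA⟩
    by_contra hx
    simp only [Set.mem_union, Set.mem_iUnion, Set.mem_sdiff, Set.mem_inter_iff, Set.mem_compl_iff,
      not_or, not_and_or, not_not, not_exists] at hx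
    obtain ⟨hxF, hxT, hxG⟩ := hx
    obtain ⟨D, hD⟩ : ∃ D : T, x ∈ D.1.1 := by simpa [hxA, hxG] using hxT
    exact hxR (Set.mem_biUnion (Finset.mem_map_of_mem _ (not_not.1 fun h => hxF ⟨D, h⟩ hD)) hD)
  calc μ.restrict A R = μ (R ∩ A) :=
      Measure.restrict_apply (Finset.measurableSet_biUnion _ fun D _ => D.2.1).compl
    _ ≤ μ (⋃ D : {D // D ∉ F}, D.1.1.1) + μ ((A ∩ G) \ (⋃ D : T, D.1.1) ∪ Gᶜ) :=
      (measure_mono hsub).trans (measure_union_le _ _)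
    _ = μ (⋃ D : {D // D ∉ F}, D.1.1.1) := by rw [measure_union_null hT0 hG, add_zero]
    _ ≤ ∑' D : {D // D ∉ F}, μ D.1.1.1 := measure_iUnion_le _
    _ < δ := hF

theorem exists_finite_partition (V : VitaliSystem μ) {A : Set X} (hA : μ A < ∞) {δ : ℝ≥0∞}
    (hδ : 0 < δ) :
    ∃ F : Finset (Set X), (∀ P ∈ F, MeasurableSet P ∧ μ.restrict A P < δ) ∧
      (F : Set (Set X)).PairwiseDisjoint id ∧ ⋃ P ∈ F, P = Set.univ := by
  classical
  obtain ⟨F, hFδ, hd, hR⟩ := V.exists_finset_restrict_compl_lt hA hδ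
  refine ⟨insert (⋃ D ∈ F, D.1)ᶜ (F.image fun D => D.1), ?_, ?_, ?_⟩
  · simp only [Finset.forall_mem_insert, Finset.forall_mem_image]
    exact ⟨⟨(F.measurableSet_biUnion fun D _ => D.2.1).compl, hR⟩,
      fun D hD => ⟨D.2.1, (Measure.restrict_apply_le _ _).trans_lt (hFδ D hD)⟩⟩
  · rw [Finset.coe_insert, Finset.coe_image]
    refine Set.PairwiseDisjoint.insert ?_ ?_
    · rintro _ ⟨D, hD, rfl⟩ _ ⟨D', hD', rfl⟩ hne
      exact hd hD hD' fun h => hne (by rw [h])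
    · rintro _ ⟨D, hD, rfl⟩ -
      exact Set.disjoint_compl_left_iff_subset.2
        (Set.subset_biUnion_of_mem (u := fun D : IntegrableSet μ => D.1) hD)
  · rw [Finset.set_biUnion_insert, Finset.set_biUnion_finset_image]
    exact Set.compl_union_self _

theorem exists_setIntegral_nonneg (V : VitaliSystem μ) {f : X → ℝ}
    (hf : ∀ D : IntegrableSet μ, IntegrableOn f D.1 μ) {A : Set X} (hA : μ A < ∞)
    (hfA : ∀ x ∈ A, ∃ᶠ D in V.filterAt x, 0 < ∫ y in D.1, f y ∂μ) {ε : ℝ≥0∞} (hε : 0 < ε)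
    (hε' : ε < ∞) :
    ∃ U : IntegrableSet μ, μ (A \ U.1) = 0 ∧ μ U.1 ≤ μ A + ε ∧ 0 ≤ ∫ y in U.1, f y ∂μ := by
  obtain ⟨T, hTc, hTf, hTd, hT0, hTε⟩ :=
    V.covering A (fun _ => {D | 0 < ∫ y in D.1, f y ∂μ}) hA hfA ε hε
  have := hTc.to_subtype
  rw [Set.biUnion_eq_iUnion] at hT0 hTε
  let U : IntegrableSet μ := ⟨⋃ D : T, D.1.1, MeasurableSet.iUnion fun D => D.1.2.1,
    hTε.trans_lt (ENNReal.add_lt_top.2 ⟨hA, hε'⟩)⟩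
  refine ⟨U, hT0, hTε, ?_⟩
  refine (hasSum_integral_iUnion (fun D : T => D.1.2.1) hTd.subtype (hf U)).nonneg fun D => ?_
  obtain ⟨x, -, hx⟩ := hTf D.1 D.2
  exact le_of_lt hx

theorem setIntegral_nonneg_of_frequently_pos (V : VitaliSystem μ) {f : X → ℝ}
    (hf : ∀ D : IntegrableSet μ, IntegrableOn f D.1 μ) {A A' : Set X} (hA : μ A < ∞)
    (hfA : ∀ x ∈ A, ∃ᶠ D in V.filterAt x, 0 < ∫ y in D.1, f y ∂μ) (hA' : MeasurableSet A')
    (hsub : A ⊆ A') (hμ : μ A' = μ A) : 0 ≤ ∫ y in A', f y ∂μ := by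
  refine le_of_forall_pos_le_add fun η hη => ?_
  obtain ⟨δ, hδ, hsmall⟩ := exists_pos_norm_setIntegral_lt hf hη
  obtain ⟨ε, hε, hεδ⟩ := exists_between hδ
  obtain ⟨⟨U, hU, hUfin⟩, hAU, hμU, hfU⟩ :=
    V.exists_setIntegral_nonneg hf hA hfA hε (hεδ.trans_le le_top)
  dsimp only at hAU hμU hfU
  have hinter : μ (U ∩ A') = μ A' := by
    refine le_antisymm (measure_mono Set.inter_subset_right) ?_
    calc μ A' ≤ μ (A ∩ U) + μ (A \ U) := hμ.trans_le (measure_le_inter_add_sdiff μ A U)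
      _ = μ (A ∩ U) := by rw [hAU, add_zero]
      _ ≤ μ (U ∩ A') := measure_mono fun x hx => ⟨hx.2, hsub hx.1⟩
  have hdiff : μ (U \ A') < δ := by
    have hle : μ A' + μ (U \ A') ≤ μ A' + ε := by
      rw [hμ]
      calc μ A + μ (U \ A') = μ (U ∩ A') + μ (U \ A') := by rw [hinter, hμ]
        _ = μ U := measure_inter_add_sdiff U hA'
        _ ≤ μ A + ε := hμU
    exact ((ENNReal.add_le_add_iff_left (hμ.trans_lt hA).ne).1 hle).trans_lt hεδ
  have heq : ∫ y in U ∩ A', f y ∂μ = ∫ y in A', f y ∂μ :=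
    setIntegral_congr_set ((ae_eq_of_subset_of_measure_ge Set.inter_subset_right hinter.ge
      (hU.inter hA').nullMeasurableSet (hμ.trans_lt hA).ne))
  calc 0 ≤ ∫ y in U, f y ∂μ := hfU
    _ = ∫ y in A', f y ∂μ + ∫ y in U \ A', f y ∂μ := by
      rw [← integral_inter_add_sdiff hA' (hf ⟨U, hU, hUfin⟩), heq]
    _ ≤ ∫ y in A', f y ∂μ + η :=
      add_le_add_right ((le_abs_self _).trans (hsmall _ (hU.diff hA') hdiff).le) _

variable [SigmaFinite μ]

theorem ae_eventually_setIntegral_nonpos (V : VitaliSystem μ) {f : X → ℝ}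
    (hfm : Measurable f) (hf : ∀ D : IntegrableSet μ, IntegrableOn f D.1 μ) :
    ∀ᵐ x ∂μ, f x < 0 → ∀ᶠ D in V.filterAt x, ∫ y in D.1, f y ∂μ ≤ 0 := by
  let B : Set X := {x | f x < 0 ∧ ∃ᶠ D in V.filterAt x, 0 < ∫ y in D.1, f y ∂μ}
  suffices hB : ∀ n, μ (B ∩ spanningSets μ n) = 0 by
    have hB0 : μ B = 0 := by
      rw [← Set.inter_univ B, ← iUnion_spanningSets μ, Set.inter_iUnion]
      exact measure_iUnion_null hB
    filter_upwards [measure_eq_zero_iff_ae_notMem.1 hB0] with x hx hfx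
    by_contra hcon
    exact hx ⟨hfx, (not_eventually.1 hcon).mono fun D => not_le.1⟩
  intro n
  let A : Set X := B ∩ spanningSets μ n
  have hA : μ A < ∞ :=
    (measure_mono Set.inter_subset_right).trans_lt (measure_spanningSets_lt_top μ n)
  let A' : Set X := toMeasurable μ A ∩ {x | f x < 0}
  have hA' : MeasurableSet A' :=
    (measurableSet_toMeasurable μ A).inter (measurableSet_lt hfm measurable_const)
  have hsub : A ⊆ A' := fun x hx => ⟨subset_toMeasurable μ A hx, hx.1.1⟩
  have hμ : μ A' = μ A := le_antisymm
    ((measure_mono Set.inter_subset_left).trans_eq (measure_toMeasurable A)) (measure_mono hsub)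
  have hle : ∀ᵐ x ∂μ.restrict A', f x < 0 := ae_restrict_of_forall_mem hA' fun x hx => hx.2
  have hint : 0 ≤ ∫ y in A', f y ∂μ :=
    V.setIntegral_nonneg_of_frequently_pos hf hA (fun x hx => hx.1.2) hA' hsub hμ
  have hzero : -f =ᵐ[μ.restrict A'] 0 := by
    have hneg : 0 ≤ᵐ[μ.restrict A'] -f := hle.mono fun x hx => neg_nonneg.2 hx.le
    refine (integral_eq_zero_iff_of_nonneg_ae hneg (hf ⟨A', hA', hμ.trans_lt hA⟩).neg).1 ?_
    refine le_antisymm ?_ (integral_nonneg_of_ae hneg)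
    simpa only [Pi.neg_apply, integral_neg, neg_nonpos] using hint
  rw [← hμ, ← Measure.restrict_eq_zero, ← ae_eq_bot, ← eventually_false_iff_eq_bot]
  filter_upwards [hle, hzero] with x hx hx'
  exact hx.ne (neg_eq_zero.1 hx')

theorem ae_eventually_average_le (V : VitaliSystem μ) {f : X → ℝ}
    (hfm : Measurable f) (hf : ∀ D : IntegrableSet μ, IntegrableOn f D.1 μ) :
    ∀ᵐ x ∂μ, ∀ q : ℚ, f x < q →
      ∀ᶠ D in V.filterAt x, (∫ y in D.1, f y ∂μ) / μ.real D.1 ≤ q := by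
  have hconst : ∀ (q : ℝ) (D : IntegrableSet μ), IntegrableOn (fun _ : X => q) D.1 μ :=
    fun q D => integrableOn_const D.2.2.ne
  have hsub : ∀ᵐ x ∂μ, ∀ q : ℚ, f x - q < 0 →
      ∀ᶠ D in V.filterAt x, ∫ y in D.1, (f y - q) ∂μ ≤ 0 :=
    ae_all_iff.2 fun q => V.ae_eventually_setIntegral_nonpos (hfm.sub_const _) fun D =>
      (hf D).sub (hconst q D)
  filter_upwards [hsub, V.mem_pos] with x hx hpos q hq
  filter_upwards [hx q (sub_neg.2 hq), hpos] with D hD hμD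
  rw [integral_sub (hf D) (hconst q D), setIntegral_const, smul_eq_mul, sub_nonpos] at hD
  exact (div_le_iff₀' (ENNReal.toReal_pos hμD.2.ne' D.2.2.ne)).2 hD

theorem ae_tendsto_average_of_measurable (V : VitaliSystem μ) {f : X → ℝ}
    (hfm : Measurable f) (hf : ∀ D : IntegrableSet μ, IntegrableOn f D.1 μ) :
    ∀ᵐ x ∂μ, Tendsto (fun D : IntegrableSet μ => (∫ y in D.1, f y ∂μ) / μ.real D.1)
      (V.filterAt x) (𝓝 (f x)) := by
  filter_upwards [V.ae_eventually_average_le hfm hf,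
    V.ae_eventually_average_le hfm.neg fun D => (hf D).neg] with x hx hx'
  refine tendsto_order.2 ⟨fun a ha => ?_, fun a ha => ?_⟩
  · obtain ⟨q, haq, hqf⟩ := exists_rat_btwn ha
    filter_upwards [hx' (-q) (by simpa using hqf)] with D hD
    simp only [Pi.neg_apply, integral_neg, neg_div, Rat.cast_neg, neg_le_neg_iff] at hD
    exact haq.trans_le hD
  · obtain ⟨q, hfq, hqa⟩ := exists_rat_btwn ha
    filter_upwards [hx q hfq] with D hD using hD.trans_lt hqa

theorem ae_tendsto_average_real (V : VitaliSystem μ) {f : X → ℝ}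
    (hf : ∀ D : IntegrableSet μ, IntegrableOn f D.1 μ) :
    ∀ᵐ x ∂μ, Tendsto (fun D : IntegrableSet μ => (∫ y in D.1, f y ∂μ) / μ.real D.1)
      (V.filterAt x) (𝓝 (f x)) := by
  have hm := aestronglyMeasurable_of_forall_integrableOn hf
  filter_upwards [hm.ae_eq_mk, V.ae_tendsto_average_of_measurable
    hm.stronglyMeasurable_mk.measurable fun D => (hf D).congr (ae_restrict_of_ae hm.ae_eq_mk)]
    with x hx ht
  rw [hx]
  exact ht.congr fun D => by rw [integral_congr_ae (ae_restrict_of_ae hm.ae_eq_mk)]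

theorem ae_tendsto_average (V : VitaliSystem μ) {f : X → ℂ}
    (hf : ∀ D : IntegrableSet μ, IntegrableOn f D.1 μ) :
    ∀ᵐ x ∂μ, Tendsto (fun D : IntegrableSet μ => (∫ y in D.1, f y ∂μ) / (μ.real D.1 : ℂ))
      (V.filterAt x) (𝓝 (f x)) := by
  filter_upwards [V.ae_tendsto_average_real fun D => (hf D).re,
    V.ae_tendsto_average_real fun D => (hf D).im] with x hre him
  have ht := hre.ofReal.add (him.ofReal.mul_const Complex.I)
  have hfx : ((RCLike.re (f x) : ℝ) : ℂ) + (RCLike.im (f x) : ℝ) * Complex.I = f x :=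
    Complex.re_add_im (f x)
  rw [hfx] at ht
  refine ht.congr fun D => ?_
  rw [← integral_re_add_im (hf D)]
  simp only [Complex.ofReal_div, div_mul_eq_mul_div, ← add_div]
  rfl

end VitaliSystem

theorem tendsto_exp_sub_one_div_iff {ι : Type*} {F : Filter ι} {z m : ι → ℂ} {c : ℂ}
    (hz : Tendsto z F (𝓝 0)) :
    Tendsto (fun i => (Complex.exp (z i) - 1) / m i) F (𝓝 c) ↔
      Tendsto (fun i => z i / m i) F (𝓝 c) := by
  have hslope : Tendsto (fun i => dslope Complex.exp 0 (z i)) F (𝓝 1) := by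
    have hcont := continuousAt_dslope_same.2 (Complex.hasDerivAt_exp 0).differentiableAt
    have ht := hcont.tendsto.comp hz
    rwa [dslope_same, (Complex.hasDerivAt_exp 0).deriv, Complex.exp_zero] at ht
  have hexp : ∀ i, Complex.exp (z i) - 1 = z i * dslope Complex.exp 0 (z i) := fun i => by
    simpa using (sub_smul_dslope Complex.exp 0 (z i)).symm
  refine ⟨fun h => ?_, fun h => ?_⟩
  · have ht := h.div hslope one_ne_zero
    rw [div_one] at ht
    refine ht.congr' ?_
    filter_upwards [hslope.eventually_ne one_ne_zero] with i hi
    rw [Pi.div_apply, hexp, div_right_comm, mul_div_cancel_right₀ _ hi]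
  · have ht := h.mul hslope
    rw [mul_one] at ht
    refine ht.congr fun i => ?_
    rw [hexp, div_mul_eq_mul_div]

namespace VitaliSystem

theorem ae_eq_of_exp_setIntegral_eq [SigmaFinite μ] (V : VitaliSystem μ) {A : Set X}
    (hA : MeasurableSet A) {f g : X → ℂ} (hf : IntegrableOn f A μ) (hg : IntegrableOn g A μ)
    (hexp : ∀ B ⊆ A, MeasurableSet B →
      Complex.exp (∫ x in B, f x ∂μ) = Complex.exp (∫ x in B, g x ∂μ)) :
    f =ᵐ[μ.restrict A] g := by
  let d : X → ℂ := A.indicator (f - g)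
  have hd : ∀ D : IntegrableSet μ, IntegrableOn d D.1 μ := fun D =>
    ((integrable_indicator_iff hA).2 (hf.sub hg)).integrableOn
  have hone : ∀ D : IntegrableSet μ, Complex.exp (∫ x in D.1, d x ∂μ) = 1 := by
    intro D
    have hsub : D.1 ∩ A ⊆ A := Set.inter_subset_right
    rw [setIntegral_indicator hA, Pi.sub_def,
      integral_sub (hf.mono_set hsub) (hg.mono_set hsub), Complex.exp_sub,
      hexp _ hsub (D.2.1.inter hA), div_self (Complex.exp_ne_zero _)]
  rw [Filter.EventuallyEq, ae_restrict_iff' hA]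
  filter_upwards [V.ae_tendsto_average hd, V.neBot, V.tendsto_zero] with x hx _ hμ hxA
  have ht := (tendsto_exp_sub_one_div_iff (V.tendsto_setIntegral_zero hd hμ)).2 hx
  simp only [hone, sub_self, zero_div] at ht
  have hdx : A.indicator (f - g) x = 0 := tendsto_nhds_unique ht tendsto_const_nhds
  rwa [Set.indicator_of_mem hxA, Pi.sub_apply, sub_eq_zero] at hdx

end VitaliSystem

end Vitali

/-! ### Multiplicative functionals on step maps -/

namespace StepMap

variable {X : Type v} [MeasurableSpace X] {μ : Measure X} {𝔟 : Type u} [Monoid 𝔟]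

theorem measurableSet_supp (g : StepMap μ 𝔟) : MeasurableSet g.supp :=
  g.measurableSet_preimage {b | b ≠ 1}

open Classical in
/-- The restriction of a step map to a measurable set `A`: it agrees with `g` on `A` and is the
unit elsewhere. -/
def restrict (g : StepMap μ 𝔟) (A : Set X) (hA : MeasurableSet A) : StepMap μ 𝔟 where
  toFun x := if x ∈ A then g x else 1
  countable_range := (g.countable_range.insert 1).mono <| by
    rintro _ ⟨x, rfl⟩
    by_cases h : x ∈ A <;> simp [h]
  measurableSet_fiber c := by
    have hfiber : (fun x => if x ∈ A then g x else 1) ⁻¹' {c} =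
        (A ∩ g ⁻¹' {c}) ∪ (Aᶜ ∩ {_x | (1 : 𝔟) = c}) := by
      ext x
      by_cases h : x ∈ A <;> simp [h]
    rw [hfiber]
    exact (hA.inter (g.measurableSet_fiber c)).union (hA.compl.inter (MeasurableSet.const _))
  support_lt_top := by
    refine (measure_mono fun x hx h => ?_).trans_lt g.support_lt_top
    exact hx (by simp [h])

section Restrict

variable (g : StepMap μ 𝔟) {A : Set X} (hA : MeasurableSet A)

theorem restrict_of_mem {x : X} (h : x ∈ A) : g.restrict A hA x = g x := if_pos h

theorem restrict_of_notMem {x : X} (h : x ∉ A) : g.restrict A hA x = 1 := if_neg h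

theorem supp_restrict : (g.restrict A hA).supp = g.supp ∩ A := by
  ext x
  by_cases h : x ∈ A <;> simp [supp, restrict, h]

theorem restrict_univ : g.restrict Set.univ MeasurableSet.univ = g :=
  ext fun x => g.restrict_of_mem _ (Set.mem_univ x)

theorem restrict_eq_ind {b : 𝔟} (D : IntegrableSet μ) (hg : ∀ x ∈ D.1, g x = b) :
    g.restrict D.1 D.2.1 = ind b D := by
  ext x
  by_cases h : x ∈ D.1
  · rw [restrict_of_mem _ _ h, ind_of_mem _ _ h, hg x h]
  · rw [restrict_of_notMem _ _ h, ind_of_notMem _ _ h]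

theorem isJoin_restrict {A : ℕ → Set X} (hA : ∀ n, MeasurableSet (A n))
    (hd : Pairwise (Disjoint on A)) :
    IsJoin (fun n => g.restrict (A n) (hA n))
      (g.restrict (⋃ n, A n) (MeasurableSet.iUnion hA)) := by
  simp only [IsJoin, supp_restrict]
  refine ⟨fun m n hmn => (hd hmn).mono Set.inter_subset_right Set.inter_subset_right,
    fun n x hx => ?_, fun x hx => ?_⟩
  · rw [restrict_of_mem _ _ hx.2, restrict_of_mem _ _ (Set.mem_iUnion.2 ⟨n, hx.2⟩)]
  · by_cases h : x ∈ ⋃ n, A n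
    · obtain ⟨n, hn⟩ := Set.mem_iUnion.1 h
      rw [restrict_of_mem _ _ h]
      by_contra hne
      exact hx n ⟨hne, hn⟩
    · exact restrict_of_notMem _ _ h

theorem exists_isJoin_ind : ∃ (b : ℕ → 𝔟) (D : ℕ → IntegrableSet μ),
    (∀ n, (D n).1 ⊆ g.supp) ∧ IsJoin (fun n => ind (b n) (D n)) g := by
  obtain ⟨b, hb⟩ := (g.countable_range.insert 1).exists_eq_range (Set.insert_nonempty _ _)
  let L : ℕ → Set X := fun n => g ⁻¹' {b n} ∩ g.supp
  have hL : ∀ n, MeasurableSet (L n) := fun n =>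
    (g.measurableSet_fiber (b n)).inter g.measurableSet_supp
  have hsub : ∀ n, disjointed L n ⊆ L n := disjointed_subset L
  have hsupp : ⋃ n, disjointed L n = g.supp := by
    rw [iUnion_disjointed, ← Set.iUnion_inter]
    rw [Set.inter_eq_right]
    intro x _
    obtain ⟨n, hn⟩ : g x ∈ Set.range b := hb ▸ Set.mem_insert_of_mem _ ⟨x, rfl⟩
    exact Set.mem_iUnion.2 ⟨n, hn.symm⟩
  let D : ℕ → IntegrableSet μ := fun n => ⟨disjointed L n, MeasurableSet.disjointed hL n,
    (measure_mono ((hsub n).trans Set.inter_subset_right)).trans_lt g.support_lt_top⟩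
  have hjoin := g.isJoin_restrict (fun n => (D n).2.1) (disjoint_disjointed L)
  have hg : g.restrict (⋃ n, (D n).1) (MeasurableSet.iUnion fun n => (D n).2.1) = g := by
    ext x
    by_cases h : x ∈ ⋃ n, (D n).1
    · exact restrict_of_mem _ _ h
    · rw [restrict_of_notMem _ _ h]
      rw [hsupp] at h
      exact (not_not.1 h).symm
  rw [hg] at hjoin
  simp only [fun n => g.restrict_eq_ind (D n) fun _ hx => (hsub n hx).1] at hjoin
  exact ⟨b, D, fun n => (hsub n).trans Set.inter_subset_right, hjoin⟩

end Restrict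

end StepMap

theorem isVitaliDerivative_exp_sub_one_iff {X : Type v} [MeasurableSpace X] {μ : Measure X}
    {𝔟 : Type u} {V : VitaliSystem μ} {l l' : X → 𝔟 → ℂ}
    (hl : ∀ (D : IntegrableSet μ) b, IntegrableOn (fun x => l x b) D.1 μ) :
    IsVitaliDerivative V (fun D b => Complex.exp (∫ x in D.1, l x b ∂μ) - 1) l' ↔
      IsVitaliDerivative V (fun D b => ∫ x in D.1, l x b ∂μ) l' := by
  refine eventually_congr ?_
  filter_upwards [V.tendsto_zero] with x hx
  exact forall_congr' fun b => tendsto_exp_sub_one_div_iff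
    (V.tendsto_setIntegral_zero (fun D => hl D b) hx)

section Density

variable {X : Type v} [MeasurableSpace X] {μ : Measure X} {𝔟 : Type u} [Monoid 𝔟]

/-- Nowhere vanishing absolutely continuous functionals that turn joins into infinite products:
what conditions (i) and (ii) share besides positivity. -/
structure IsMultiplicative (φ : StepMap μ 𝔟 → ℂ) : Prop where
  tendsto_prod : ∀ (g : ℕ → StepMap μ 𝔟) (h : StepMap μ 𝔟), StepMap.IsJoin g h →
    Tendsto (fun N => ∏ n ∈ Finset.range N, φ (g n)) atTop (𝓝 (φ h))
  ne_zero : ∀ g, φ g ≠ 0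
  apply_ind_of_null : ∀ (D : IntegrableSet μ) (b : 𝔟), μ D.1 = 0 → φ (StepMap.ind b D) = 1

variable {V : VitaliSystem μ} {φ : StepMap μ 𝔟 → ℂ}

namespace IsMultiplicative

theorem apply_of_null (h : IsMultiplicative φ) {g : StepMap μ 𝔟} (hg : μ g.supp = 0) :
    φ g = 1 := by
  obtain ⟨b, D, hD, hjoin⟩ := g.exists_isJoin_ind
  refine tendsto_nhds_unique (h.tendsto_prod _ _ hjoin) ?_
  simp only [fun n => h.apply_ind_of_null (D n) (b n) (measure_mono_null (hD n) hg),
    Finset.prod_const_one, tendsto_const_nhds]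

open Classical in
theorem isMultiplicativeMeasure (h : IsMultiplicative φ) (g : StepMap μ 𝔟) :
    IsMultiplicativeMeasure (μ.restrict g.supp)
      (fun A => if hA : MeasurableSet A then φ (g.restrict A hA) else 1) where
  tendsto_prod A hA hd := by
    simp only [hA, MeasurableSet.iUnion hA, dif_pos]
    exact h.tendsto_prod _ _ (g.isJoin_restrict hA hd)
  ne_zero A hA := by
    simp only [hA, dif_pos]
    exact h.ne_zero _
  null A hA hμA := by
    simp only [hA, dif_pos]
    refine h.apply_of_null ?_
    rwa [StepMap.supp_restrict, Set.inter_comm, ← Measure.restrict_apply hA]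

theorem exists_density (h : IsMultiplicative φ) (V : VitaliSystem μ) (g : StepMap μ 𝔟) :
    ∃ ρ : X → ℂ, Integrable ρ μ ∧
      ∀ A (hA : MeasurableSet A), φ (g.restrict A hA) = Complex.exp (∫ x in A, ρ x ∂μ) := by
  have : IsFiniteMeasure (μ.restrict g.supp) :=
    isFiniteMeasure_restrict.2 g.support_lt_top.ne
  obtain ⟨ρ, hρ, hexp⟩ := (h.isMultiplicativeMeasure g).exists_density fun δ hδ =>
    V.exists_finite_partition g.support_lt_top hδ
  refine ⟨g.supp.indicator ρ, (integrable_indicator_iff g.measurableSet_supp).2 hρ,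
    fun A hA => ?_⟩
  have hA' := hexp A hA
  rwa [dif_pos hA, Measure.restrict_restrict hA, ← setIntegral_indicator g.measurableSet_supp]
    at hA'

end IsMultiplicative

theorem exists_density_of_forall_exists_density [SigmaFinite μ] (V : VitaliSystem μ)
    {Ψ : IntegrableSet μ → ℂ}
    (h : ∀ D : IntegrableSet μ, ∃ ρ : X → ℂ, IntegrableOn ρ D.1 μ ∧
      ∀ A : IntegrableSet μ, A.1 ⊆ D.1 → Ψ A = Complex.exp (∫ x in A.1, ρ x ∂μ)) :
    ∃ r : X → ℂ, ∀ D : IntegrableSet μ, IntegrableOn r D.1 μ ∧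
      Ψ D = Complex.exp (∫ x in D.1, r x ∂μ) := by
  choose ρ hρ hexp using h
  let S : ℕ → IntegrableSet μ := fun n => ⟨disjointed (spanningSets μ) n,
    MeasurableSet.disjointed (measurableSet_spanningSets μ) n,
    (measure_mono (disjointed_subset _ n)).trans_lt (measure_spanningSets_lt_top μ n)⟩
  have hρS : ∀ (D : IntegrableSet μ) n, ρ D =ᵐ[μ.restrict (D.1 ∩ (S n).1)] ρ (S n) := by
    intro D n
    refine V.ae_eq_of_exp_setIntegral_eq (D.2.1.inter (S n).2.1)
      ((hρ D).mono_set Set.inter_subset_left) ((hρ (S n)).mono_set Set.inter_subset_right)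
      fun B hB hBm => ?_
    let B' : IntegrableSet μ :=
      ⟨B, hBm, (measure_mono (hB.trans Set.inter_subset_left)).trans_lt D.2.2⟩
    rw [← hexp D B' (hB.trans Set.inter_subset_left),
      ← hexp (S n) B' (hB.trans Set.inter_subset_right)]
  let r : X → ℂ := fun x => ρ (S (spanningSetsIndex μ x)) x
  have hr : ∀ D : IntegrableSet μ, ρ D =ᵐ[μ.restrict D.1] r := by
    intro D
    have hall : ∀ᵐ x ∂μ, ∀ n, x ∈ D.1 ∩ (S n).1 → ρ D x = ρ (S n) x :=
      ae_all_iff.2 fun n => (ae_restrict_iff' (D.2.1.inter (S n).2.1)).1 (hρS D n)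
    refine (ae_restrict_iff' D.2.1).2 ?_
    filter_upwards [hall] with x hx hxD
    exact hx _ ⟨hxD, mem_disjointed_spanningSetsIndex μ x⟩
  exact ⟨r, fun D => ⟨(hρ D).congr (hr D),
    (hexp D D subset_rfl).trans (by rw [integral_congr_ae (hr D)])⟩⟩

namespace IsMultiplicative

variable [SigmaFinite μ] {l : X → 𝔟 → ℂ}

theorem integrableOn_and_exp_setIntegral (h : IsMultiplicative φ)
    (hl : IsVitaliDerivative V (fun D b => φ (StepMap.ind b D) - 1) l) (D : IntegrableSet μ)
    (b : 𝔟) : IntegrableOn (fun x => l x b) D.1 μ ∧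
      φ (StepMap.ind b D) = Complex.exp (∫ x in D.1, l x b ∂μ) := by
  have hlocal : ∀ D : IntegrableSet μ, ∃ ρ : X → ℂ, IntegrableOn ρ D.1 μ ∧
      ∀ A : IntegrableSet μ, A.1 ⊆ D.1 →
        φ (StepMap.ind b A) = Complex.exp (∫ x in A.1, ρ x ∂μ) := by
    intro D
    obtain ⟨ρ, hρ, hexp⟩ := h.exists_density V (StepMap.ind b D)
    refine ⟨ρ, hρ.integrableOn, fun A hAD => ?_⟩
    rw [← hexp A.1 A.2.1, StepMap.restrict_eq_ind _ A fun x hx => StepMap.ind_of_mem b D (hAD hx)]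
  obtain ⟨r, hr⟩ := exists_density_of_forall_exists_density V hlocal
  have hlr : (fun x => l x b) =ᵐ[μ] r := by
    filter_upwards [hl, V.neBot, V.tendsto_zero, V.ae_tendsto_average fun D => (hr D).1]
      with x hx hne hμ hav
    refine tendsto_nhds_unique (hx b) ?_
    simp only [fun D : IntegrableSet μ => (hr D).2]
    exact (tendsto_exp_sub_one_div_iff
      (V.tendsto_setIntegral_zero (fun D => (hr D).1) hμ)).2 hav
  have hlrD : (fun x => l x b) =ᵐ[μ.restrict D.1] r := ae_restrict_of_ae hlr
  exact ⟨(hr D).1.congr hlrD.symm,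
    (hr D).2.trans (congrArg Complex.exp (integral_congr_ae hlrD.symm))⟩

theorem ae_eq_density (h : IsMultiplicative φ)
    (hl : IsVitaliDerivative V (fun D b => φ (StepMap.ind b D) - 1) l) {g : StepMap μ 𝔟}
    {ρ : X → ℂ} (hρ : Integrable ρ μ)
    (hexp : ∀ A (hA : MeasurableSet A),
      φ (g.restrict A hA) = Complex.exp (∫ x in A, ρ x ∂μ)) :
    ρ =ᵐ[μ] fun x => l x (g x) := by
  have hlevel : ∀ b n, ∀ᵐ x ∂μ, x ∈ g ⁻¹' {b} ∩ spanningSets μ n → ρ x = l x b := by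
    intro b n
    let D : IntegrableSet μ := ⟨g ⁻¹' {b} ∩ spanningSets μ n,
      (g.measurableSet_fiber b).inter (measurableSet_spanningSets μ n),
      (measure_mono Set.inter_subset_right).trans_lt (measure_spanningSets_lt_top μ n)⟩
    refine (ae_restrict_iff' D.2.1).1 (V.ae_eq_of_exp_setIntegral_eq D.2.1 hρ.integrableOn
      (h.integrableOn_and_exp_setIntegral hl D b).1 fun B hB hBm => ?_)
    let B' : IntegrableSet μ := ⟨B, hBm, (measure_mono hB).trans_lt D.2.2⟩
    rw [← hexp B hBm, g.restrict_eq_ind B' fun x hx => (hB hx).1]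
    exact (h.integrableOn_and_exp_setIntegral hl B' b).2
  have hall : ∀ᵐ x ∂μ, ∀ b ∈ Set.range g, ∀ n, x ∈ g ⁻¹' {b} ∩ spanningSets μ n → ρ x = l x b :=
    (ae_ball_iff g.countable_range).2 fun b _ => ae_all_iff.2 (hlevel b)
  filter_upwards [hall] with x hx
  exact hx (g x) ⟨x, rfl⟩ _ ⟨rfl, mem_spanningSetsIndex μ x⟩

theorem isLogDensity (h : IsMultiplicative φ)
    (hl : IsVitaliDerivative V (fun D b => φ (StepMap.ind b D) - 1) l) :
    IsLogDensity V φ l where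
  integrable g := by
    obtain ⟨ρ, hρ, hexp⟩ := h.exists_density V g
    exact hρ.congr (h.ae_eq_density hl hρ hexp)
  exp_eq g := by
    obtain ⟨ρ, hρ, hexp⟩ := h.exists_density V g
    rw [integralFunctional, ← integral_congr_ae (h.ae_eq_density hl hρ hexp), ← setIntegral_univ,
      ← hexp _ MeasurableSet.univ, g.restrict_univ]
  derivative := by
    have hlD := h.integrableOn_and_exp_setIntegral hl
    simp only [fun D b => (hlD D b).2] at hl
    exact (isVitaliDerivative_exp_sub_one_iff fun D b => (hlD D b).1).1 hl

end IsMultiplicative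

end Density

/-! ### Positive definite and conditionally positive definite functionals -/

section Positivity

variable {ι : Type*}

theorem posSemidef_vecMulVec_star (a : ι → ℂ) : (Matrix.vecMulVec a (star a)).PosSemidef := by
  refine ⟨?_, fun x => ?_⟩
  · rw [Matrix.IsHermitian, Matrix.conjTranspose_vecMulVec, star_star]
  · have hsq : (x.sum fun i r => x.sum fun j t =>
        star r * Matrix.vecMulVec a (star a) i j * t) =
        star (x.sum fun j t => star (a j) * t) * x.sum fun j t => star (a j) * t := by
      simp only [Finsupp.sum, star_sum, Finset.sum_mul_sum, Matrix.vecMulVec_apply, Pi.star_apply,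
        star_mul, star_star, mul_assoc]
    rw [hsq]
    exact star_mul_self_nonneg _

theorem posSemidef_map_pow {K : Matrix ι ι ℂ} (hK : K.PosSemidef) (n : ℕ) :
    (K.map (· ^ n)).PosSemidef := by
  induction n with
  | zero =>
    have hone : K.map (· ^ 0) = Matrix.vecMulVec 1 (star 1) := by
      ext i j
      simp [Matrix.vecMulVec_apply]
    rw [hone]
    exact posSemidef_vecMulVec_star 1
  | succ n ih =>
    have hsucc : K.map (· ^ (n + 1)) = (K.map (· ^ n)).hadamard K := by
      ext i j
      simp [pow_succ]
    rw [hsucc]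
    exact ih.hadamard hK

theorem posSemidef_map_exp {K : Matrix ι ι ℂ} (hK : K.PosSemidef) :
    (K.map Complex.exp).PosSemidef := by
  refine ⟨?_, fun x => ?_⟩
  · ext i j
    simp [← Complex.exp_conj, ← hK.1.apply i j]
  · have hsum : HasSum
        (fun n : ℕ => x.sum fun i r => x.sum fun j t => star r * (K i j ^ n / n.factorial) * t)
        (x.sum fun i r => x.sum fun j t => star r * K.map Complex.exp i j * t) := by
      refine hasSum_sum fun i _ => hasSum_sum fun j _ => ((HasSum.mul_left _ ?_).mul_right _)
      rw [Matrix.map_apply, Complex.exp_eq_exp_ℂ]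
      exact NormedSpace.expSeries_div_hasSum_exp (K i j)
    refine hsum.nonneg fun n => ?_
    have hn : ((n.factorial : ℝ)⁻¹ • K.map (· ^ n)).PosSemidef :=
      (posSemidef_map_pow hK n).smul (by positivity)
    refine (hn.2 x).trans_eq (Finsupp.sum_congr fun i _ => Finsupp.sum_congr fun j _ => ?_)
    simp [div_eq_inv_mul]

theorem sum_sum_mapRange_conj (Q : Matrix ι ι ℂ) (κ : ι →₀ ℂ) :
    ((κ.mapRange conj (map_zero _)).sum fun i r => (κ.mapRange conj (map_zero _)).sum fun j t =>
      star r * Q i j * t) = κ.sum fun i r => κ.sum fun j t => r * Q i j * conj t := by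
  simp [Finsupp.sum_mapRange_index]

variable {M : Type w}

theorem sum_sum_mapDomain (f : ι → M) (κ : ι →₀ ℂ) (Q : M → M → ℂ) :
    ((κ.mapDomain f).sum fun a r => (κ.mapDomain f).sum fun c t => r * Q a c * conj t) =
      κ.sum fun i r => κ.sum fun j t => r * Q (f i) (f j) * conj t := by
  simp [Finsupp.sum_mapDomain_index, add_mul, mul_add]

variable [Monoid M] [StarMul M]

theorem IsState.sum_comp_nonneg {φ : M → ℂ} (h : IsState φ) (f : ι → M) (κ : ι →₀ ℂ) :
    0 ≤ κ.sum fun i r => κ.sum fun j t => r * φ (f i * star (f j)) * conj t :=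
  (h.2 (κ.mapDomain f)).trans_eq (sum_sum_mapDomain f κ fun a c => φ (a * star c))

theorem IsCumulant.sum_comp_nonneg {lam : M → ℂ} (h : IsCumulant lam) (f : ι → M) (κ : ι →₀ ℂ)
    (hκ : (κ.sum fun _ r => r) = 0) :
    0 ≤ κ.sum fun i r => κ.sum fun j t => r * lam (f i * star (f j)) * conj t :=
  (h.1 (κ.mapDomain f) (by
    change ((κ.mapDomain f).sum fun _ r => r) = 0
    rwa [Finsupp.sum_mapDomain_index (fun _ => rfl) fun _ _ _ => rfl])).trans_eq
      (sum_sum_mapDomain f κ fun a c => lam (a * star c))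

theorem IsState.star_eq {φ : M → ℂ} (h : IsState φ) (b : M) : φ (star b) = conj (φ b) := by
  have him : ∀ c : Fin 2 → ℂ, (∑ i, ∑ j, c i * φ (![1, b] i * star (![1, b] j)) * conj (c j)).im =
      0 := by
    intro c
    have hc := h.sum_comp_nonneg ![1, b] (Finsupp.equivFunOnFinite.symm c)
    simp only [Finsupp.sum_fintype, zero_mul, mul_zero, map_zero, Finset.sum_const_zero,
      implies_true, Finsupp.equivFunOnFinite_symm_apply_apply] at hc
    exact (Complex.nonneg_iff.1 hc).2.symm
  have hbb : (φ (b * star b)).im = 0 := by simpa using him ![0, 1]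
  have hone : (φ (star b)).im + (φ b).im = 0 := by simpa [h.1, hbb] using him ![1, 1]
  have hI : -(φ (star b)).re + (φ b).re = 0 := by simpa [h.1, hbb] using him ![1, Complex.I]
  refine Complex.ext ?_ ?_
  · rw [Complex.conj_re]
    linarith
  · rw [Complex.conj_im]
    linarith

theorem IsState.isCumulant_sub_one {φ : M → ℂ} (h : IsState φ) :
    IsCumulant fun b => φ b - 1 := by
  refine ⟨fun κ hκ => (h.2 κ).trans_eq ?_, by simp [h.1], fun b => by simp [h.star_eq b]⟩
  have hzero : ∑ a ∈ κ.support, ∑ c ∈ κ.support, κ a * conj (κ c) = 0 := by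
    rw [← Finset.sum_mul_sum, hκ, zero_mul]
  simp only [mul_sub, sub_mul, mul_one, Finset.sum_sub_distrib, hzero, sub_zero]

theorem IsCumulant.zero : IsCumulant fun _ : M => (0 : ℂ) :=
  ⟨fun κ _ => by simp, rfl, fun b => by simp⟩

/-- The kernel `lam (a * star c) - lam a - lam (star c)` attached to a functional on a
`⋆`-monoid; it is positive definite when `lam` is a cumulant functional. -/
def cumulantKernel (lam : M → ℂ) : Matrix M M ℂ :=
  Matrix.of fun a c => lam (a * star c) - lam a - lam (star c)

theorem IsCumulant.posSemidef_cumulantKernel {lam : M → ℂ} (h : IsCumulant lam) :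
    (cumulantKernel lam).PosSemidef := by
  refine ⟨?_, fun x => ?_⟩
  · ext a c
    simp only [cumulantKernel, Matrix.conjTranspose_apply, Matrix.of_apply, star_sub,
      Complex.star_def, ← h.2.2, star_mul, star_star]
    ring
  · obtain ⟨y, rfl⟩ : ∃ y : M →₀ ℂ, y.mapRange conj (map_zero _) = x :=
      ⟨x.mapRange conj (map_zero _), by ext; simp⟩
    let κ : M →₀ ℂ := y - Finsupp.single 1 (y.sum fun _ r => r)
    have hκ : (κ.sum fun _ r => r) = 0 := by simp [κ, Finsupp.sum_sub_index]
    refine (h.1 κ hκ).trans_eq ?_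
    rw [sum_sum_mapRange_conj]
    change (κ.sum fun a r => κ.sum fun c t => r * lam (a * star c) * conj t) = _
    simp only [κ, Finsupp.sum_sub_index, sub_mul, mul_sub, map_sub, Finsupp.sum_single_index,
      zero_mul, mul_zero, map_zero, forall_const, Finsupp.sum_sub, star_one, mul_one, one_mul,
      h.2.1, sub_zero, Finsupp.sum_fun_zero, cumulantKernel, Matrix.of_apply]
    simp only [Finsupp.sum, map_sum, Finset.mul_sum, Finset.sum_mul]
    rw [Finset.sum_comm (f := fun c a => y a * lam (star c) * conj (y c))]
    ring

theorem isCumulant_of_posSemidef_cumulantKernel {lam : M → ℂ}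
    (hpos : (cumulantKernel lam).PosSemidef) (hone : lam 1 = 0)
    (hstar : ∀ b, lam (star b) = conj (lam b)) : IsCumulant lam := by
  refine ⟨fun κ hκ => ?_, hone, hstar⟩
  have hconj : ∑ c ∈ κ.support, conj (κ c) = 0 := by rw [← map_sum, hκ, map_zero]
  refine ((hpos.2 _).trans_eq (sum_sum_mapRange_conj _ κ)).trans_eq ?_
  have hright : ∑ a ∈ κ.support, ∑ c ∈ κ.support, κ a * lam a * conj (κ c) = 0 := by
    rw [← Finset.sum_mul_sum, hconj, mul_zero]
  have hleft : ∑ a ∈ κ.support, ∑ c ∈ κ.support, κ a * lam (star c) * conj (κ c) = 0 := by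
    simp only [mul_assoc, ← Finset.sum_mul_sum, hκ, zero_mul]
  simp only [Finsupp.sum, cumulantKernel, Matrix.of_apply, mul_sub, sub_mul,
    Finset.sum_sub_distrib, hright, hleft, sub_zero]

theorem IsCumulant.isState_exp {lam : M → ℂ} (h : IsCumulant lam) :
    IsState fun b => Complex.exp (lam b) := by
  have hfactor : (Matrix.of fun a c => Complex.exp (lam (a * star c))) =
      (Matrix.vecMulVec (fun a => Complex.exp (lam a))
        (star fun a => Complex.exp (lam a))).hadamard ((cumulantKernel lam).map Complex.exp) := by
    ext a c
    simp only [cumulantKernel, Matrix.of_apply, Matrix.hadamard_apply, Matrix.vecMulVec_apply,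
      Pi.star_apply, Complex.star_def, ← Complex.exp_conj, ← h.2.2, Matrix.map_apply,
      ← Complex.exp_add]
    congr 1
    ring
  have hpos : (Matrix.of fun a c => Complex.exp (lam (a * star c))).PosSemidef := by
    rw [hfactor]
    exact (posSemidef_vecMulVec_star _).hadamard (posSemidef_map_exp h.posSemidef_cumulantKernel)
  exact ⟨by simp [h.2.1], fun κ => (hpos.2 _).trans_eq (sum_sum_mapRange_conj _ κ)⟩

theorem IsState.comp {N : Type*} [Monoid N] [StarMul N] {φ : M → ℂ} (h : IsState φ) (f : N →* M)
    (hf : ∀ b, f (star b) = star (f b)) : IsState fun b => φ (f b) := by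
  refine ⟨by simp [h.1], fun κ => ?_⟩
  simp only [map_mul, hf]
  exact h.sum_comp_nonneg f κ

theorem IsCumulant.comp {N : Type*} [Monoid N] [StarMul N] {lam : M → ℂ} (h : IsCumulant lam)
    (f : N →* M) (hf : ∀ b, f (star b) = star (f b)) : IsCumulant fun b => lam (f b) := by
  refine ⟨fun κ hκ => ?_, by simp [h.2.1], fun b => by simp only [hf, h.2.2]⟩
  simp only [map_mul, hf]
  exact h.sum_comp_nonneg f κ hκ

end Positivity

section Derivative

variable {X : Type v} [MeasurableSpace X] {μ : Measure X} {𝔟 : Type u} [Monoid 𝔟] [StarMul 𝔟]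

theorem IsVitaliDerivative.ae_isCumulant {V : VitaliSystem μ} {ν : IntegrableSet μ → 𝔟 → ℂ}
    {l : X → 𝔟 → ℂ} (hl : IsVitaliDerivative V ν l) (hν : ∀ D, IsCumulant (ν D)) :
    ∀ᵐ x ∂μ, IsCumulant (l x) := by
  filter_upwards [hl, V.neBot] with x hx hne
  refine ⟨fun κ hκ => ?_, tendsto_nhds_unique (hx 1) ?_, fun b => ?_⟩
  · refine ge_of_tendsto' (tendsto_finsetSum _ fun a _ => tendsto_finsetSum _ fun c _ =>
      ((hx _).const_mul (κ a)).mul_const (conj (κ c))) fun D => ?_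
    have hform : ∑ a ∈ κ.support, ∑ c ∈ κ.support,
        κ a * (ν D (a * star c) / (μ.real D.1 : ℂ)) * conj (κ c) =
        (∑ a ∈ κ.support, ∑ c ∈ κ.support, κ a * ν D (a * star c) * conj (κ c)) /
          (μ.real D.1 : ℂ) := by
      simp only [Finset.sum_div, mul_div_assoc', div_mul_eq_mul_div]
    rw [hform]
    exact div_nonneg ((hν D).1 κ hκ) (Complex.zero_le_real.2 measureReal_nonneg)
  · simp [(hν _).2.1]
  · refine tendsto_nhds_unique (hx (star b)) ?_
    refine ((Complex.continuous_conj.tendsto _).comp (hx b)).congr fun D => ?_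
    simp [(hν D).2.2 b]

theorem isCumulant_integralFunctional {l : X → 𝔟 → ℂ}
    (hint : ∀ g : StepMap μ 𝔟, Integrable (fun x => l x (g x)) μ)
    (hl : ∀ᵐ x ∂μ, IsCumulant (l x)) : IsCumulant (integralFunctional μ l) := by
  refine ⟨fun κ hκ => ?_, integral_eq_zero_of_ae (hl.mono fun x hx => hx.2.1), fun g => ?_⟩
  · have hi : ∀ a c : StepMap μ 𝔟,
        Integrable (fun x => κ a * l x ((a * star c) x) * conj (κ c)) μ :=
      fun a c => ((hint _).const_mul _).mul_const _
    have hform : ∫ x, ∑ a ∈ κ.support, ∑ c ∈ κ.support,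
        κ a * l x ((a * star c) x) * conj (κ c) ∂μ = ∑ a ∈ κ.support, ∑ c ∈ κ.support,
          κ a * integralFunctional μ l (a * star c) * conj (κ c) := by
      rw [integral_finsetSum _ fun a _ => integrable_finsetSum _ fun c _ => hi a c]
      refine Finset.sum_congr rfl fun a _ => ?_
      rw [integral_finsetSum _ fun c _ => hi a c]
      simp only [integral_mul_const, integral_const_mul, integralFunctional]
    rw [← hform]
    refine integral_nonneg_of_ae ?_
    filter_upwards [hl] with x hx using hx.sum_comp_nonneg (fun g : StepMap μ 𝔟 => g x) κ hκ
  · refine Eq.trans (integral_congr_ae ?_) integral_conj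
    filter_upwards [hl] with x hx using hx.2.2 _

end Derivative

/-! ### Integral functionals and symmetries -/

namespace StepMap

variable {X : Type v} [MeasurableSpace X] {μ : Measure X} {𝔟 : Type u} [Monoid 𝔟]
  (D : IntegrableSet μ)

/-- The homomorphism `b ↦ b_D` that embeds `𝔟` into the step maps. -/
def indHom : 𝔟 →* StepMap μ 𝔟 where
  toFun b := ind b D
  map_one' := by
    ext x
    simp [ind]
  map_mul' a b := by
    ext x
    by_cases h : x ∈ D.1 <;> simp [ind, h]

theorem indHom_star [StarMul 𝔟] (b : 𝔟) : indHom D (star b) = star (indHom D b) := by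
  ext x
  by_cases h : x ∈ D.1 <;> simp [indHom, ind, h]

end StepMap

section LogDensity

variable {X : Type v} [MeasurableSpace X] {μ : Measure X} {𝔟 : Type u} [Monoid 𝔟]
  {V : VitaliSystem μ} {φ : StepMap μ 𝔟 → ℂ} {l : X → 𝔟 → ℂ}

theorem integralFunctional_eq_setIntegral (hl1 : ∀ᵐ x ∂μ, l x 1 = 0) (g : StepMap μ 𝔟)
    {A : Set X} (hA : ∀ x ∉ A, g x = 1) :
    integralFunctional μ l g = ∫ x in A, l x (g x) ∂μ := by
  refine (setIntegral_eq_integral_of_ae_compl_eq_zero ?_).symm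
  filter_upwards [hl1] with x hx hxA
  rw [hA x hxA, hx]

theorem integralFunctional_ind (hl1 : ∀ᵐ x ∂μ, l x 1 = 0) (b : 𝔟) (D : IntegrableSet μ) :
    integralFunctional μ l (StepMap.ind b D) = ∫ x in D.1, l x b ∂μ :=
  (integralFunctional_eq_setIntegral hl1 _ fun _ hx => StepMap.ind_of_notMem b D hx).trans <|
    setIntegral_congr_fun D.2.1 fun x hx => congrArg (l x) (StepMap.ind_of_mem b D hx)

namespace IsLogDensity

theorem integrableOn (h : IsLogDensity V φ l) (D : IntegrableSet μ) (b : 𝔟) :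
    IntegrableOn (fun x => l x b) D.1 μ :=
  (h.integrable (StepMap.ind b D)).integrableOn.congr_fun
    (fun x hx => congrArg (l x) (StepMap.ind_of_mem b D hx)) D.2.1

theorem congr {l' : X → 𝔟 → ℂ} (h : IsLogDensity V φ l) (hl : ∀ᵐ x ∂μ, ∀ b, l x b = l' x b) :
    IsLogDensity V φ l' where
  integrable g := (h.integrable g).congr (hl.mono fun x hx => hx (g x))
  exp_eq g := by
    rw [← h.exp_eq g]
    exact congrArg Complex.exp (integral_congr_ae (hl.mono fun x hx => (hx (g x)).symm))
  derivative := by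
    filter_upwards [h.derivative, hl] with x hx hxl b
    rw [← hxl b]
    refine (hx b).congr fun D => ?_
    rw [integral_congr_ae (ae_restrict_of_ae (hl.mono fun y hy => hy b))]

theorem isVitaliDerivative_sub_one (h : IsLogDensity V φ l) (hl1 : ∀ᵐ x ∂μ, l x 1 = 0) :
    IsVitaliDerivative V (fun D b => φ (StepMap.ind b D) - 1) l := by
  simp only [← h.exp_eq, integralFunctional_ind hl1]
  exact (isVitaliDerivative_exp_sub_one_iff h.integrableOn).2 h.derivative

end IsLogDensity

end LogDensity

namespace Symmetry

variable {S : Type w} [Semigroup S] {X : Type v} [MeasurableSpace X] {μ : Measure X}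
  {𝔟 : Type u} [Monoid 𝔟] [StarMul 𝔟] (σ : Symmetry S μ 𝔟)

theorem map_restrict (s : S) {D : Set X} (hD : MeasurableSet D) :
    (μ.restrict D).map (σ.act s) = μ.restrict (σ.act s '' D) := by
  have he := σ.measurableEmbedding s
  ext A hA
  rw [he.map_apply, Measure.restrict_apply (he.measurable hA), Measure.restrict_apply hA,
    ← σ.measure_image s ((he.measurable hA).inter hD), Set.image_preimage_inter]

theorem map_act (s : S) : μ.map (σ.act s) = μ.restrict (Set.range (σ.act s)) := by
  simpa only [Measure.restrict_univ, Set.image_univ] using σ.map_restrict s MeasurableSet.univ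

theorem ae_act (s : S) {p : X → Prop} (h : ∀ᵐ y ∂μ, p y) : ∀ᵐ x ∂μ, p (σ.act s x) := by
  rw [← (σ.measurableEmbedding s).ae_map_iff, σ.map_act]
  exact ae_restrict_of_ae h

theorem shift_act (s : S) (g : StepMap μ 𝔟) (x : X) : σ.shift s g (σ.act s x) = σ.θ s (g x) :=
  σ.shiftFun_act s g x

theorem shift_of_notMem (s : S) (g : StepMap μ 𝔟) {y : X} (hy : y ∉ Set.range (σ.act s)) :
    σ.shift s g y = 1 :=
  σ.shiftFun_of_notMem s g hy

theorem shift_ind (s : S) (b : 𝔟) (D : IntegrableSet μ) :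
    σ.shift s (StepMap.ind b D) = StepMap.ind (σ.θ s b) (σ.image s D) := by
  have hinj := (σ.measurableEmbedding s).injective
  ext y
  by_cases hy : y ∈ Set.range (σ.act s)
  · obtain ⟨x, rfl⟩ := hy
    rw [shift_act]
    by_cases hx : x ∈ D.1
    · rw [StepMap.ind_of_mem _ _ hx]
      exact (StepMap.ind_of_mem _ (σ.image s D) (Set.mem_image_of_mem _ hx)).symm
    · rw [StepMap.ind_of_notMem _ _ hx, map_one]
      exact (StepMap.ind_of_notMem _ (σ.image s D) (hinj.mem_set_image.not.2 hx)).symm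
  · rw [σ.shift_of_notMem s _ hy]
    exact (StepMap.ind_of_notMem _ (σ.image s D) fun h => hy (Set.image_subset_range _ _ h)).symm

theorem measureReal_image (s : S) (D : IntegrableSet μ) :
    μ.real (σ.image s D).1 = μ.real D.1 :=
  congrArg ENNReal.toReal (σ.measure_image s D.2.1)

/-- The symmetry `s` carries the measure `ν` to the measure `ν'` on its range. It covers at once
the whole measure `μ` and its restrictions to integrable sets. -/
structure Transports (s : S) (ν ν' : Measure X) : Prop where
  absolutelyContinuous : ν ≪ μ
  map_eq : ν.map (σ.act s) = ν'.restrict (Set.range (σ.act s))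

theorem transports (s : S) : σ.Transports s μ μ := ⟨.rfl, σ.map_act s⟩

theorem transports_image (s : S) (D : IntegrableSet μ) :
    σ.Transports s (μ.restrict D.1) (μ.restrict (σ.image s D).1) where
  absolutelyContinuous := Measure.absolutelyContinuous_of_le Measure.restrict_le_self
  map_eq := by
    rw [σ.map_restrict s D.2.1,
      Measure.restrict_restrict (σ.measurableEmbedding s).measurableSet_range]
    exact congrArg μ.restrict (Set.inter_eq_right.2 (Set.image_subset_range _ _)).symm

theorem ae_mem_range (s : S) (D : IntegrableSet μ) :
    ∀ᵐ y ∂μ.restrict (σ.image s D).1, y ∈ Set.range (σ.act s) :=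
  (ae_restrict_mem (σ.image s D).2.1).mono fun _ hy => Set.image_subset_range _ _ hy

namespace Transports

variable {σ} {s : S} {ν ν' : Measure X}

theorem ae (h : σ.Transports s ν ν') {p : X → Prop} (hact : ∀ᵐ x ∂ν, p (σ.act s x))
    (hcompl : ∀ᵐ y ∂ν', y ∉ Set.range (σ.act s) → p y) : ∀ᵐ y ∂ν', p y := by
  have hrange : ∀ᵐ y ∂ν', y ∈ Set.range (σ.act s) → p y := by
    rwa [← ae_restrict_iff' (σ.measurableEmbedding s).measurableSet_range, ← h.map_eq,
      (σ.measurableEmbedding s).ae_map_iff]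
  filter_upwards [hrange, hcompl] with y hy hy' using (em _).elim hy hy'

theorem integral_eq (h : σ.Transports s ν ν') {F : X → ℂ}
    (hF : ∀ᵐ y ∂ν', y ∉ Set.range (σ.act s) → F y = 0) :
    ∫ y, F y ∂ν' = ∫ x, F (σ.act s x) ∂ν := by
  rw [← setIntegral_eq_integral_of_ae_compl_eq_zero hF, ← h.map_eq,
    (σ.measurableEmbedding s).integral_map]

end Transports

variable {σ} {V : VitaliSystem μ} {φ : StepMap μ 𝔟 → ℂ} {l : X → 𝔟 → ℂ}

theorem IsHomogeneous.isCovariantDensity (hφ : σ.IsHomogeneous φ) (hV : σ.Respects V)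
    (hl : IsVitaliDerivative V (fun D b => φ (StepMap.ind b D) - 1) l) :
    σ.IsCovariantDensity l := by
  intro s
  filter_upwards [hl, σ.ae_act s hl, hV s, V.neBot] with x hx hsx hr hne b
  refine tendsto_nhds_unique ?_ (hx b)
  refine ((hsx (σ.θ s b)).comp hr).congr fun D => ?_
  simp only [Function.comp, measureReal_image, ← shift_ind, hφ s]

theorem IsCovariantDensity.isHomogeneous (hl : σ.IsCovariantDensity l)
    (hl1 : ∀ᵐ x ∂μ, l x 1 = 0) : σ.IsHomogeneous (integralFunctional μ l) := fun s g => by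
  refine ((σ.transports s).integral_eq ?_).trans (integral_congr_ae ?_)
  · filter_upwards [hl1] with y hy hrange
    rw [σ.shift_of_notMem s g hrange, hy]
  · filter_upwards [hl s] with x hx
    simp only [shift_act, hx]

theorem IsCovariantDensity.setIntegral_image (hl : σ.IsCovariantDensity l) (s : S)
    (D : IntegrableSet μ) (b : 𝔟) :
    ∫ x in (σ.image s D).1, l x (σ.θ s b) ∂μ = ∫ x in D.1, l x b ∂μ :=
  ((σ.transports_image s D).integral_eq
    ((σ.ae_mem_range s D).mono fun _ hy hy' => absurd hy hy')).trans
    (integral_congr_ae (ae_restrict_of_ae ((hl s).mono fun _ hx => hx b)))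

end Symmetry

/-! ### Cumulant densities -/

section CumulantDensity

variable {X : Type v} [MeasurableSpace X] {μ : Measure X} {𝔟 : Type u} [Monoid 𝔟] [StarMul 𝔟]
  {V : VitaliSystem μ} {φ : StepMap μ 𝔟 → ℂ} {l : X → 𝔟 → ℂ}

/-- A logarithmic density of `φ` that consists of cumulant functionals: the infinitesimal object
to which each of the four conditions is reduced. -/
structure IsCumulantDensity (V : VitaliSystem μ) (φ : StepMap μ 𝔟 → ℂ) (l : X → 𝔟 → ℂ) : Prop
    extends IsLogDensity V φ l where
  isCumulant : ∀ x, IsCumulant (l x)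

open Classical in
theorem IsLogDensity.exists_isCumulantDensity (h : IsLogDensity V φ l)
    (hl : ∀ᵐ x ∂μ, IsCumulant (l x)) : ∃ l', IsCumulantDensity V φ l' := by
  refine ⟨fun x => if IsCumulant (l x) then l x else fun _ => 0, h.congr ?_, fun x => ?_⟩
  · filter_upwards [hl] with x hx b
    rw [if_pos hx]
  · split_ifs with hx
    · exact hx
    · exact IsCumulant.zero

theorem InfinitelyDivisibleState.isMultiplicative (h : InfinitelyDivisibleState V φ) :
    IsMultiplicative φ :=
  ⟨h.chaotic.2, h.ne_zero, h.absolutelyContinuous⟩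

theorem InfinitelyDivisibleState.exists_isCumulantDensity [SigmaFinite μ]
    (h : InfinitelyDivisibleState V φ) : ∃ l, IsCumulantDensity V φ l := by
  obtain ⟨l, hl⟩ := h.exists_derivative
  exact (h.isMultiplicative.isLogDensity hl).exists_isCumulantDensity
    (hl.ae_isCumulant fun D => (h.isState D).isCumulant_sub_one)

section CumulantFunctional

variable {S : Type w} [Semigroup S] {σ : Symmetry S μ 𝔟} {lam : StepMap μ 𝔟 → ℂ}

theorem CumulantFunctional.isMultiplicative (h : CumulantFunctional σ V φ lam l) :
    IsMultiplicative φ where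
  tendsto_prod g f hgf := by
    simpa only [Complex.exp_sum, h.exp_eq] using (h.sigmaAdditive g f hgf).tendsto_sum_nat.cexp
  ne_zero g := h.exp_eq g ▸ Complex.exp_ne_zero _
  apply_ind_of_null D b hD := by rw [← h.exp_eq, h.absolutelyContinuous D b hD, Complex.exp_zero]

theorem CumulantFunctional.exists_isCumulantDensity [SigmaFinite μ]
    (h : CumulantFunctional σ V φ lam l) : ∃ l', IsCumulantDensity V φ l' := by
  have hl : IsVitaliDerivative V (fun D b => φ (StepMap.ind b D) - 1) l := by
    have hlog := h.derivative
    simp only [h.eq_integral] at hlog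
    simp only [← h.exp_eq, h.eq_integral]
    exact (isVitaliDerivative_exp_sub_one_iff h.integrableOn).2 hlog
  exact (h.isMultiplicative.isLogDensity hl).exists_isCumulantDensity
    (h.derivative.ae_isCumulant h.cumulant)

end CumulantFunctional

namespace IsCumulantDensity

theorem apply_one (h : IsCumulantDensity V φ l) (x : X) : l x 1 = 0 := (h.isCumulant x).2.1

theorem integral_ind (h : IsCumulantDensity V φ l) (b : 𝔟) (D : IntegrableSet μ) :
    integralFunctional μ l (StepMap.ind b D) = ∫ x in D.1, l x b ∂μ :=
  integralFunctional_ind (ae_of_all _ h.apply_one) b D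

theorem integral_ind_of_null (h : IsCumulantDensity V φ l) {D : IntegrableSet μ}
    (hD : μ D.1 = 0) (b : 𝔟) : integralFunctional μ l (StepMap.ind b D) = 0 := by
  rw [h.integral_ind, Measure.restrict_eq_zero.2 hD, integral_zero_measure]

theorem isCumulant_integral (h : IsCumulantDensity V φ l) :
    IsCumulant (integralFunctional μ l) :=
  isCumulant_integralFunctional h.integrable (ae_of_all _ h.isCumulant)

theorem isState (h : IsCumulantDensity V φ l) : IsState φ :=
  (funext h.exp_eq : (fun g => Complex.exp (integralFunctional μ l g)) = φ) ▸
    h.isCumulant_integral.isState_exp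

theorem hasSum (h : IsCumulantDensity V φ l) {g : ℕ → StepMap μ 𝔟} {f : StepMap μ 𝔟}
    (hgf : StepMap.IsJoin g f) :
    HasSum (fun n => integralFunctional μ l (g n)) (integralFunctional μ l f) := by
  have hl1 := ae_of_all μ h.apply_one
  have hsum := hasSum_integral_iUnion (fun n => (g n).measurableSet_supp)
    (fun m n hmn => hgf.1 hmn) ((h.integrable f).integrableOn (s := ⋃ n, (g n).supp))
  rw [← integralFunctional_eq_setIntegral hl1 f fun x hx =>
    hgf.2.2 x fun n hn => hx (Set.mem_iUnion.2 ⟨n, hn⟩)] at hsum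
  have hg : ∀ n, integralFunctional μ l (g n) = ∫ x in (g n).supp, l x (f x) ∂μ := fun n =>
    (integralFunctional_eq_setIntegral hl1 (g n) fun _ hx => not_not.1 hx).trans
      (setIntegral_congr_fun (g n).measurableSet_supp fun x hx =>
        congrArg (l x) (hgf.2.1 n x hx).symm)
  simpa only [hg] using hsum

theorem isVitaliDerivative_sub_one (h : IsCumulantDensity V φ l) :
    IsVitaliDerivative V (fun D b => φ (StepMap.ind b D) - 1) l :=
  h.toIsLogDensity.isVitaliDerivative_sub_one (ae_of_all _ h.apply_one)

theorem infinitelyDivisibleState (h : IsCumulantDensity V φ l) :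
    InfinitelyDivisibleState V φ where
  isState D := h.isState.comp (StepMap.indHom D) (StepMap.indHom_star D)
  chaotic := ⟨h.isState, fun g f hgf => by
    simpa only [Complex.exp_sum, h.exp_eq] using (h.hasSum hgf).tendsto_sum_nat.cexp⟩
  ne_zero g := h.exp_eq g ▸ Complex.exp_ne_zero _
  absolutelyContinuous D b hD := by
    rw [← h.exp_eq, h.integral_ind_of_null hD, Complex.exp_zero]
  exists_derivative := ⟨l, h.isVitaliDerivative_sub_one⟩

variable {S : Type w} [Semigroup S] {σ : Symmetry S μ 𝔟}

theorem isCovariantDensity (h : IsCumulantDensity V φ l) (hV : σ.Respects V)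
    (hφ : σ.IsHomogeneous φ) : σ.IsCovariantDensity l :=
  hφ.isCovariantDensity hV h.isVitaliDerivative_sub_one

theorem isHomogeneous (h : IsCumulantDensity V φ l) (hV : σ.Respects V)
    (hφ : σ.IsHomogeneous φ) : σ.IsHomogeneous (integralFunctional μ l) :=
  (h.isCovariantDensity hV hφ).isHomogeneous (ae_of_all _ h.apply_one)

theorem cumulantFunctional (h : IsCumulantDensity V φ l) (hV : σ.Respects V)
    (hφ : σ.IsHomogeneous φ) : CumulantFunctional σ V φ (integralFunctional μ l) l where
  exp_eq := h.exp_eq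
  sigmaAdditive _ _ hgf := h.hasSum hgf
  absolutelyContinuous _ b hD := h.integral_ind_of_null hD b
  homogeneous := h.isHomogeneous hV hφ
  cumulant D := h.isCumulant_integral.comp (StepMap.indHom D) (StepMap.indHom_star D)
  integrableOn := h.toIsLogDensity.integrableOn
  eq_integral D b := h.integral_ind b D
  derivative := by
    simp only [h.integral_ind]
    exact h.derivative
  covariant := h.isCovariantDensity hV hφ

end IsCumulantDensity

end CumulantDensity

/-! ### The canonical triple of a cumulant functional -/

section Span

variable {ι : Type*} {E F : Type*}

theorem exists_linearMap_of_span [AddCommGroup E] [Module ℂ E] [AddCommGroup F] [Module ℂ F]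
    {v : ι → E} {w : ι → F} (hv : Submodule.span ℂ (Set.range v) = ⊤)
    (h : ∀ κ, Finsupp.linearCombination ℂ v κ = 0 → Finsupp.linearCombination ℂ w κ = 0) :
    ∃ T : E →ₗ[ℂ] F, ∀ i, T (v i) = w i := by
  obtain ⟨r, hr⟩ := (Finsupp.linearCombination ℂ v).exists_rightInverse_of_surjective
    ((Finsupp.range_linearCombination ℂ).trans hv)
  refine ⟨Finsupp.linearCombination ℂ w ∘ₗ r, fun i => ?_⟩
  have hi : Finsupp.linearCombination ℂ v (r (v i) - Finsupp.single i 1) = 0 := by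
    rw [map_sub, ← LinearMap.comp_apply, hr]
    simp
  simpa [sub_eq_zero] using h _ hi

variable [NormedAddCommGroup E] [InnerProductSpace ℂ E]

theorem eq_zero_of_forall_inner_eq_zero {v : ι → E}
    (hv : Submodule.span ℂ (Set.range v) = ⊤) {e : E} (h : ∀ i, ⟪e, v i⟫_ℂ = 0) : e = 0 := by
  have he : innerₛₗ ℂ e = 0 := LinearMap.ext_on_range hv h
  exact inner_self_eq_zero.1 (LinearMap.congr_fun he e)

theorem exists_isometric_of_gram [NormedAddCommGroup F] [InnerProductSpace ℂ F]
    {v : ι → E} {w : ι → F} (hv : Submodule.span ℂ (Set.range v) = ⊤)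
    (h : ∀ i j, ⟪w i, w j⟫_ℂ = ⟪v i, v j⟫_ℂ) :
    ∃ T : E →ₗ[ℂ] F, (∀ i, T (v i) = w i) ∧ ∀ e, ‖T e‖ = ‖e‖ := by
  have hnorm (κ : ι →₀ ℂ) :
      ‖Finsupp.linearCombination ℂ w κ‖ = ‖Finsupp.linearCombination ℂ v κ‖ := by
    simp only [norm_eq_sqrt_re_inner (𝕜 := ℂ), Finsupp.linearCombination_apply, Finsupp.sum,
      sum_inner, inner_sum, inner_smul_left, inner_smul_right, h]
  obtain ⟨T, hT⟩ := exists_linearMap_of_span (w := w) hv fun κ hκ => by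
    rw [← norm_eq_zero, hnorm, hκ, norm_zero]
  have hcomp : T ∘ₗ Finsupp.linearCombination ℂ v = Finsupp.linearCombination ℂ w := by
    ext i
    simp [hT]
  refine ⟨T, hT, fun e => ?_⟩
  obtain ⟨κ, rfl⟩ := LinearMap.range_eq_top.1 ((Finsupp.range_linearCombination ℂ).trans hv) e
  rw [← hnorm, ← hcomp, LinearMap.comp_apply]

end Span

theorem exists_inner_eq_of_posSemidef {ι : Type u} {Q : Matrix ι ι ℂ} (hQ : Q.PosSemidef) :
    ∃ (E : Type u) (_ : NormedAddCommGroup E) (_ : InnerProductSpace ℂ E) (k : ι → E),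
      (∀ a c, ⟪k a, k c⟫_ℂ = Q a c) ∧ Submodule.span ℂ (Set.range k) = ⊤ := by
  let K : Matrix ι ι (ℂ →L[ℂ] ℂ) := Q.map fun z => z • 1
  have hK : K.PosSemidef := by
    have hiff := (RKHS.posSemidef_tfae (K := K)).out 0 2
    refine hiff.2 ⟨?_, fun κ => ?_⟩
    · ext a c
      simp [K, ← hQ.1.apply a c]
    · refine (Complex.nonneg_iff.1 (hQ.2 κ)).1.trans_eq ?_
      have hconj (a c : ι) : conj (Q c a) = Q a c := hQ.1.apply a c
      simp [K, hconj, mul_comm]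
  have : Fact K.PosSemidef := ⟨hK⟩
  let v (a : ι) : RKHS.OfKernel K := RKHS.kerFun _ a 1
  refine ⟨Submodule.span ℂ (Set.range v), inferInstance, inferInstance,
    fun a => ⟨v a, Submodule.subset_span ⟨a, rfl⟩⟩, fun a c => ?_, ?_⟩
  · change ⟪v a, v c⟫_ℂ = Q a c
    rw [← RKHS.kernel_inner]
    simpa [K] using hQ.1.apply a c
  · refine Eq.trans ?_ (Submodule.span_span_coe_preimage (s := Set.range v))
    congr 1
    ext
    simp [Subtype.ext_iff]

section Triple

variable {𝔟 : Type u} [Monoid 𝔟] [StarMul 𝔟]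

/-- The cocycle `k` and the representation `j` associated with a cumulant functional `lam`, on a
pre-Hilbert space which is minimal in the sense that the vectors `k b` span it. -/
structure IsTriple {E : Type u} [NormedAddCommGroup E] [InnerProductSpace ℂ E] (lam : 𝔟 → ℂ)
    (k : 𝔟 → E) (j : 𝔟 → E →ₗ[ℂ] E) : Prop where
  lam_one : lam 1 = 0
  lam_star : ∀ b, lam (star b) = conj (lam b)
  inner_k : ∀ a c, ⟪k a, k c⟫_ℂ = lam (star a * c) - lam (star a) - lam c
  span_k : Submodule.span ℂ (Set.range k) = ⊤
  j_k : ∀ g c, j g (k c) = k (g * c) - k g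

theorem IsCumulant.exists_isTriple {lam : 𝔟 → ℂ} (h : IsCumulant lam) :
    ∃ (E : Type u) (_ : NormedAddCommGroup E) (_ : InnerProductSpace ℂ E) (k : 𝔟 → E)
      (j : 𝔟 → E →ₗ[ℂ] E), IsTriple lam k j := by
  obtain ⟨E, _, _, k, hk, hspan⟩ :=
    exists_inner_eq_of_posSemidef (h.posSemidef_cumulantKernel.submatrix star)
  simp only [Matrix.submatrix_apply, cumulantKernel, Matrix.of_apply, star_star] at hk
  have hadj (g a c : 𝔟) :
      ⟪k (g * a) - k g, k c⟫_ℂ = ⟪k a, k (star g * c) - k (star g)⟫_ℂ := by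
    simp only [inner_sub_left, inner_sub_right, hk, star_mul, mul_assoc]
    ring
  -- By `hadj` a null combination of the vectors `k c` is mapped to a vector orthogonal to `E`.
  have hj (g : 𝔟) : ∃ T : E →ₗ[ℂ] E, ∀ c, T (k c) = k (g * c) - k g := by
    refine exists_linearMap_of_span (w := fun c => k (g * c) - k g) hspan fun κ hκ =>
      eq_zero_of_forall_inner_eq_zero hspan fun d => ?_
    rw [← inner_zero_left (k (star g * d) - k (star g)), ← hκ]
    simp only [Finsupp.linearCombination_apply, Finsupp.sum, sum_inner, inner_smul_left, hadj]
  choose j hj using hj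
  exact ⟨E, _, _, k, j, h.2.1, h.2.2, hk, hspan, hj⟩

namespace IsTriple

variable {E : Type u} [NormedAddCommGroup E] [InnerProductSpace ℂ E] {lam : 𝔟 → ℂ}
    {k : 𝔟 → E} {j : 𝔟 → E →ₗ[ℂ] E}

theorem k_one (h : IsTriple lam k j) : k 1 = 0 := by
  rw [← inner_self_eq_zero (𝕜 := ℂ), h.inner_k]
  simp [h.lam_one]

theorem linearMap_ext (h : IsTriple lam k j) {R F : Type*} [Semiring R] {τ : ℂ →+* R}
    [AddCommMonoid F] [Module R F] {T T' : E →ₛₗ[τ] F} (hT : ∀ b, T (k b) = T' (k b)) : T = T' :=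
  LinearMap.ext_on_range h.span_k hT

theorem j_one (h : IsTriple lam k j) : j 1 = LinearMap.id :=
  h.linearMap_ext fun b => by simp [h.j_k, h.k_one]

theorem j_mul (h : IsTriple lam k j) (a b : 𝔟) : j (a * b) = j a ∘ₗ j b :=
  h.linearMap_ext fun c => by simp [h.j_k, mul_assoc]

theorem inner_j_star (h : IsTriple lam k j) (b : 𝔟) (e f : E) :
    ⟪j (star b) e, f⟫_ℂ = ⟪e, j b f⟫_ℂ := by
  have hforms : (innerₛₗ ℂ).comp (j (star b)) = (innerₛₗ ℂ).compl₂ (j b) :=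
    h.linearMap_ext fun a => h.linearMap_ext fun c => by
      simp only [LinearMap.comp_apply, LinearMap.compl₂_apply, innerₛₗ_apply_apply, h.j_k,
        inner_sub_left, inner_sub_right, h.inner_k, star_mul, star_star, mul_assoc]
      ring
  exact LinearMap.congr_fun₂ hforms e f

end IsTriple

end Triple

/-! ### Pre-Hilbert subspaces of direct integrals -/

section DirectIntegral

variable {X : Type v} [MeasurableSpace X] {ν : Measure X}
  {E : X → Type u} [∀ x, NormedAddCommGroup (E x)] [∀ x, InnerProductSpace ℂ (E x)]

theorem cls_eq_iff {ξ η : ∀ x, E x} : cls ν ξ = cls ν η ↔ ∀ᵐ x ∂ν, ξ x = η x := by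
  refine (Submodule.Quotient.eq _).trans ?_
  change (∀ᵐ x ∂ν, ξ x - η x = 0) ↔ _
  simp only [sub_eq_zero]

theorem exists_cls (ξ : SectionClass ν E) : ∃ ζ : ∀ x, E x, cls ν ζ = ξ :=
  Submodule.Quotient.mk_surjective _ ξ

theorem sprod_conj (ξ η : SectionClass ν E) : conj (sprod ξ η) = sprod η ξ := by
  obtain ⟨ξ, rfl⟩ := exists_cls ξ
  obtain ⟨η, rfl⟩ := exists_cls η
  simp only [sprod_cls, ← integral_conj, inner_conj_symm]

theorem sprod_smul_right (c : ℂ) (ξ η : SectionClass ν E) :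
    sprod ξ (c • η) = c * sprod ξ η := by
  obtain ⟨ξ, rfl⟩ := exists_cls ξ
  obtain ⟨η, rfl⟩ := exists_cls η
  rw [sprod_cls, ← integral_const_mul]
  exact integral_congr_ae (ae_of_all _ fun x => inner_smul_right _ _ _)

theorem sprod_smul_left (c : ℂ) (ξ η : SectionClass ν E) :
    sprod (c • ξ) η = conj c * sprod ξ η := by
  rw [← sprod_conj, sprod_smul_right, map_mul, sprod_conj]

theorem sprod_self_nonneg (ξ : SectionClass ν E) : 0 ≤ sprod ξ ξ := by
  obtain ⟨ξ, rfl⟩ := exists_cls ξ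
  exact integral_nonneg fun x => Complex.nonneg_iff.2
    ⟨inner_self_nonneg (𝕜 := ℂ), (inner_self_im (𝕜 := ℂ) (ξ x)).symm⟩

/-- The sections with integrable scalar products with a given section `ξ`. -/
def integrableInner (ν : Measure X) (ξ : ∀ x, E x) : Submodule ℂ (∀ x, E x) where
  carrier := {η | Integrable (fun x => ⟪ξ x, η x⟫_ℂ) ν}
  add_mem' h h' := (h.add h').congr (ae_of_all _ fun _ => (inner_add_right _ _ _).symm)
  zero_mem' := by simp
  smul_mem' c _ h := (h.const_mul c).congr (ae_of_all _ fun _ => (inner_smul_right _ _ _).symm)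

theorem nullSections_le_integrableInner (ξ : ∀ x, E x) :
    nullSections ν E ≤ integrableInner ν ξ := fun η hη =>
  (integrable_zero X ℂ ν).congr
    ((show ∀ᵐ x ∂ν, η x = 0 from hη).mono fun x hx => by simp [hx])

theorem mem_integrableInner_comm {ξ η : ∀ x, E x} :
    η ∈ integrableInner ν ξ ↔ ξ ∈ integrableInner ν η := by
  refine Iff.trans ?_ (LinearIsometryEquiv.integrable_comp_iff (RCLike.conjLIE (K := ℂ)))
  simp [integrableInner]

theorem mem_integrableInner_of_cls_mem_span {ι : Type*} {v : ι → ∀ x, E x} {ξ η : ∀ x, E x}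
    (hξ : ∀ i, v i ∈ integrableInner ν ξ)
    (hη : cls ν η ∈ Submodule.span ℂ (Set.range fun i => cls ν (v i))) :
    η ∈ integrableInner ν ξ := by
  have hspan : Submodule.span ℂ (Set.range fun i => cls ν (v i)) =
      (Submodule.span ℂ (Set.range v)).map (nullSections ν E).mkQ := by
    rw [Submodule.map_span, ← Set.range_comp]
    rfl
  rw [hspan] at hη
  have hsup : η ∈ nullSections ν E ⊔ Submodule.span ℂ (Set.range v) := by
    rw [← Submodule.comap_map_mkQ]
    exact hη
  exact sup_le (nullSections_le_integrableInner ξ)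
    (Submodule.span_le.2 (Set.range_subset_iff.2 hξ)) hsup

theorem isPreHilbert_span {ι : Type*} {v : ι → ∀ x, E x}
    (hv : ∀ i j, Integrable (fun x => ⟪v i x, v j x⟫_ℂ) ν) :
    IsPreHilbert (Submodule.span ℂ (Set.range fun i => cls ν (v i))) := fun _ _ hξ hη =>
  mem_integrableInner_of_cls_mem_span (fun i => mem_integrableInner_comm.1
    (mem_integrableInner_of_cls_mem_span (fun j => hv i j) hξ)) hη

namespace IsPreHilbert

variable {K : Submodule ℂ (SectionClass ν E)}

theorem sprod_add_right (hK : IsPreHilbert K) {ξ η ζ : SectionClass ν E} (hξ : ξ ∈ K)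
    (hη : η ∈ K) (hζ : ζ ∈ K) : sprod ξ (η + ζ) = sprod ξ η + sprod ξ ζ := by
  obtain ⟨ξ, rfl⟩ := exists_cls ξ
  obtain ⟨η, rfl⟩ := exists_cls η
  obtain ⟨ζ, rfl⟩ := exists_cls ζ
  rw [sprod_cls, sprod_cls, ← integral_add (hK _ _ hξ hη) (hK _ _ hξ hζ)]
  exact integral_congr_ae (ae_of_all _ fun x => inner_add_right _ _ _)

theorem sprod_add_left (hK : IsPreHilbert K) {ξ η ζ : SectionClass ν E} (hξ : ξ ∈ K)
    (hη : η ∈ K) (hζ : ζ ∈ K) : sprod (ξ + η) ζ = sprod ξ ζ + sprod η ζ := by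
  rw [← sprod_conj, hK.sprod_add_right hζ hξ hη, map_add, sprod_conj, sprod_conj]

/-- The scalar product of a pre-Hilbert subspace as a sesquilinear map. -/
def form (hK : IsPreHilbert K) : K →ₗ⋆[ℂ] K →ₗ[ℂ] ℂ :=
  LinearMap.mk₂'ₛₗ (starRingEnd ℂ) (RingHom.id ℂ)
    (fun ξ η => sprod (ξ : SectionClass ν E) (η : SectionClass ν E))
    (fun ξ η ζ => hK.sprod_add_left ξ.2 η.2 ζ.2)
    (fun c _ _ => sprod_smul_left c _ _)
    (fun ξ η ζ => hK.sprod_add_right ξ.2 η.2 ζ.2)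
    (fun c _ _ => sprod_smul_right c _ _)

theorem form_apply (hK : IsPreHilbert K) (ξ η : K) :
    hK.form ξ η = sprod (ξ : SectionClass ν E) (η : SectionClass ν E) := rfl

theorem form_conj (hK : IsPreHilbert K) (ξ η : K) : conj (hK.form ξ η) = hK.form η ξ :=
  sprod_conj _ _

theorem posSemidef_form {ι : Type*} (hK : IsPreHilbert K) (v : ι → K) :
    (Matrix.of fun a c => hK.form (v a) (v c)).PosSemidef := by
  refine ⟨?_, fun κ => ?_⟩
  · ext a c
    exact hK.form_conj _ _
  · refine (sprod_self_nonneg ((κ.sum fun c r => r • v c : K) : SectionClass ν E)).trans_eq ?_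
    rw [← hK.form_apply]
    simp only [Finsupp.sum, map_sum, LinearMap.sum_apply, LinearMap.map_smulₛₗ hK.form,
      LinearMap.smul_apply, map_smul, smul_eq_mul, Matrix.of_apply, Complex.star_def,
      mul_assoc, mul_comm (κ _), Finset.sum_mul]
    exact Finset.sum_comm

end IsPreHilbert

theorem IsPreHilbert.isCumulant {M : Type*} [Monoid M] [StarMul M] {lam : M → ℂ}
    {K : Submodule ℂ (SectionClass ν E)} (hK : IsPreHilbert K) (k : M → K)
    (hk : ∀ a c, hK.form (k (star a)) (k c) = lam (a * c) - lam a - lam c)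
    (hone : lam 1 = 0) (hstar : ∀ b, lam (star b) = conj (lam b)) : IsCumulant lam := by
  refine isCumulant_of_posSemidef_cumulantKernel ?_ hone hstar
  have hgram : cumulantKernel lam =
      Matrix.of fun a c => hK.form (k (star a)) (k (star c)) := by
    ext a c
    exact (hk a (star c)).symm
  rw [hgram]
  exact hK.posSemidef_form fun a => k (star a)

end DirectIntegral

/-! ### Fields of triples -/

section TripleField

variable {X : Type v} [MeasurableSpace X] {ν : Measure X} {𝔟 : Type u} [Monoid 𝔟] [StarMul 𝔟]
  {E : X → Type u} [∀ x, NormedAddCommGroup (E x)] [∀ x, InnerProductSpace ℂ (E x)]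
  {l : X → 𝔟 → ℂ} {k : ∀ x, 𝔟 → E x} {j : ∀ x, 𝔟 → E x →ₗ[ℂ] E x}

theorem integrable_inner_k (hT : ∀ x, IsTriple (l x) (k x) (j x)) {g h : X → 𝔟}
    (hgh : Integrable (fun x => l x (star (g x) * h x)) ν)
    (hg : Integrable (fun x => l x (star (g x))) ν) (hh : Integrable (fun x => l x (h x)) ν) :
    Integrable (fun x => ⟪k x (g x), k x (h x)⟫_ℂ) ν := by
  simp only [(hT _).inner_k]
  exact (hgh.sub hg).sub hh

theorem sprod_cls_k (hT : ∀ x, IsTriple (l x) (k x) (j x)) {g h : X → 𝔟}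
    (hgh : Integrable (fun x => l x (g x * h x)) ν) (hg : Integrable (fun x => l x (g x)) ν)
    (hh : Integrable (fun x => l x (h x)) ν) :
    sprod (cls ν fun x => k x (star (g x))) (cls ν fun x => k x (h x)) =
      ∫ x, l x (g x * h x) ∂ν - ∫ x, l x (g x) ∂ν - ∫ x, l x (h x) ∂ν := by
  have hsub : Integrable (fun x => l x (g x * h x) - l x (g x)) ν := hgh.sub hg
  rw [sprod_cls, ← integral_sub hgh hg, ← integral_sub hsub hh]
  simp only [(hT _).inner_k, star_star]

theorem cls_k_one (hT : ∀ x, IsTriple (l x) (k x) (j x)) : (cls ν fun x => k x 1) = 0 :=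
  cls_eq_iff.2 (ae_of_all _ fun x => (hT x).k_one)

theorem decomposable_cls_k (hT : ∀ x, IsTriple (l x) (k x) (j x)) (g h : X → 𝔟) :
    decomposable (fun x => j x (g x)) (cls ν fun x => k x (h x)) =
      (cls ν fun x => k x (g x * h x)) - cls ν fun x => k x (g x) :=
  cls_eq_iff.2 (ae_of_all _ fun x => (hT x).j_k (g x) (h x))

theorem decomposable_mul (hT : ∀ x, IsTriple (l x) (k x) (j x)) (g h : X → 𝔟)
    (ξ : SectionClass ν E) : decomposable (fun x => j x (g x * h x)) ξ =
      decomposable (fun x => j x (g x)) (decomposable (fun x => j x (h x)) ξ) := by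
  obtain ⟨ξ, rfl⟩ := exists_cls ξ
  simp only [decomposable_cls, (hT _).j_mul, LinearMap.comp_apply]

theorem decomposable_one (hT : ∀ x, IsTriple (l x) (k x) (j x)) (ξ : SectionClass ν E) :
    decomposable (fun x => j x 1) ξ = ξ := by
  obtain ⟨ξ, rfl⟩ := exists_cls ξ
  simp only [decomposable_cls, (hT _).j_one, LinearMap.id_apply]

theorem sprod_decomposable_star (hT : ∀ x, IsTriple (l x) (k x) (j x)) (g : X → 𝔟)
    (ξ η : SectionClass ν E) :
    sprod (decomposable (fun x => j x (star (g x))) ξ) η =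
      sprod ξ (decomposable (fun x => j x (g x)) η) := by
  obtain ⟨ξ, rfl⟩ := exists_cls ξ
  obtain ⟨η, rfl⟩ := exists_cls η
  simp only [decomposable_cls, sprod_cls, (hT _).inner_j_star]

end TripleField

/-! ### Transport of sections by isometric fibre maps -/

section Push

variable {S : Type w} [Semigroup S] {X : Type v} [MeasurableSpace X] {μ : Measure X}
  {𝔟 : Type u} [Monoid 𝔟] [StarMul 𝔟] {σ : Symmetry S μ 𝔟}
  {E : X → Type u} [∀ x, NormedAddCommGroup (E x)] [∀ x, InnerProductSpace ℂ (E x)]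
  {W : ∀ s x, E x →ₗ[ℂ] E (σ.act s x)} {s : S} {ν ν' : Measure X}

variable (W s) in
/-- The transport `V_s` of sections as a linear map. -/
def pushLinear : (∀ x, E x) →ₗ[ℂ] (∀ x, E x) where
  toFun := push σ W s
  map_add' ξ η := funext fun y => by
    by_cases hy : ∃ x, σ.act s x = y
    · obtain ⟨x, rfl⟩ := hy
      simp only [push_act, Pi.add_apply, map_add]
    · simp only [push_of_notMem σ W s _ hy, Pi.add_apply, add_zero]
  map_smul' c ξ := funext fun y => by
    by_cases hy : ∃ x, σ.act s x = y
    · obtain ⟨x, rfl⟩ := hy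
      simp only [push_act, Pi.smul_apply, map_smul, RingHom.id_apply]
    · simp only [push_of_notMem σ W s _ hy, Pi.smul_apply, smul_zero]

/-- The transport `V_s` of classes of sections along `s`. -/
def pushClass (W : ∀ s x, E x →ₗ[ℂ] E (σ.act s x)) (h : σ.Transports s ν ν') :
    SectionClass ν E →ₗ[ℂ] SectionClass ν' E :=
  Submodule.mapQ _ _ (pushLinear W s) fun ξ hξ =>
    h.ae (p := fun y => push σ W s ξ y = 0)
      (Filter.Eventually.mono hξ fun x hx => by rw [push_act, hx, map_zero])
      (ae_of_all _ fun _ hy => push_of_notMem σ W s ξ hy)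

theorem pushClass_cls (h : σ.Transports s ν ν') (ξ : ∀ x, E x) :
    pushClass W h (cls ν ξ) = cls ν' (push σ W s ξ) := rfl

theorem pushClass_cls_eq (h : σ.Transports s ν ν') {ξ η : ∀ x, E x}
    (hact : ∀ᵐ x ∂ν, W s x (ξ x) = η (σ.act s x))
    (hcompl : ∀ᵐ y ∂ν', y ∉ Set.range (σ.act s) → η y = 0) :
    pushClass W h (cls ν ξ) = cls ν' η := by
  refine cls_eq_iff.2 (h.ae (hact.mono fun x hx => ?_) (hcompl.mono fun y hy hrange => ?_))
  · exact (push_act σ W s ξ x).trans hx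
  · exact (push_of_notMem σ W s ξ hrange).trans (hy hrange).symm

theorem sprod_pushClass (h : σ.Transports s ν ν') (hW : ∀ᵐ x ∂μ, ∀ e, ‖W s x e‖ = ‖e‖)
    (ξ η : SectionClass ν E) : sprod (pushClass W h ξ) (pushClass W h η) = sprod ξ η := by
  obtain ⟨ξ, rfl⟩ := exists_cls ξ
  obtain ⟨η, rfl⟩ := exists_cls η
  rw [pushClass_cls, pushClass_cls, sprod_cls, sprod_cls]
  refine (h.integral_eq (ae_of_all _ fun y hy => ?_)).trans (integral_congr_ae ?_)
  · rw [push_of_notMem σ W s ξ hy, inner_zero_left]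
  · filter_upwards [h.absolutelyContinuous.ae_le hW] with x hx
    rw [push_act, push_act]
    exact (LinearMap.norm_map_iff_inner_map_map (W s x)).1 hx _ _

/-- The fibre maps intertwine the cocycles and are isometric almost everywhere. -/
structure IsCovariantField (σ : Symmetry S μ 𝔟) (k : ∀ x, 𝔟 → E x)
    (W : ∀ s x, E x →ₗ[ℂ] E (σ.act s x)) : Prop where
  isometric : ∀ s, ∀ᵐ x ∂μ, ∀ e, ‖W s x e‖ = ‖e‖
  k_covariant : ∀ s, ∀ᵐ x ∂μ, ∀ b, k (σ.act s x) (σ.θ s b) = W s x (k x b)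

variable {l : X → 𝔟 → ℂ} {k : ∀ x, 𝔟 → E x} {j : ∀ x, 𝔟 → E x →ₗ[ℂ] E x}

theorem exists_isCovariantField (hT : ∀ x, IsTriple (l x) (k x) (j x))
    (hl : σ.IsCovariantDensity l) :
    ∃ W : ∀ s x, E x →ₗ[ℂ] E (σ.act s x), IsCovariantField σ k W := by
  have hex : ∀ s x, ∃ T : E x →ₗ[ℂ] E (σ.act s x),
      (∀ b, l (σ.act s x) (σ.θ s b) = l x b) →
        (∀ b, T (k x b) = k (σ.act s x) (σ.θ s b)) ∧ ∀ e, ‖T e‖ = ‖e‖ := by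
    intro s x
    by_cases h : ∀ b, l (σ.act s x) (σ.θ s b) = l x b
    · obtain ⟨T, hkT⟩ := exists_isometric_of_gram (w := fun b => k (σ.act s x) (σ.θ s b))
        (hT x).span_k fun a c => by
          rw [(hT _).inner_k, (hT x).inner_k, ← σ.θ_star, ← map_mul, h, h, h]
      exact ⟨T, fun _ => hkT⟩
    · exact ⟨0, fun h' => absurd h' h⟩
  choose W hW using hex
  refine ⟨W, fun s => ?_, fun s => ?_⟩
  · filter_upwards [hl s] with x hx using (hW s x hx).2
  · filter_upwards [hl s] with x hx b using ((hW s x hx).1 b).symm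

namespace IsCovariantField

theorem isIsometricRep (hW : IsCovariantField σ k W) (hT : ∀ x, IsTriple (l x) (k x) (j x)) :
    IsIsometricRep σ W := by
  refine ⟨hW.isometric, fun s t ξ => cls_eq_iff.2 ((σ.transports (s * t)).ae ?_ ?_)⟩
  · filter_upwards [hW.k_covariant (s * t), hW.k_covariant t,
      σ.ae_act t (hW.k_covariant s)] with x hst ht hs
    -- `W s (t x) ∘ W t x` lands in `E (s (t x))`, only propositionally equal to `E ((s * t) x)`
    have key : ∀ z, z = σ.act (s * t) x → ∀ T : E x →ₗ[ℂ] E z,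
        (∀ b, T (k x b) = k z (σ.θ (s * t) b)) → push σ W (s * t) ξ z = T (ξ x) := by
      rintro z rfl T hTk
      rw [push_act, (hT x).linearMap_ext (T := W (s * t) x) (T' := T) fun b => by rw [hTk, hst]]
    rw [σ.act_mul, push_act, push_act]
    exact key _ (σ.act_mul s t x).symm (W s (σ.act t x) ∘ₗ W t x) fun b => by
      rw [LinearMap.comp_apply, ← ht, ← hs, σ.θ_mul]
  · refine ae_of_all _ fun y hy => ?_
    rw [push_of_notMem σ W _ ξ hy]
    by_cases hs : y ∈ Set.range (σ.act s)
    · obtain ⟨z, rfl⟩ := hs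
      rw [push_act, push_of_notMem σ W t ξ, map_zero]
      rintro ⟨x, rfl⟩
      exact hy ⟨x, σ.act_mul s t x⟩
    · rw [push_of_notMem σ W s _ hs]

theorem j_covariant (hW : IsCovariantField σ k W) (hT : ∀ x, IsTriple (l x) (k x) (j x)) (s : S) :
    ∀ᵐ x ∂μ, ∀ b, W s x ∘ₗ j x b = j (σ.act s x) (σ.θ s b) ∘ₗ W s x := by
  filter_upwards [hW.k_covariant s] with x hx b
  refine (hT x).linearMap_ext fun c => ?_
  simp only [LinearMap.comp_apply, (hT _).j_k, map_sub, ← hx, map_mul]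

theorem pushClass_cls_k (hW : IsCovariantField σ k W) (hT : ∀ x, IsTriple (l x) (k x) (j x))
    (h : σ.Transports s ν ν') {g g' : X → 𝔟} (hg : ∀ x, g' (σ.act s x) = σ.θ s (g x))
    (hg' : ∀ᵐ y ∂ν', y ∉ Set.range (σ.act s) → g' y = 1) :
    pushClass W h (cls ν fun x => k x (g x)) = cls ν' fun y => k y (g' y) := by
  refine pushClass_cls_eq h ?_ ?_
  · filter_upwards [h.absolutelyContinuous.ae_le (hW.k_covariant s)] with x hx
    rw [hg, hx]
  · filter_upwards [hg'] with y hy hrange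
    rw [hy hrange, (hT y).k_one]

theorem pushClass_decomposable (hW : IsCovariantField σ k W)
    (hT : ∀ x, IsTriple (l x) (k x) (j x)) (h : σ.Transports s ν ν') {g g' : X → 𝔟}
    (hg : ∀ x, g' (σ.act s x) = σ.θ s (g x)) (ξ : SectionClass ν E) :
    pushClass W h (decomposable (fun x => j x (g x)) ξ) =
      decomposable (fun y => j y (g' y)) (pushClass W h ξ) := by
  obtain ⟨ξ, rfl⟩ := exists_cls ξ
  rw [decomposable_cls, pushClass_cls h ξ, decomposable_cls]
  refine pushClass_cls_eq h ?_ (ae_of_all _ fun y hy => ?_)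
  · filter_upwards [h.absolutelyContinuous.ae_le (hW.j_covariant hT s)] with x hx
    rw [push_act, hg]
    exact LinearMap.congr_fun (hx (g x)) (ξ x)
  · rw [push_of_notMem σ W s ξ hy, map_zero]

end IsCovariantField

end Push

/-! ### The pre-Hilbert space of a cocycle -/

section CocycleSpan

variable {X : Type v} [MeasurableSpace X] {ν : Measure X} {𝔟 : Type u}
  {E : X → Type u} [∀ x, NormedAddCommGroup (E x)] [∀ x, InnerProductSpace ℂ (E x)]
  {M : Type*}

/-- The space of sections spanned by the vectors `∫^⊕ k_x(p_m(x)) dν(x)` of a cocycle `k`, for a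
family of fields `p_m : X → 𝔟`. The families in use are all the step maps and all the constants. -/
def cocycleSpan (ν : Measure X) (k : ∀ x, 𝔟 → E x) (p : M → X → 𝔟) :
    Submodule ℂ (SectionClass ν E) :=
  Submodule.span ℂ (Set.range fun m => cls ν fun x => k x (p m x))

theorem cls_mem_cocycleSpan (k : ∀ x, 𝔟 → E x) (p : M → X → 𝔟) (m : M) :
    (cls ν fun x => k x (p m x)) ∈ cocycleSpan ν k p :=
  Submodule.subset_span ⟨m, rfl⟩

variable [Monoid 𝔟] [StarMul 𝔟] [Monoid M] [StarMul M] {p : M →⋆* (X → 𝔟)}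
  {l : X → 𝔟 → ℂ} {k : ∀ x, 𝔟 → E x} {j : ∀ x, 𝔟 → E x →ₗ[ℂ] E x}

theorem isPreHilbert_cocycleSpan (hT : ∀ x, IsTriple (l x) (k x) (j x))
    (hl : ∀ m, Integrable (fun x => l x (p m x)) ν) : IsPreHilbert (cocycleSpan ν k p) := by
  refine isPreHilbert_span fun a c => integrable_inner_k hT ?_ ?_ (hl c)
  · simpa only [map_mul, map_star, Pi.mul_apply, Pi.star_apply] using hl (star a * c)
  · simpa only [map_star, Pi.star_apply] using hl (star a)

theorem decomposable_mem_cocycleSpan (hT : ∀ x, IsTriple (l x) (k x) (j x)) (m : M) :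
    ∀ ξ ∈ cocycleSpan ν k p, decomposable (fun x => j x (p m x)) ξ ∈ cocycleSpan ν k p := by
  refine (Submodule.span_le (p := (cocycleSpan ν k p).comap _)).2 ?_
  rintro _ ⟨c, rfl⟩
  rw [SetLike.mem_coe, Submodule.mem_comap]
  rw [decomposable_cls_k hT]
  refine sub_mem ?_ (cls_mem_cocycleSpan k p m)
  simpa only [map_mul, Pi.mul_apply] using cls_mem_cocycleSpan k p (m * c)

theorem pushClass_mem_cocycleSpan {S : Type w} [Semigroup S] {μ ν' : Measure X}
    {σ : Symmetry S μ 𝔟} {W : ∀ s x, E x →ₗ[ℂ] E (σ.act s x)} {s : S} {τ : M → M}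
    (hW : IsCovariantField σ k W) (hT : ∀ x, IsTriple (l x) (k x) (j x))
    (h : σ.Transports s ν ν') (hτ : ∀ m x, p (τ m) (σ.act s x) = σ.θ s (p m x))
    (hτ' : ∀ m, ∀ᵐ y ∂ν', y ∉ Set.range (σ.act s) → p (τ m) y = 1) :
    ∀ ξ ∈ cocycleSpan ν k p, pushClass W h ξ ∈ cocycleSpan ν' k p := by
  refine (Submodule.span_le (p := (cocycleSpan ν' k p).comap _)).2 ?_
  rintro _ ⟨m, rfl⟩
  rw [SetLike.mem_coe, Submodule.mem_comap]
  rw [hW.pushClass_cls_k hT h (hτ m) (hτ' m)]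
  exact cls_mem_cocycleSpan k p (τ m)

end CocycleSpan

theorem IsCumulantDensity.exists_covariant_triple {S : Type w} [Semigroup S] {X : Type v}
    [MeasurableSpace X] {μ : Measure X} {𝔟 : Type u} [Monoid 𝔟] [StarMul 𝔟] {σ : Symmetry S μ 𝔟}
    {V : VitaliSystem μ} {φ : StepMap μ 𝔟 → ℂ} {l : X → 𝔟 → ℂ} (h : IsCumulantDensity V φ l)
    (hV : σ.Respects V) (hφ : σ.IsHomogeneous φ) :
    ∃ (E : X → Type u) (_ : ∀ x, NormedAddCommGroup (E x)) (_ : ∀ x, InnerProductSpace ℂ (E x))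
      (k : ∀ x, 𝔟 → E x) (j : ∀ x, 𝔟 → E x →ₗ[ℂ] E x) (W : ∀ s x, E x →ₗ[ℂ] E (σ.act s x)),
      (∀ x, IsTriple (l x) (k x) (j x)) ∧ IsCovariantField σ k W := by
  choose E iN iI k j hT using fun x => (h.isCumulant x).exists_isTriple
  obtain ⟨W, hW⟩ := exists_isCovariantField hT (h.isCovariantDensity hV hφ)
  exact ⟨E, iN, iI, k, j, W, hT, hW⟩

/-! ### Canonical triples over the step maps -/

section CanonicalTriple

variable {S : Type w} [Semigroup S] {X : Type v} [MeasurableSpace X] {μ : Measure X}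
  {𝔟 : Type u} [Monoid 𝔟] [StarMul 𝔟] {σ : Symmetry S μ 𝔟} {V : VitaliSystem μ}
  {φ : StepMap μ 𝔟 → ℂ} {l : X → 𝔟 → ℂ}

variable (μ 𝔟) in
/-- The inclusion of the step maps into the `⋆`-monoid of all fields `X → 𝔟`. -/
def StepMap.coeStarHom : StepMap μ 𝔟 →⋆* (X → 𝔟) where
  toFun g := g
  map_one' := rfl
  map_mul' _ _ := rfl
  map_star' _ := rfl

section

variable {E : X → Type u} [∀ x, NormedAddCommGroup (E x)] [∀ x, InnerProductSpace ℂ (E x)]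
  {k : ∀ x, 𝔟 → E x} {j : ∀ x, 𝔟 → E x →ₗ[ℂ] E x} {W : ∀ s x, E x →ₗ[ℂ] E (σ.act s x)}

theorem IsPreHilbert.covec_oper {K : Submodule ℂ (SectionClass μ E)} (hK : IsPreHilbert K)
    (hT : ∀ x, IsTriple (l x) (k x) (j x)) (hk : ∀ g : StepMap μ 𝔟, vec k g ∈ K)
    (f g : StepMap μ 𝔟) {ξ : SectionClass μ E} (hξ : ξ ∈ K) :
    covec k f (oper j g ξ) = covec k (f * g) ξ - covec k g ξ := by
  have hstar : sprod (oper j (star g) (vec k (star f))) ξ = covec k f (oper j g ξ) :=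
    sprod_decomposable_star hT g _ ξ
  have hvec : oper j (star g) (vec k (star f)) = vec k (star (f * g)) - vec k (star g) := by
    rw [star_mul]
    exact decomposable_cls_k hT (star g : StepMap μ 𝔟) (star f : StepMap μ 𝔟)
  rw [← hstar, hvec]
  exact LinearMap.map_sub₂ hK.form ⟨_, hk (star (f * g))⟩ ⟨_, hk (star g)⟩ ⟨ξ, hξ⟩

theorem IsCumulantDensity.canonicalTriple (h : IsCumulantDensity V φ l) (hV : σ.Respects V)
    (hφ : σ.IsHomogeneous φ) (hT : ∀ x, IsTriple (l x) (k x) (j x))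
    (hW : IsCovariantField σ k W) :
    CanonicalTriple σ V φ l k j W (cocycleSpan μ k (StepMap.coeStarHom μ 𝔟)) where
  logDensity := h.toIsLogDensity
  homogeneous := h.isHomogeneous hV hφ
  covariant := h.isCovariantDensity hV hφ
  l_star x := (hT x).lam_star
  l_one x := (hT x).lam_one
  preHilbert := isPreHilbert_cocycleSpan hT h.integrable
  vec_mem := cls_mem_cocycleSpan k (StepMap.coeStarHom μ 𝔟)
  k_one x := (hT x).k_one
  isometricRep := hW.isIsometricRep hT
  push_mem s _ := pushClass_mem_cocycleSpan (p := StepMap.coeStarHom μ 𝔟) (τ := σ.shift s) hW hT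
    (σ.transports s) (σ.shift_act s)
    (fun g => ae_of_all _ fun _ hy => σ.shift_of_notMem s g hy) _
  push_isometric s ξ _ := sprod_pushClass (σ.transports s) (hW.isometric s) (cls μ ξ) (cls μ ξ)
  k_covariant := hW.k_covariant
  covec_vec f g := sprod_cls_k hT (h.integrable (f * g)) (h.integrable f) (h.integrable g)
  j_one x := (hT x).j_one
  oper_mem := decomposable_mem_cocycleSpan (p := StepMap.coeStarHom μ 𝔟) hT
  oper_mul g f ξ _ := decomposable_mul hT g f ξ
  oper_star g ξ _ η _ := sprod_decomposable_star hT g ξ η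
  oper_one ξ _ := decomposable_one hT ξ
  oper_covariant s g ξ _ :=
    hW.pushClass_decomposable hT (σ.transports s) (σ.shift_act s g) (cls μ ξ)
  oper_vec g f := decomposable_cls_k hT g f
  covec_oper f g ξ hξ := (isPreHilbert_cocycleSpan hT h.integrable).covec_oper hT
    (cls_mem_cocycleSpan k (StepMap.coeStarHom μ 𝔟)) f g hξ
  oper_continuous g f := ⟨{f * g}, 1, fun ξ _ => by
    rw [Finset.sum_singleton, one_mul]
    exact le_of_eq (congrArg (fun η => √(sprod η η).re) (decomposable_mul hT f g ξ).symm)⟩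

theorem CanonicalTriple.exists_isCumulantDensity {K : Submodule ℂ (SectionClass μ E)}
    (h : CanonicalTriple σ V φ l k j W K) : ∃ l', IsCumulantDensity V φ l' := by
  have hlam : IsCumulant (integralFunctional μ l) := by
    refine h.preHilbert.isCumulant (fun g => ⟨vec k g, h.vec_mem g⟩) h.covec_vec ?_ fun g => ?_
    · simp only [integralFunctional, StepMap.one_apply, h.l_one, integral_zero]
    · simp only [integralFunctional, ← integral_conj, StepMap.star_apply, h.l_star]
  refine h.logDensity.exists_isCumulantDensity (h.logDensity.derivative.ae_isCumulant fun D => ?_)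
  simp_rw [← integralFunctional_ind (ae_of_all μ h.l_one)]
  exact hlam.comp (StepMap.indHom D) (StepMap.indHom_star D)

end

theorem IsCumulantDensity.exists_canonicalTriple (h : IsCumulantDensity V φ l)
    (hV : σ.Respects V) (hφ : σ.IsHomogeneous φ) :
    ∃ (E : X → Type u) (_ : ∀ x, NormedAddCommGroup (E x)) (_ : ∀ x, InnerProductSpace ℂ (E x))
      (l : X → 𝔟 → ℂ) (k : ∀ x, 𝔟 → E x) (j : ∀ x, 𝔟 → E x →ₗ[ℂ] E x)
      (W : ∀ s x, E x →ₗ[ℂ] E (σ.act s x)) (K : Submodule ℂ (SectionClass μ E)),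
      CanonicalTriple σ V φ l k j W K := by
  obtain ⟨E, iN, iI, k, j, W, hT, hW⟩ := h.exists_covariant_triple hV hφ
  exact ⟨E, iN, iI, l, k, j, W, _, h.canonicalTriple hV hφ hT hW⟩

end CanonicalTriple

/-! ### Triangular operators on `ℂ ⊕ K ⊕ ℂ` -/

section Triangular

variable {X : Type v} [MeasurableSpace X] {ν : Measure X}
  {E : X → Type u} [∀ x, NormedAddCommGroup (E x)] [∀ x, InnerProductSpace ℂ (E x)]
  {K : Submodule ℂ (SectionClass ν E)}

theorem minkowski_eq (hK : IsPreHilbert K) (p q : ℂ × K × ℂ) :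
    minkowski p q = conj p.1 * q.2.2 + hK.form p.2.1 q.2.1 + conj p.2.2 * q.1 := rfl

theorem minkowski_null_vector (hK : IsPreHilbert K) :
    minkowski ((0, 0, 1) : ℂ × K × ℂ) (0, 0, 1) = 0 := by
  simp [minkowski_eq hK]

/-- The triangular operator with rows `(1, ⟨η, ·⟩, c)`, `(0, A, ζ)`, `(0, 0, 1)` on the columns
`(k₋, k∘, k₊)` of the Minkowski space `ℂ ⊕ K ⊕ ℂ`. -/
def triangular (hK : IsPreHilbert K) (η ζ : K) (A : K →ₗ[ℂ] K) (c : ℂ) :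
    Module.End ℂ (ℂ × K × ℂ) :=
  (LinearMap.fst ℂ ℂ (K × ℂ) +
      hK.form η ∘ₗ LinearMap.fst ℂ K ℂ ∘ₗ LinearMap.snd ℂ ℂ (K × ℂ) +
      c • (LinearMap.snd ℂ K ℂ ∘ₗ LinearMap.snd ℂ ℂ (K × ℂ))).prod
    ((A.coprod (LinearMap.toSpanSingleton ℂ K ζ)).prod (LinearMap.snd ℂ K ℂ) ∘ₗ
      LinearMap.snd ℂ ℂ (K × ℂ))

theorem triangular_apply (hK : IsPreHilbert K) (η ζ : K) (A : K →ₗ[ℂ] K) (c : ℂ)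
    (p : ℂ × K × ℂ) : triangular hK η ζ A c p =
      (p.1 + hK.form η p.2.1 + c * p.2.2, A p.2.1 + p.2.2 • ζ, p.2.2) := rfl

theorem minkowski_triangular (hK : IsPreHilbert K) (η ζ : K) (A : K →ₗ[ℂ] K) (c : ℂ) :
    minkowski ((0, 0, 1) : ℂ × K × ℂ) (triangular hK η ζ A c (0, 0, 1)) = c := by
  simp [minkowski_eq hK, triangular_apply]

/-- A `⋆`-representation `A` of a `⋆`-monoid on a pre-Hilbert subspace, with a cocycle `k` whose
coboundary is `lam`: the global counterpart of `IsTriple`. -/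
structure IsPreHilbertTriple {M : Type*} [Monoid M] [StarMul M] (hK : IsPreHilbert K)
    (lam : M → ℂ) (k : M → K) (A : M → K →ₗ[ℂ] K) : Prop where
  lam_one : lam 1 = 0
  lam_star : ∀ b, lam (star b) = conj (lam b)
  form_k : ∀ a b, hK.form (k (star a)) (k b) = lam (a * b) - lam a - lam b
  k_one : k 1 = 0
  oper_k : ∀ a b, A a (k b) = k (a * b) - k a
  oper_mul : ∀ a b, A (a * b) = A a ∘ₗ A b
  oper_one : A 1 = LinearMap.id
  form_oper_star : ∀ b ξ η, hK.form (A (star b) ξ) η = hK.form ξ (A b η)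

namespace IsPreHilbertTriple

variable {M : Type*} [Monoid M] [StarMul M] {hK : IsPreHilbert K} {lam : M → ℂ} {k : M → K}
  {A : M → K →ₗ[ℂ] K}

theorem triangular_mul (h : IsPreHilbertTriple hK lam k A) (a b : M) :
    triangular hK (k (star (a * b))) (k (a * b)) (A (a * b)) (lam (a * b)) =
      triangular hK (k (star a)) (k a) (A a) (lam a) *
        triangular hK (k (star b)) (k b) (A b) (lam b) := by
  refine LinearMap.ext fun p => Prod.ext ?_ (Prod.ext ?_ rfl)
  · simp only [Module.End.mul_apply, triangular_apply, map_add, map_smul, map_sub, h.form_k,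
      ← h.form_oper_star, h.oper_k, LinearMap.sub_apply, star_mul, smul_eq_mul]
    ring
  · simp only [Module.End.mul_apply, triangular_apply, map_add, map_smul, h.oper_k, h.oper_mul,
      LinearMap.comp_apply, smul_sub]
    abel

theorem triangular_one (h : IsPreHilbertTriple hK lam k A) :
    triangular hK (k (star 1)) (k 1) (A 1) (lam 1) = 1 := by
  refine LinearMap.ext fun p => ?_
  simp [triangular_apply, h.k_one, h.lam_one, h.oper_one]

theorem minkowski_triangular_star (h : IsPreHilbertTriple hK lam k A) (b : M)
    (p q : ℂ × K × ℂ) :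
    minkowski (triangular hK (k (star (star b))) (k (star b)) (A (star b)) (lam (star b)) p) q =
      minkowski p (triangular hK (k (star b)) (k b) (A b) (lam b) q) := by
  simp only [minkowski_eq hK, triangular_apply, map_add, map_mul, map_smul, LinearMap.add_apply,
    LinearMap.map_smulₛₗ hK.form, LinearMap.smul_apply, hK.form_conj, h.lam_star, star_star,
    Complex.conj_conj, h.form_oper_star, smul_eq_mul]
  ring

end IsPreHilbertTriple

variable {ν' : Measure X} {K' : Submodule ℂ (SectionClass ν' E)}

/-- The block diagonal operator `diag(1, T, 1)` between Minkowski spaces. -/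
def blockDiag (T : K →ₗ[ℂ] K') : (ℂ × K × ℂ) →ₗ[ℂ] (ℂ × K' × ℂ) :=
  LinearMap.id.prodMap (T.prodMap LinearMap.id)

theorem blockDiag_apply (T : K →ₗ[ℂ] K') (p : ℂ × K × ℂ) :
    blockDiag T p = (p.1, T p.2.1, p.2.2) := rfl

theorem blockDiag_minus (T : K →ₗ[ℂ] K') (p : ℂ × K × ℂ) : (blockDiag T p).1 = p.1 := rfl

theorem blockDiag_plus (T : K →ₗ[ℂ] K') (p : ℂ × K × ℂ) : (blockDiag T p).2.2 = p.2.2 := rfl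

theorem minkowski_blockDiag (hK : IsPreHilbert K) (hK' : IsPreHilbert K') {T : K →ₗ[ℂ] K'}
    (hT : ∀ ξ η, hK'.form (T ξ) (T η) = hK.form ξ η) (p q : ℂ × K × ℂ) :
    minkowski (blockDiag T p) (blockDiag T q) = minkowski p q := by
  rw [minkowski_eq hK, minkowski_eq hK', blockDiag_apply, blockDiag_apply, hT]

theorem blockDiag_triangular (hK : IsPreHilbert K) (hK' : IsPreHilbert K') {T : K →ₗ[ℂ] K'}
    (hT : ∀ ξ η, hK'.form (T ξ) (T η) = hK.form ξ η) {A : K →ₗ[ℂ] K} {A' : K' →ₗ[ℂ] K'}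
    (hA : ∀ ξ, T (A ξ) = A' (T ξ)) (η ζ : K) (c : ℂ) (p : ℂ × K × ℂ) :
    blockDiag T (triangular hK η ζ A c p) = triangular hK' (T η) (T ζ) A' c (blockDiag T p) := by
  simp only [blockDiag_apply, triangular_apply, map_add, map_smul, hA, hT]

end Triangular

/-! ### Minkowski representations over integrable sets -/

section Cocycle

variable {X : Type v} [MeasurableSpace X] {ν : Measure X} {𝔟 : Type u}
  {E : X → Type u} [∀ x, NormedAddCommGroup (E x)] [∀ x, InnerProductSpace ℂ (E x)]
  {l : X → 𝔟 → ℂ} {k : ∀ x, 𝔟 → E x} {j : ∀ x, 𝔟 → E x →ₗ[ℂ] E x} {M : Type*}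

/-- The vector `∫^⊕ k_x(p_m(x)) dν(x)` of the space spanned by a cocycle. -/
def cocycleVec (ν : Measure X) (k : ∀ x, 𝔟 → E x) (p : M → X → 𝔟) (m : M) : cocycleSpan ν k p :=
  ⟨cls ν fun x => k x (p m x), cls_mem_cocycleSpan k p m⟩

theorem coe_cocycleVec (p : M → X → 𝔟) (m : M) :
    (cocycleVec ν k p m : SectionClass ν E) = cls ν fun x => k x (p m x) := rfl

variable [Monoid 𝔟] [StarMul 𝔟] [Monoid M] [StarMul M] {p : M →⋆* (X → 𝔟)}

variable (ν p) in
/-- The decomposable operator `∫^⊕ j_x(p_m(x)) dν(x)` on the space spanned by a cocycle. -/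
def cocycleOper (hT : ∀ x, IsTriple (l x) (k x) (j x)) (m : M) :
    cocycleSpan ν k p →ₗ[ℂ] cocycleSpan ν k p :=
  (decomposable fun x => j x (p m x)).restrict (decomposable_mem_cocycleSpan hT m)

theorem coe_cocycleOper (hT : ∀ x, IsTriple (l x) (k x) (j x)) (m : M)
    (ξ : cocycleSpan ν k p) :
    (cocycleOper ν p hT m ξ : SectionClass ν E) = decomposable (fun x => j x (p m x)) ξ.1 := rfl

theorem isPreHilbertTriple_cocycle (hT : ∀ x, IsTriple (l x) (k x) (j x))
    (hl : ∀ m, Integrable (fun x => l x (p m x)) ν) :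
    IsPreHilbertTriple (isPreHilbert_cocycleSpan hT hl) (fun m => ∫ x, l x (p m x) ∂ν)
      (cocycleVec ν k p) (cocycleOper ν p hT) where
  lam_one := by simp [(hT _).lam_one]
  lam_star b := by simp only [map_star, Pi.star_apply, (hT _).lam_star, integral_conj]
  form_k a b := by
    have hab := hl (a * b)
    simp only [IsPreHilbert.form_apply, cocycleVec, map_mul, map_star, Pi.mul_apply,
      Pi.star_apply] at hab ⊢
    exact sprod_cls_k hT hab (hl a) (hl b)
  k_one := Subtype.ext <| by
    simpa only [Submodule.coe_zero, coe_cocycleVec, map_one, Pi.one_apply] using cls_k_one hT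
  oper_k a b := Subtype.ext <| by
    simpa only [Submodule.coe_sub, coe_cocycleVec, coe_cocycleOper, map_mul,
      Pi.mul_apply] using
      decomposable_cls_k hT (p a) (p b)
  oper_mul a b := LinearMap.ext fun ξ => Subtype.ext <| by
    simpa only [LinearMap.comp_apply, coe_cocycleOper, map_mul, Pi.mul_apply] using
      decomposable_mul hT (p a) (p b) ξ.1
  oper_one := LinearMap.ext fun ξ => Subtype.ext <| by
    simpa only [LinearMap.id_apply, coe_cocycleOper, map_one, Pi.one_apply] using
      decomposable_one hT ξ.1
  form_oper_star b ξ η := by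
    simpa only [IsPreHilbert.form_apply, coe_cocycleOper, map_star, Pi.star_apply] using
      sprod_decomposable_star hT (p b) ξ.1 η.1

end Cocycle

section MinkowskiRep

variable {S : Type w} [Semigroup S] {X : Type v} [MeasurableSpace X] {μ : Measure X}
  {𝔟 : Type u} [Monoid 𝔟] [StarMul 𝔟] {σ : Symmetry S μ 𝔟} {V : VitaliSystem μ}
  {φ : StepMap μ 𝔟 → ℂ} {l : X → 𝔟 → ℂ}

variable (X 𝔟) in
/-- The inclusion of a `⋆`-monoid into its fields over `X`, as the constant fields. -/
def constStarHom : 𝔟 →⋆* (X → 𝔟) where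
  toFun b _ := b
  map_one' := rfl
  map_mul' _ _ := rfl
  map_star' _ := rfl

section

variable {E : X → Type u} [∀ x, NormedAddCommGroup (E x)] [∀ x, InnerProductSpace ℂ (E x)]
  {k : ∀ x, 𝔟 → E x} {j : ∀ x, 𝔟 → E x →ₗ[ℂ] E x} {W : ∀ s x, E x →ₗ[ℂ] E (σ.act s x)}

/-- The transport of the space spanned by the cocycle over an integrable set `D` to that
over `sD`. -/
def cocyclePush (hT : ∀ x, IsTriple (l x) (k x) (j x)) (hW : IsCovariantField σ k W) (s : S)
    (D : IntegrableSet μ) :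
    cocycleSpan (μ.restrict D.1) k (constStarHom X 𝔟) →ₗ[ℂ]
      cocycleSpan (μ.restrict (σ.image s D).1) k (constStarHom X 𝔟) :=
  (pushClass W (σ.transports_image s D)).restrict <| pushClass_mem_cocycleSpan
    (p := constStarHom X 𝔟) (τ := σ.θ s) hW hT (σ.transports_image s D) (fun _ _ => rfl)
    fun _ => (σ.ae_mem_range s D).mono fun _ hy hy' => absurd hy hy'

theorem cocyclePush_vec (hT : ∀ x, IsTriple (l x) (k x) (j x)) (hW : IsCovariantField σ k W)
    (s : S) (D : IntegrableSet μ) (b : 𝔟) :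
    cocyclePush hT hW s D (cocycleVec _ k (constStarHom X 𝔟) b) =
      cocycleVec _ k (constStarHom X 𝔟) (σ.θ s b) :=
  Subtype.ext <| hW.pushClass_cls_k hT (σ.transports_image s D) (fun _ => rfl)
    ((σ.ae_mem_range s D).mono fun _ hy hy' => absurd hy hy')

theorem cocyclePush_oper (hT : ∀ x, IsTriple (l x) (k x) (j x)) (hW : IsCovariantField σ k W)
    (s : S) (D : IntegrableSet μ) (b : 𝔟)
    (ξ : cocycleSpan (μ.restrict D.1) k (constStarHom X 𝔟)) :
    cocyclePush hT hW s D (cocycleOper _ (constStarHom X 𝔟) hT b ξ) =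
      cocycleOper _ (constStarHom X 𝔟) hT (σ.θ s b) (cocyclePush hT hW s D ξ) :=
  Subtype.ext <| hW.pushClass_decomposable hT (σ.transports_image s D) (fun _ => rfl) ξ.1

theorem IsCumulantDensity.minkowskiRep (h : IsCumulantDensity V φ l) (hV : σ.Respects V)
    (hφ : σ.IsHomogeneous φ) (hT : ∀ x, IsTriple (l x) (k x) (j x))
    (hW : IsCovariantField σ k W) :
    MinkowskiRep σ V φ l k j W
      (fun D => cocycleSpan (μ.restrict D.1) k (constStarHom X 𝔟))
      (fun D b => triangular
        (isPreHilbert_cocycleSpan (p := constStarHom X 𝔟) hT (h.toIsLogDensity.integrableOn D))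
        (cocycleVec _ k (constStarHom X 𝔟) (star b)) (cocycleVec _ k (constStarHom X 𝔟) b)
        (cocycleOper _ (constStarHom X 𝔟) hT b) (∫ x in D.1, l x b ∂μ))
      (fun s D => blockDiag (cocyclePush hT hW s D)) := by
  have hK : ∀ D : IntegrableSet μ,
      IsPreHilbert (cocycleSpan (μ.restrict D.1) k (constStarHom X 𝔟)) := fun D =>
    isPreHilbert_cocycleSpan (p := constStarHom X 𝔟) hT (h.toIsLogDensity.integrableOn D)
  have htriple : ∀ D : IntegrableSet μ, IsPreHilbertTriple (hK D)
      (fun b => ∫ x in D.1, l x b ∂μ) (cocycleVec _ k (constStarHom X 𝔟))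
      (cocycleOper _ (constStarHom X 𝔟) hT) := fun D =>
    isPreHilbertTriple_cocycle (p := constStarHom X 𝔟) hT (h.toIsLogDensity.integrableOn D)
  have hpush : ∀ s (D : IntegrableSet μ) ξ η, (hK (σ.image s D)).form (cocyclePush hT hW s D ξ)
      (cocyclePush hT hW s D η) = (hK D).form ξ η := fun s D ξ η =>
    sprod_pushClass (σ.transports_image s D) (hW.isometric s) ξ.1 η.1
  exact
  { logDensity := h.toIsLogDensity
    preHilbert := hK
    map_mul D a b := (htriple D).triangular_mul a b
    map_star D b p q := (htriple D).minkowski_triangular_star b p q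
    map_one D := (htriple D).triangular_one
    row_minus _ _ _ := rfl
    row_circ _ _ _ := rfl
    row_plus _ _ _ := rfl
    corner D b := minkowski_triangular (hK D) _ _ _ _
    null_vector D := minkowski_null_vector (hK D)
    exp_corner D b := by rw [← h.integral_ind, h.exp_eq]
    isometricRep := hW.isIsometricRep hT
    block_minus _ _ p := blockDiag_minus _ p
    block_circ s D p ξ hξ := congrArg (pushClass W (σ.transports_image s D)) hξ
    block_plus _ _ p := blockDiag_plus _ p
    pseudoIsometric s D p q := minkowski_blockDiag (hK D) (hK _) (hpush s D) p q
    intertwines s D b p := by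
      refine (blockDiag_triangular (hK D) (hK _) (hpush s D) (cocyclePush_oper hT hW s D b)
        _ _ _ p).trans ?_
      rw [cocyclePush_vec, cocyclePush_vec, σ.θ_star,
        (h.isCovariantDensity hV hφ).setIntegral_image] }

namespace MinkowskiRep

variable {K : ∀ D : IntegrableSet μ, Submodule ℂ (SectionClass (μ.restrict D.1) E)}
  {J : ∀ D, 𝔟 → Module.End ℂ (ℂ × K D × ℂ)}
  {U : ∀ s D, (ℂ × K D × ℂ) →ₗ[ℂ] (ℂ × K (σ.image s D) × ℂ)}

theorem fst_null_vector (h : MinkowskiRep σ V φ l k j W K J U) (D : IntegrableSet μ) (b : 𝔟) :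
    (J D b (0, 0, 1)).1 = ∫ x in D.1, l x b ∂μ := by
  simpa [minkowski_eq (h.preHilbert D)] using h.corner D b

theorem coe_null_vector (h : MinkowskiRep σ V φ l k j W K J U) (D : IntegrableSet μ) (b : 𝔟) :
    ((J D b (0, 0, 1)).2.1 : SectionClass (μ.restrict D.1) E) = cls _ fun x => k x b := by
  simp [h.row_circ]

theorem isCumulant_setIntegral (h : MinkowskiRep σ V φ l k j W K J U) (D : IntegrableSet μ) :
    IsCumulant fun b => ∫ x in D.1, l x b ∂μ := by
  refine (h.preHilbert D).isCumulant (fun b => (J D b (0, 0, 1)).2.1) (fun a c => ?_) ?_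
    fun b => ?_
  · have hac := h.fst_null_vector D (a * c)
    rw [h.map_mul, Module.End.mul_apply, h.row_minus, h.row_plus, h.fst_null_vector,
      mul_one] at hac
    rw [IsPreHilbert.form_apply, h.coe_null_vector, ← hac]
    ring
  · rw [← h.fst_null_vector, h.map_one, Module.End.one_apply]
  · have hb := (h.map_star D b (0, 0, 1) (0, 0, 1)).trans (h.corner D b)
    simp only [minkowski_eq (h.preHilbert D), h.row_plus, h.fst_null_vector, map_zero, mul_zero,
      mul_one, add_zero] at hb
    rw [← hb, Complex.conj_conj]

theorem exists_isCumulantDensity (h : MinkowskiRep σ V φ l k j W K J U) :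
    ∃ l', IsCumulantDensity V φ l' :=
  h.logDensity.exists_isCumulantDensity
    (h.logDensity.derivative.ae_isCumulant h.isCumulant_setIntegral)

end MinkowskiRep

end

theorem IsCumulantDensity.exists_minkowskiRep (h : IsCumulantDensity V φ l)
    (hV : σ.Respects V) (hφ : σ.IsHomogeneous φ) :
    ∃ (E : X → Type u) (_ : ∀ x, NormedAddCommGroup (E x)) (_ : ∀ x, InnerProductSpace ℂ (E x))
      (l : X → 𝔟 → ℂ) (k : ∀ x, 𝔟 → E x) (j : ∀ x, 𝔟 → E x →ₗ[ℂ] E x)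
      (W : ∀ s x, E x →ₗ[ℂ] E (σ.act s x))
      (K : ∀ D : IntegrableSet μ, Submodule ℂ (SectionClass (μ.restrict D.1) E))
      (J : ∀ D, 𝔟 → Module.End ℂ (ℂ × K D × ℂ))
      (U : ∀ s D, (ℂ × K D × ℂ) →ₗ[ℂ] (ℂ × K (σ.image s D) × ℂ)),
      MinkowskiRep σ V φ l k j W K J U := by
  obtain ⟨E, iN, iI, k, j, W, hT, hW⟩ := h.exists_covariant_triple hV hφ
  exact ⟨E, iN, iI, l, k, j, W, _, _, _, h.minkowskiRep hV hφ hT hW⟩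

end MinkowskiRep

end LevyField

end

universe u v w

open MeasureTheory LevyField in
theorem theorem1 {S : Type w} [Semigroup S]
    {X : Type v} [MeasurableSpace X] (μ : Measure X) [SigmaFinite μ] (hμ : IsAtomless μ)
    {𝔟 : Type u} [Monoid 𝔟] [StarMul 𝔟]
    (σ : Symmetry S μ 𝔟) (V : VitaliSystem μ) (hV : σ.Respects V)
    (φ : StepMap μ 𝔟 → ℂ) (hφ : σ.IsHomogeneous φ) :
    List.TFAE
      [ -- the `φ_D` are absolutely continuous infinitely divisible states with Vitali derivative
        InfinitelyDivisibleState V φ,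
        -- `ln φ` is a covariant absolutely continuous cumulant generating functional
        ∃ (lam : StepMap μ 𝔟 → ℂ) (l : X → 𝔟 → ℂ), CumulantFunctional σ V φ lam l,
        -- canonical triple over a direct integral of pre-Hilbert spaces
        ∃ (E : X → Type u) (_ : ∀ x, NormedAddCommGroup (E x))
          (_ : ∀ x, InnerProductSpace ℂ (E x))
          (l : X → 𝔟 → ℂ) (k : ∀ x, 𝔟 → E x) (j : ∀ x, 𝔟 → E x →ₗ[ℂ] E x)
          (W : ∀ s x, E x →ₗ[ℂ] E (σ.act s x)) (K : Submodule ℂ (SectionClass μ E)),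
          CanonicalTriple σ V φ l k j W K,
        -- covariant triangular representations on the Minkowski spaces `ℂ ⊕ K_D ⊕ ℂ`
        ∃ (E : X → Type u) (_ : ∀ x, NormedAddCommGroup (E x))
          (_ : ∀ x, InnerProductSpace ℂ (E x))
          (l : X → 𝔟 → ℂ) (k : ∀ x, 𝔟 → E x) (j : ∀ x, 𝔟 → E x →ₗ[ℂ] E x)
          (W : ∀ s x, E x →ₗ[ℂ] E (σ.act s x))
          (K : ∀ D : IntegrableSet μ, Submodule ℂ (SectionClass (μ.restrict D.1) E))
          (J : ∀ D, 𝔟 → Module.End ℂ (ℂ × K D × ℂ))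
          (U : ∀ s D, (ℂ × K D × ℂ) →ₗ[ℂ] (ℂ × K (σ.image s D) × ℂ)),
          MinkowskiRep σ V φ l k j W K J U ] := by
  have state_iff : InfinitelyDivisibleState V φ ↔ ∃ l, IsCumulantDensity V φ l :=
    ⟨fun h => h.exists_isCumulantDensity, fun ⟨_, h⟩ => h.infinitelyDivisibleState⟩
  rw [state_iff]
  tfae_have 1 → 2 := fun ⟨l, h⟩ => ⟨_, l, h.cumulantFunctional hV hφ⟩
  tfae_have 2 → 1 := fun ⟨_, _, h⟩ => h.exists_isCumulantDensity
  tfae_have 1 → 3 := fun ⟨_, h⟩ => h.exists_canonicalTriple hV hφ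
  tfae_have 3 → 1 := fun ⟨_, _, _, _, _, _, _, _, h⟩ => h.exists_isCumulantDensity
  tfae_have 1 → 4 := fun ⟨_, h⟩ => h.exists_minkowskiRep hV hφ
  tfae_have 4 → 1 := fun ⟨_, _, _, _, _, _, _, _, _, _, h⟩ => h.exists_isCumulantDensity
  tfae_finish
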